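/- Let $d\ge 1$, let $r,\lambda,L>0$, and let $B=\{x\in\mathbb R^d:\|x\|\le r\}$. Let $(\xi_j)_{j\in\mathbb Z}$ be the points of a homogeneous Poisson process on $\mathbb R^d$ with rate $\lambda$, and let $(v_j)_{j\in\mathbb Z}$ be i.i.d. random vectors in $\mathbb R^d$, independent of $(\xi_j)_{j\in\mathbb Z}$. Let $F$ denote the distribution of the speed $\|v\|$, where $v$ has the common law of the $v_j$, and let $\mu=\mathbb E\|v\|=\int_0^\infty x\,dF(x)$. Put $$N(t)=\sum_{j\in\mathbb Z}\mathbf 1\{\xi_j+v_jt\in B\},\quad t\ge 0,\qquad \rho=\mathbb E N(t)=\lambda\,\mathrm{vol}(B).$$ From the observation $\{N(t):0\le t\le T\}$ form, for $0\le t<T$ and $0<h<T$, $$\hat R(t)=\frac1{T-t}\int_0^{T-t}(N(s)-\rho)(N(t+s)-\rho)\,ds,\qquad \hat\mu_h=-\frac{r\,\mathrm B(\frac{d+1}2,\frac12)}{\rho h^2}\int_0^hK\Big(\frac th\Big)\hat R(t)\,dt,$$ where $\mathrm B(\cdot,\cdot)$ is the beta function and $K:[0,1]\to\mathbb R$ is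 a fixed integrable kernel with $\int_0^1K(x)\,dx=0$, $\int_0^1xK(x)\,dx=1$ and $\int_0^1x^2|K(x)|\,dx<\infty$. Let $\mathscr F(L)$ be the class of distribution functions $F$ on $[0,\infty)$ that are absolutely continuous with a density $f$ differentiable on $(0,\infty)$ such that, for $l=0,1$, $$\sup_{x>0}\big\{(1+x^{l+2})|f^{(l)}(x)|\big\}\le L,\qquad \int_0^\infty x^{l+2}|f^{(l)}(x)|\,dx\le L,$$ and let $$\mathcal R_T[\hat\mu_h;\mathscr F(L)]=\sup_{F\in\mathscr F(L)}\big\{\mathbb E|\hat\mu_h-\mu|^2\big\}^{1/2},$$ where the supremum extends over all velocity laws whose speed distribution $F$ is in $\mathscr F(L)$. Theorem. There is a constant $C>0$ depending only on $d$ such that, for all $\lambda,r,L>0$, every such kernel $K$, and every bandwidth $h_*=h_*(T)$ satisfying $(\ln T)^2/T\le h_*\le 1/(\sqrt T\ln T)$ for all sufficiently large $T$, $$\limsup_{T\to\infty}\Big\{\sqrt T\,\mathcal R_T[\hat\mu_{h_*};\mathscr F(L)]\Big\}\le C\Big(1+\frac1\rho\Big)^{1/2}\big[L(1+L)r\big]^{1/2}.$$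 -/

import Mathlib

open MeasureTheory ProbabilityTheory Filter
open scoped ENNReal

universe u

noncomputable section

namespace Smoluchowski

/-- The random point measure `Ξ = ∑_j ε_{ξ_j}` (a sum of Dirac masses). -/
def pointMeasure {Ω E : Type*} [MeasurableSpace E] (ξ : ℤ → Ω → E) (ω : Ω) : Measure E :=
  Measure.sum fun j => Measure.dirac (ξ j ω)

/-- The random points `ξ_j`, `j ∈ ℤ`, form a homogeneous Poisson process on `ℝ^d` with rate `lam`:
the number of points in a Borel set `A` of finite volume has the Poisson law with mean
`lam * vol A`, and the numbers of points in pairwise disjoint Borel sets are independent. -/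
structure IsHomogeneousPoisson {Ω : Type*} [MeasurableSpace Ω] {d : ℕ} (lam : ℝ) (P : Measure Ω)
    (ξ : ℤ → Ω → EuclideanSpace ℝ (Fin d)) : Prop where
  measurable : ∀ j, Measurable (ξ j)
  law_count : ∀ A : Set (EuclideanSpace ℝ (Fin d)), MeasurableSet A → volume A ≠ ∞ →
    P.map (fun ω => pointMeasure ξ ω A) =
      (poissonMeasure (lam * (volume A).toReal).toNNReal).map (fun k : ℕ => (k : ℝ≥0∞))
  indep_count : ∀ (n : ℕ) (A : Fin n → Set (EuclideanSpace ℝ (Fin d))),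
    (∀ i, MeasurableSet (A i)) → Pairwise (Function.onFun Disjoint A) →
      iIndepFun (fun i ω => pointMeasure ξ ω (A i)) P

/-- The system of particles in undeviated uniform motion: the initial positions `ξ_j` form a
homogeneous Poisson process with rate `lam`, and the velocities `v_j` are i.i.d. with law `G` and
independent of the initial positions. -/
structure IsUndeviatedMotion {Ω : Type*} [MeasurableSpace Ω] {d : ℕ} (lam : ℝ)
    (G : Measure (EuclideanSpace ℝ (Fin d))) (P : Measure Ω)
    (ξ v : ℤ → Ω → EuclideanSpace ℝ (Fin d)) : Prop where
  isProbabilityMeasure : IsProbabilityMeasure P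
  poisson : IsHomogeneousPoisson lam P ξ
  measurable_velocity : ∀ j, Measurable (v j)
  law_velocity : ∀ j, P.map (v j) = G
  indep_velocity : iIndepFun v P
  indep_position_velocity : IndepFun (fun ω j => ξ j ω) (fun ω j => v j ω) P

/-- `N(t) = ∑_j 1{X_t^{(j)} ∈ B}` with `X_t^{(j)} = ξ_j + v_j t` and `B` the closed ball of
radius `r` centred at the origin. -/
def count {Ω : Type*} {d : ℕ} (r : ℝ) (ξ v : ℤ → Ω → EuclideanSpace ℝ (Fin d)) (ω : Ω) (t : ℝ) :
    ℝ≥0∞ :=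
  ∑' j : ℤ, (Metric.closedBall (0 : EuclideanSpace ℝ (Fin d)) r).indicator
    (fun _ => (1 : ℝ≥0∞)) (ξ j ω + t • v j ω)

/-- `ρ = E N(t) = lam * vol B`. -/
def meanCount (d : ℕ) (lam r : ℝ) : ℝ :=
  lam * (volume (Metric.closedBall (0 : EuclideanSpace ℝ (Fin d)) r)).toReal

/-- The covariance estimator
`R̂(t) = (T - t)⁻¹ ∫_0^{T-t} (N(s) - ρ) (N(t+s) - ρ) ds` computed from a path `N` on `[0, T]`. -/
def covEstimator (ρ T : ℝ) (N : ℝ → ℝ) (t : ℝ) : ℝ :=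
  1 / (T - t) * ∫ s in (0 : ℝ)..(T - t), (N s - ρ) * (N (t + s) - ρ)

/-- The estimator
`μ̂_h = - r B((d+1)/2, 1/2) / (ρ h²) ∫_0^h K(t/h) R̂(t) dt` of the mean speed, computed from a
path `N` on `[0, T]`. -/
def meanSpeedEstimator (d : ℕ) (r ρ : ℝ) (K : ℝ → ℝ) (h T : ℝ) (N : ℝ → ℝ) : ℝ :=
  -(r * ProbabilityTheory.beta (((d : ℝ) + 1) / 2) (1 / 2) / (ρ * h ^ 2)) *
    ∫ t in (0 : ℝ)..h, K (t / h) * covEstimator ρ T N t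

/-- The conditions on the kernel `K : [0,1] → ℝ` (values outside `[0,1]` play no role). -/
structure IsKernel (K : ℝ → ℝ) : Prop where
  integrableOn : IntegrableOn K (Set.Icc 0 1)
  integral_eq_zero : ∫ x in (0 : ℝ)..1, K x = 0
  integral_mul_eq_one : ∫ x in (0 : ℝ)..1, x * K x = 1
  integrableOn_sq_mul_abs : IntegrableOn (fun x => x ^ 2 * |K x|) (Set.Icc 0 1)

/-- The class `𝓕(L)` of speed distributions on `[0, ∞)`, as probability measures on `ℝ`: those
with a differentiable density `f` on `(0, ∞)` such that, for `l = 0, 1`,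
`sup_{x > 0} (1 + x^(l+2)) |f^(l)(x)| ≤ L` and `∫_0^∞ x^(l+2) |f^(l)(x)| dx ≤ L`. -/
def speedClass (L : ℝ) : Set (Measure ℝ) :=
  {F | IsProbabilityMeasure F ∧ ∃ f : ℝ → ℝ,
    (∀ x, 0 < x → 0 ≤ f x) ∧
    F = (volume.restrict (Set.Ioi 0)).withDensity (fun x => ENNReal.ofReal (f x)) ∧
    (∀ x, 0 < x → DifferentiableAt ℝ f x) ∧
    ∀ l : ℕ, l ≤ 1 →
      (∀ x, 0 < x → (1 + x ^ (l + 2)) * |iteratedDeriv l f x| ≤ L) ∧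
      ∫⁻ x in Set.Ioi (0 : ℝ), ENNReal.ofReal (x ^ (l + 2) * |iteratedDeriv l f x|)
        ≤ ENNReal.ofReal L}

/-- The root mean squared error of the estimator of `μ = E‖v‖ = ∫ x dF(x)` when the speed
distribution is `F`: the largest value of `(E |μ̂_h - μ|²)^{1/2}` over all velocity laws `G` for
which `‖v‖` has law `F`, and over all realizations of the particle system. -/
def rmse (d : ℕ) (lam r : ℝ) (K : ℝ → ℝ) (h T : ℝ) (F : Measure ℝ) : ℝ≥0∞ :=
  ⨆ (G : Measure (EuclideanSpace ℝ (Fin d))) (_ : G.map (fun w => ‖w‖) = F)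
    (Ω : Type u) (_ : MeasurableSpace Ω) (P : Measure Ω)
    (ξ : ℤ → Ω → EuclideanSpace ℝ (Fin d)) (v : ℤ → Ω → EuclideanSpace ℝ (Fin d))
    (_ : IsUndeviatedMotion lam G P ξ v),
    eLpNorm (fun ω =>
      meanSpeedEstimator d r (meanCount d lam r) K h T (fun t => (count r ξ v ω t).toReal)
        - ∫ x, x ∂F) 2 P

/-- The maximal risk `𝓡_T[μ̂_h; 𝓕(L)] = sup_{F ∈ 𝓕(L)} (E_F |μ̂_h - μ|²)^{1/2}`. -/
def maxRisk (d : ℕ) (lam r L : ℝ) (K : ℝ → ℝ) (h T : ℝ) : ℝ≥0∞ :=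
  ⨆ F ∈ speedClass L, rmse.{u} d lam r K h T F

end Smoluchowski

end

/-!
A particle started at `x` with velocity `v ≠ 0` either misses the ball or is inside exactly during a
time interval `[a, b]` (`mem_closedBall_iff_mem_transit`). The marked points `(ξ_j, v_j)` have the
factorial moments of a Poisson process with intensity `Λ = lam • volume ⊗ G`
(`IsUndeviatedMotion.factorialMoment`), and under `Λ` the entry times and the exit times both have
the constant rate `m = lam * crossSection d r * E‖v‖` (`isTransitFlow_intensity`). With
`β = beta ((d + 1) / 2) (1 / 2)`, the volume of the ball is `crossSection d r * (r * β)`, hence the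
mean speed is `r * β / ρ * m`, so it is enough to estimate `m`.

Write `M(s) = N(s) - ρ`, and let `n` be the number of entries and exits during `(0, T]`; its mean is
`2 T m` and its variance at most `4 T m`. Polarization gives
`2 M(s) M(s + t) = M(s)² + M(s + t)² - (M(s + t) - M(s))²`. In the squared increment the
contribution of single particles integrates over `s` to `t n`, apart from the particles with a
transit shorter than `t` or with an entry or exit close to an end of the observation period. The
contribution of pairs of distinct particles is centred; its covariance at times `s`, `s'` is twice
the square of the covariance of the increments, which makes its integral negligible
(`lintegral_integral_offDiag_sq_le`). Hence `R̂(t) = ∫ M² / T - t n / (2 T)` up to an error that is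
small compared with `t T ^ (-1/2)` in mean square, uniformly in the speed distribution
(`enorm_covEstimator_sub_le`, `lintegral_errBound_sq_le`). The kernel annihilates the constant and
extracts the slope (`IsKernel.enorm_integral_add_slope_le`), so the estimator is
`r * β / ρ * n / (2 T)` up to `o(T ^ (-1/2))` in mean square. The variance of `n` then bounds `T`
times the mean squared error by a multiple of `r E‖v‖ / ρ`, and `E‖v‖ ≤ 1 + L ≤ 2 L (1 + L)` on the
class of speed distributions.

The class enters only through the second moment of the speed, the absence of an atom at zero and
`1 ≤ 2 L`; no expansion of the covariance function is needed.
-/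

open MeasureTheory ProbabilityTheory Filter
open scoped ENNReal

namespace Smoluchowski

/-! ### Factorial moments of the marked Poisson process -/

section FactorialMoments

lemma lintegral_descFactorial_poissonMeasure (r : NNReal) (m : ℕ) :
    ∫⁻ n, (n.descFactorial m : ℝ≥0∞) ∂(poissonMeasure r) = (r : ℝ≥0∞) ^ m := by
  rw [poissonMeasure, lintegral_sum_measure]
  simp only [lintegral_smul_measure, lintegral_dirac, smul_eq_mul]
  have hsupp : Function.support (fun n : ℕ =>
      ENNReal.ofReal (Real.exp (-r) * (r : ℝ) ^ n / (n.factorial : ℝ)) *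
        (n.descFactorial m : ℝ≥0∞)) ⊆ Set.range (fun k : ℕ => k + m) := by
    intro n hn
    have : m ≤ n := by
      by_contra h
      apply hn
      simp [Nat.descFactorial_of_lt (not_le.1 h)]
    exact ⟨n - m, Nat.sub_add_cancel this⟩
  rw [← (add_left_injective m).tsum_eq hsupp]
  have hterm : ∀ k : ℕ, ENNReal.ofReal (Real.exp (-r) * (r : ℝ) ^ (k + m) /
      ((k + m).factorial : ℝ)) * ((k + m).descFactorial m : ℝ≥0∞) =
      (r : ℝ≥0∞) ^ m * ENNReal.ofReal (Real.exp (-r) * (r : ℝ) ^ k / (k.factorial : ℝ)) := by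
    intro k
    have h1 : (r : ℝ≥0∞) ^ m = ENNReal.ofReal ((r : ℝ) ^ m) := by
      rw [ENNReal.ofReal_pow r.coe_nonneg, ENNReal.ofReal_coe_nnreal]
    have h2 : ((k + m).descFactorial m : ℝ≥0∞) =
        ENNReal.ofReal ((k + m).descFactorial m : ℝ) := by simp
    rw [h1, h2, ← ENNReal.ofReal_mul (by positivity), ← ENNReal.ofReal_mul (by positivity)]
    congr 1
    have h3 : ((k + m).factorial : ℝ) = (k.factorial : ℝ) * ((k + m).descFactorial m : ℝ) := by
      have := Nat.factorial_mul_descFactorial (Nat.le_add_left m k)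
      rw [Nat.add_sub_cancel] at this
      exact_mod_cast this.symm
    have h4 : ((k + m).descFactorial m : ℝ) ≠ 0 := by
      have : (k + m).descFactorial m ≠ 0 := by
        rw [Ne, Nat.descFactorial_eq_zero_iff_lt]; omega
      exact_mod_cast this
    have h5 : (k.factorial : ℝ) ≠ 0 := by positivity
    rw [h3]
    field_simp
    ring
  simp_rw [hterm]
  rw [ENNReal.tsum_mul_left]
  have h1 : ∑' k : ℕ, ENNReal.ofReal (Real.exp (-r) * (r : ℝ) ^ k / (k.factorial : ℝ)) = 1 := by
    rw [← ENNReal.ofReal_tsum_of_nonneg (fun k => by positivity)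
      (hasSum_one_poissonMeasure r).summable, (hasSum_one_poissonMeasure r).tsum_eq,
      ENNReal.ofReal_one]
  rw [h1, mul_one]

lemma pointMeasure_apply_eq_encard {Ω E : Type*} [MeasurableSpace E] (ξ : ℤ → Ω → E) (ω : Ω)
    {A : Set E} (hA : MeasurableSet A) :
    pointMeasure ξ ω A = (({j | ξ j ω ∈ A} : Set ℤ).encard : ℝ≥0∞) := by
  rw [pointMeasure, Measure.sum_apply _ hA]
  simp only [Measure.dirac_apply' _ hA]
  rw [← ENNReal.tsum_set_one, tsum_subtype _ fun _ => (1 : ℝ≥0∞)]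
  rfl

/-- The injective maps that send each `i` into `S (a i)`, for disjoint sets `S c`, are the families
of injective maps from the fibres of `a` to the sets `S c`. -/
def embeddingsIntoDisjointEquiv {ι κ α : Type*} (S : κ → Set α)
    (hS : Pairwise (Function.onFun Disjoint S)) (a : ι → κ) :
    {j : ι ↪ α // ∀ i, j i ∈ S (a i)} ≃ ∀ c, ({i // a i = c} ↪ S c) where
  toFun j c := ⟨fun i => ⟨j.1 i.1, by have := j.2 i.1; rwa [i.2] at this⟩, fun i i' h =>
    Subtype.ext (j.1.injective (congrArg Subtype.val h))⟩
  invFun g := ⟨⟨fun i => (g (a i) ⟨i, rfl⟩ : α), by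
    intro i i' h
    have hc : a i = a i' := by
      by_contra hne
      exact Set.disjoint_left.1 (hS hne) (g (a i) ⟨i, rfl⟩).2
        (by simp only at h; rw [h]; exact (g (a i') ⟨i', rfl⟩).2)
    have key : ∀ c (hi : a i = c) (hi' : a i' = c),
        ((g c ⟨i, hi⟩ : S c) : α) = g c ⟨i', hi'⟩ → i = i' := by
      intro c hi hi' hh
      have := (g c).injective (Subtype.ext hh)
      simpa using this
    apply key (a i') hc rfl
    have tr : ∀ c (hi : a i = c), ((g c ⟨i, hi⟩ : S c) : α) = g (a i) ⟨i, rfl⟩ := by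
      rintro _ rfl; rfl
    rw [tr]; exact h⟩, fun i => (g (a i) ⟨i, rfl⟩).2⟩
  left_inv j := by ext i; rfl
  right_inv g := by
    funext c; ext i
    obtain ⟨i, rfl⟩ := i
    rfl

lemma card_embeddings_into_disjoint {κ α : Type*} [Fintype κ] [DecidableEq κ] {k : ℕ}
    (S : κ → Set α)
    (hS : Pairwise (Function.onFun Disjoint S)) (hfin : ∀ c, (S c).Finite) (a : Fin k → κ) :
    (({j : Fin k ↪ α | ∀ i, j i ∈ S (a i)} : Set (Fin k ↪ α)).encard : ℝ≥0∞) =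
      ∏ c, (((S c).ncard.descFactorial (Fintype.card {i // a i = c}) : ℕ) : ℝ≥0∞) := by
  classical
  have : ∀ c, Fintype (S c) := fun c => (hfin c).fintype
  have e := embeddingsIntoDisjointEquiv S hS a
  have : Fintype {j : Fin k ↪ α // ∀ i, j i ∈ S (a i)} := Fintype.ofEquiv _ e.symm
  have h1 : ({j : Fin k ↪ α | ∀ i, j i ∈ S (a i)} : Set (Fin k ↪ α)).encard =
      ((Fintype.card {j : Fin k ↪ α // ∀ i, j i ∈ S (a i)} : ℕ) : ℕ∞) := by
    rw [← ENat.card_coe_set_eq]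
    exact ENat.card_eq_coe_fintype_card (α := {j : Fin k ↪ α // ∀ i, j i ∈ S (a i)})
  rw [h1, Fintype.card_congr e, Fintype.card_pi]
  simp only [Fintype.card_embedding_eq]
  rw [ENat.toENNReal_coe, Nat.cast_prod]
  refine Finset.prod_congr rfl fun c _ => ?_
  rw [Set.fintypeCard_eq_ncard]

variable {Ω : Type*} [MeasurableSpace Ω] {d : ℕ} {lam : ℝ} {P : Measure Ω}
  {ξ : ℤ → Ω → EuclideanSpace ℝ (Fin d)}

lemma IsHomogeneousPoisson.measurable_pointMeasure (h : IsHomogeneousPoisson lam P ξ)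
    {A : Set (EuclideanSpace ℝ (Fin d))} (hA : MeasurableSet A) :
    Measurable fun ω => pointMeasure ξ ω A := by
  simp only [pointMeasure, Measure.sum_apply _ hA, Measure.dirac_apply' _ hA]
  exact Measurable.tsum fun j => (measurable_one.indicator hA).comp (h.measurable j)

lemma IsHomogeneousPoisson.ae_finite (h : IsHomogeneousPoisson lam P ξ)
    {A : Set (EuclideanSpace ℝ (Fin d))} (hA : MeasurableSet A) (hA' : volume A ≠ ∞) :
    ∀ᵐ ω ∂P, ({j | ξ j ω ∈ A} : Set ℤ).Finite := by
  have h1 : ∀ᵐ x ∂(P.map fun ω => pointMeasure ξ ω A), x ≠ ∞ := by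
    rw [h.law_count A hA hA']
    refine (ae_map_iff (measurable_of_countable _).aemeasurable
      (measurableSet_singleton (∞ : ℝ≥0∞)).compl).2 (Eventually.of_forall fun k => by simp)
  filter_upwards [ae_of_ae_map (h.measurable_pointMeasure hA).aemeasurable h1] with ω hω
  rw [pointMeasure_apply_eq_encard ξ ω hA] at hω
  rw [← Set.encard_lt_top_iff]
  exact lt_top_iff_ne_top.2 fun h' => hω (by simp [h'])

/-- The factorial moments of the counts in a disjoint family of sets. -/
lemma IsHomogeneousPoisson.lintegral_encard_embeddings (h : IsHomogeneousPoisson lam P ξ)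
    (hlam : 0 ≤ lam) {κ : Type*} [Finite κ] {C : κ → Set (EuclideanSpace ℝ (Fin d))}
    (hC : ∀ c, MeasurableSet (C c)) (hC' : ∀ c, volume (C c) ≠ ∞)
    (hdisj : Pairwise (Function.onFun Disjoint C)) {k : ℕ} (a : Fin k → κ) :
    ∫⁻ ω, (({j : Fin k ↪ ℤ | ∀ i, ξ (j i) ω ∈ C (a i)} : Set (Fin k ↪ ℤ)).encard : ℝ≥0∞) ∂P =
      ∏ i, ENNReal.ofReal lam * volume (C (a i)) := by
  classical
  have := Fintype.ofFinite κ
  -- Counts take values in `ℝ≥0∞`; `F m` is a measurable extension of the falling factorial.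
  let F : ℕ → ℝ≥0∞ → ℝ≥0∞ := fun m x => ((⌊x.toReal⌋₊.descFactorial m : ℕ) : ℝ≥0∞)
  have hF : ∀ m, Measurable (F m) := fun m =>
    (measurable_of_countable fun n : ℕ => ((n.descFactorial m : ℕ) : ℝ≥0∞)).comp
      (Nat.measurable_floor.comp ENNReal.measurable_toReal)
  let mm : κ → ℕ := fun c => Fintype.card {i // a i = c}
  have hae : ∀ᵐ ω ∂P, (({j : Fin k ↪ ℤ | ∀ i, ξ (j i) ω ∈ C (a i)} :
      Set (Fin k ↪ ℤ)).encard : ℝ≥0∞) = ∏ c, F (mm c) (pointMeasure ξ ω (C c)) := by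
    filter_upwards [ae_all_iff.2 fun c => h.ae_finite (hC c) (hC' c)] with ω hω
    refine (card_embeddings_into_disjoint (fun c => {j | ξ j ω ∈ C c})
      (fun c c' hcc => Set.disjoint_left.2 fun j hj hj' =>
        Set.disjoint_left.1 (hdisj hcc) hj hj') hω a).trans ?_
    refine Finset.prod_congr rfl fun c _ => ?_
    rw [pointMeasure_apply_eq_encard ξ ω (hC c), ← (hω c).cast_ncard_eq]
    simp [F, mm]
  rw [lintegral_congr_ae hae]
  have hind : iIndepFun (fun c ω => pointMeasure ξ ω (C c)) P := by
    let e := Fintype.equivFin κ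
    have h1 := h.indep_count (Fintype.card κ) (fun i => C (e.symm i)) (fun i => hC _)
      (fun i i' hii => hdisj (e.symm.injective.ne hii))
    have h2 := h1.precomp e.injective
    simpa [Function.comp_def] using h2
  have hind2 := hind.comp (fun c => F (mm c)) fun c => hF _
  refine (lintegral_prod_eq_prod_lintegral_of_indepFun Finset.univ _ hind2
    fun c => (hF _).comp (h.measurable_pointMeasure (hC c))).trans ?_
  have hval : ∀ c, ∫⁻ ω, ((F (mm c)) ∘ fun ω => pointMeasure ξ ω (C c)) ω ∂P =
      (ENNReal.ofReal lam * volume (C c)) ^ (mm c) := by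
    intro c
    simp only [Function.comp]
    rw [← lintegral_map (hF (mm c)) (h.measurable_pointMeasure (hC c)),
      h.law_count _ (hC c) (hC' c), lintegral_map (hF _) (by fun_prop)]
    have : ∀ n : ℕ, F (mm c) (n : ℝ≥0∞) = ((n.descFactorial (mm c) : ℕ) : ℝ≥0∞) := by
      intro n; simp [F]
    simp_rw [this]
    rw [lintegral_descFactorial_poissonMeasure]
    congr 1
    rw [← ENNReal.ofReal_toReal (hC' c), ← ENNReal.ofReal_mul hlam,
      ENNReal.toReal_ofReal ENNReal.toReal_nonneg]
    rfl
  rw [Finset.prod_congr rfl fun c _ => hval c]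
  rw [← Finset.prod_fiberwise' Finset.univ a (fun c => ENNReal.ofReal lam * volume (C c))]
  refine Finset.prod_congr rfl fun c _ => ?_
  rw [Finset.prod_const]
  congr 1
  exact Fintype.card_subtype _

lemma sum_map_apply_eq_lintegral_encard {E : Type*} [MeasurableSpace E] {z : ℤ → Ω → E}
    (hz : ∀ j, Measurable (z j)) {k : ℕ} {s : Fin k → Set E} (hs : ∀ i, MeasurableSet (s i)) :
    Measure.sum (fun j : Fin k ↪ ℤ => P.map fun ω i => z (j i) ω) (Set.univ.pi s) =
      ∫⁻ ω, (({j : Fin k ↪ ℤ | ∀ i, z (j i) ω ∈ s i} : Set (Fin k ↪ ℤ)).encard : ℝ≥0∞) ∂P := by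
  have hpi : MeasurableSet (Set.univ.pi s) := MeasurableSet.univ_pi hs
  have hm : ∀ j : Fin k ↪ ℤ, Measurable fun ω i => z (j i) ω := fun j =>
    measurable_pi_lambda _ fun i => hz _
  rw [Measure.sum_apply _ hpi]
  have h1 : ∀ ω, (({j : Fin k ↪ ℤ | ∀ i, z (j i) ω ∈ s i} : Set (Fin k ↪ ℤ)).encard : ℝ≥0∞) =
      ∑' j : Fin k ↪ ℤ, ((fun ω i => z (j i) ω) ⁻¹' (Set.univ.pi s)).indicator 1 ω := by
    intro ω
    rw [← ENNReal.tsum_set_one, tsum_subtype _ fun _ => (1 : ℝ≥0∞)]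
    refine tsum_congr fun j => ?_
    by_cases hj : ∀ i, z (j i) ω ∈ s i
    · rw [Set.indicator_of_mem (by exact hj), Set.indicator_of_mem (by simpa using hj)]; rfl
    · rw [Set.indicator_of_notMem (by exact hj), Set.indicator_of_notMem (by simpa using hj)]
  simp_rw [h1]
  have : Countable (Fin k ↪ ℤ) := DFunLike.coe_injective.countable
  rw [lintegral_tsum fun j => (measurable_one.indicator (hm j hpi)).aemeasurable]
  refine tsum_congr fun j => ?_
  rw [lintegral_indicator_one (hm j hpi), Measure.map_apply (hm j) hpi]

instance (lam : ℝ) : SigmaFinite (ENNReal.ofReal lam •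
    (volume : Measure (EuclideanSpace ℝ (Fin d)))) :=
  inferInstanceAs (SigmaFinite (lam.toNNReal • (volume : Measure (EuclideanSpace ℝ (Fin d)))))

/-- The factorial moment measures of a homogeneous Poisson process are the powers of its
intensity measure. A box is cut into products of atoms of the finite partition generated by its
sides; two atoms are equal or disjoint, which is the case settled by the factorial moments of the
Poisson law. -/
theorem IsHomogeneousPoisson.factorialMoment (h : IsHomogeneousPoisson lam P ξ) (hlam : 0 ≤ lam)
    (k : ℕ) :
    Measure.sum (fun j : Fin k ↪ ℤ => P.map fun ω i => ξ (j i) ω) =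
      Measure.pi fun _ : Fin k => ENNReal.ofReal lam •
        (volume : Measure (EuclideanSpace ℝ (Fin d))) := by
  classical
  symm
  let D : Set (Set (EuclideanSpace ℝ (Fin d))) := {s | MeasurableSet s ∧ volume s < ∞}
  have hspan : (ENNReal.ofReal lam •
      (volume : Measure (EuclideanSpace ℝ (Fin d)))).FiniteSpanningSetsIn D :=
    { set := fun n => Metric.ball 0 n
      set_mem := fun n => ⟨measurableSet_ball, measure_ball_lt_top⟩
      finite := fun n => by
        rw [Measure.smul_apply, smul_eq_mul]
        exact ENNReal.mul_lt_top ENNReal.ofReal_lt_top measure_ball_lt_top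
      spanning := Metric.iUnion_ball_nat 0 }
  refine Measure.pi_eq_generateFrom (C := fun _ => D) (fun _ => ?_) (fun _ => ?_)
    (fun _ => hspan) ?_
  · apply le_antisymm
    · exact MeasurableSpace.generateFrom_le fun s hs => hs.1
    · intro s hs
      have : s = ⋃ n : ℕ, s ∩ Metric.ball 0 n := by
        rw [← Set.inter_iUnion, Metric.iUnion_ball_nat, Set.inter_univ]
      rw [this]
      exact MeasurableSet.iUnion fun n => MeasurableSpace.measurableSet_generateFrom
        ⟨hs.inter measurableSet_ball,
          (measure_mono Set.inter_subset_right).trans_lt measure_ball_lt_top⟩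
  · intro s hs t ht _
    exact ⟨hs.1.inter ht.1, (measure_mono Set.inter_subset_left).trans_lt hs.2⟩
  · intro s hs
    -- The fibres of `χ` are the atoms of the partition generated by the sides `s i` of the box.
    let χ : EuclideanSpace ℝ (Fin d) → (Fin k → Bool) := fun x i => decide (x ∈ s i)
    have hχ : Measurable χ := by
      refine measurable_pi_lambda _ fun i => ?_
      refine measurable_to_bool ?_
      have : (fun x => decide (x ∈ s i)) ⁻¹' {true} = s i := by ext; simp
      rw [this]; exact (hs i).1
    let χk : (Fin k → EuclideanSpace ℝ (Fin d)) → (Fin k → Fin k → Bool) := fun x i => χ (x i)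
    have hχk : Measurable χk := measurable_pi_lambda _ fun i => hχ.comp (measurable_pi_apply i)
    let τs : Finset (Fin k → Fin k → Bool) := {τ | ∀ i, τ i i = true}
    have hbox : Set.univ.pi s = χk ⁻¹' (τs : Set (Fin k → Fin k → Bool)) := by
      ext x; simp [χk, χ, τs]
    have hfib : ∀ τ : Fin k → Fin k → Bool, χk ⁻¹' {τ} =
        Set.univ.pi fun i => χ ⁻¹' {τ i} := by
      intro τ; ext x; simp [χk, funext_iff (f := fun i => χ (x i))]
    have hsplit : ∀ m : Measure (Fin k → EuclideanSpace ℝ (Fin d)),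
        m (Set.univ.pi s) = ∑ τ ∈ τs, m (Set.univ.pi fun i => χ ⁻¹' {τ i}) := by
      intro m
      rw [hbox, ← sum_measure_preimage_singleton τs fun τ _ => hχk (measurableSet_singleton τ)]
      exact Finset.sum_congr rfl fun τ _ => by rw [hfib]
    have hpi := hsplit (Measure.pi fun _ : Fin k => ENNReal.ofReal lam •
        (volume : Measure (EuclideanSpace ℝ (Fin d))))
    rw [Measure.pi_pi] at hpi
    rw [hpi, hsplit]
    refine Finset.sum_congr rfl fun τ hτ => ?_
    have hτ' : ∀ i, τ i i = true := by simpa [τs] using hτ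
    rw [Measure.pi_pi, sum_map_apply_eq_lintegral_encard h.measurable
      fun i => hχ (measurableSet_singleton _)]
    have hsub : ∀ i, χ ⁻¹' {τ i} ⊆ s i := by
      intro i x hx
      have h2 : χ x i = true := by
        rw [show χ x = τ i from hx]; exact hτ' i
      simpa [χ] using h2
    have key := h.lintegral_encard_embeddings hlam (κ := Set.range τ)
      (C := fun c => χ ⁻¹' {c.1}) (fun c => hχ (measurableSet_singleton _))
      (by
        rintro ⟨_, i, rfl⟩
        exact ((measure_mono (hsub i)).trans_lt (hs i).2).ne)
      (by
        intro c c' hcc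
        refine Set.disjoint_left.2 fun x hx hx' => hcc (Subtype.ext ?_)
        exact (hx : χ x = c.1).symm.trans hx')
      (fun i => ⟨τ i, i, rfl⟩)
    rw [key]
    simp

/-- The intensity measure of the marked Poisson process of positions and velocities. -/
noncomputable def intensity {d : ℕ} (lam : ℝ) (G : Measure (EuclideanSpace ℝ (Fin d))) :
    Measure (EuclideanSpace ℝ (Fin d) × EuclideanSpace ℝ (Fin d)) :=
  (ENNReal.ofReal lam • (volume : Measure (EuclideanSpace ℝ (Fin d)))).prod G

/-- The factorial moment measures of the marked process are the powers of its intensity: the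
marks are independent of the positions, and along distinct indices they are independent of each
other. -/
theorem IsUndeviatedMotion.factorialMoment {G : Measure (EuclideanSpace ℝ (Fin d))}
    {v : ℤ → Ω → EuclideanSpace ℝ (Fin d)} (h : IsUndeviatedMotion lam G P ξ v) (hlam : 0 ≤ lam)
    (k : ℕ) :
    Measure.sum (fun j : Fin k ↪ ℤ => P.map fun ω i => (ξ (j i) ω, v (j i) ω)) =
      Measure.pi fun _ : Fin k => intensity lam G := by
  have := h.isProbabilityMeasure
  have hG : IsProbabilityMeasure G := by
    rw [← h.law_velocity 0]
    exact Measure.isProbabilityMeasure_map (h.measurable_velocity 0).aemeasurable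
  let e := MeasurableEquiv.arrowProdEquivProdArrow (EuclideanSpace ℝ (Fin d))
    (EuclideanSpace ℝ (Fin d)) (Fin k)
  have hj : ∀ j : Fin k ↪ ℤ, (P.map fun ω i => (ξ (j i) ω, v (j i) ω)) =
      ((P.map fun ω i => ξ (j i) ω).prod (Measure.pi fun _ : Fin k => G)).map e.symm := by
    intro j
    have hξ : Measurable fun ω i => ξ (j i) ω := measurable_pi_lambda _ fun i =>
      h.poisson.measurable _
    have hv : Measurable fun ω i => v (j i) ω := measurable_pi_lambda _ fun i =>
      h.measurable_velocity _
    have h1 : P.map (fun ω i => v (j i) ω) = Measure.pi fun _ : Fin k => G := by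
      have := (iIndepFun_iff_map_fun_eq_pi_map
        fun i => (h.measurable_velocity (j i)).aemeasurable).1
          (h.indep_velocity.precomp j.injective)
      simpa [Function.comp_def, h.law_velocity] using this
    have h2 : IndepFun (fun ω i => ξ (j i) ω) (fun ω i => v (j i) ω) P :=
      h.indep_position_velocity.comp
        (φ := fun (x : ℤ → EuclideanSpace ℝ (Fin d)) i => x (j i))
        (ψ := fun (x : ℤ → EuclideanSpace ℝ (Fin d)) i => x (j i))
        (measurable_pi_lambda _ fun i => measurable_pi_apply _)
        (measurable_pi_lambda _ fun i => measurable_pi_apply _)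
    rw [← h1, ← (indepFun_iff_map_prod_eq_prod_map_map hξ.aemeasurable hv.aemeasurable).1 h2,
      Measure.map_map e.symm.measurable (hξ.prodMk hv)]
    rfl
  simp_rw [hj]
  rw [← Measure.map_sum e.symm.measurable.aemeasurable, ← Measure.prod_sum_left,
    h.poisson.factorialMoment hlam]
  exact ((measurePreserving_arrowProdEquivProdArrow (EuclideanSpace ℝ (Fin d))
    (EuclideanSpace ℝ (Fin d)) (Fin k) (fun _ => ENNReal.ofReal lam • volume)
    (fun _ => G)).symm _).map_eq

end FactorialMoments

/-! ### Transit of a uniformly moving particle through a ball -/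

section Transit

variable {E : Type*} [NormedAddCommGroup E] [InnerProductSpace ℝ E]

/-- A quarter of the discriminant of the quadratic equation `‖x + s • v‖ ^ 2 = r ^ 2` in `s`. -/
noncomputable def transitDiscr (r : ℝ) (z : E × E) : ℝ :=
  (inner ℝ z.1 z.2) ^ 2 - ‖z.2‖ ^ 2 * (‖z.1‖ ^ 2 - r ^ 2)

/-- The pairs of an initial position and a nonzero velocity whose trajectory meets the closed ball
of radius `r`. -/
def hitSet (r : ℝ) : Set (E × E) := {z | z.2 ≠ 0 ∧ 0 ≤ transitDiscr r z}

/-- The time of entry into the closed ball of radius `r` (meaningful on `hitSet r`). -/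
noncomputable def entryTime (r : ℝ) (z : E × E) : ℝ :=
  (-(inner ℝ z.1 z.2) - √(transitDiscr r z)) / ‖z.2‖ ^ 2

/-- The time of exit from the closed ball of radius `r` (meaningful on `hitSet r`). -/
noncomputable def exitTime (r : ℝ) (z : E × E) : ℝ :=
  (-(inner ℝ z.1 z.2) + √(transitDiscr r z)) / ‖z.2‖ ^ 2

lemma entryTime_le_exitTime (r : ℝ) (z : E × E) : entryTime r z ≤ exitTime r z := by
  unfold entryTime exitTime
  gcongr
  linarith [Real.sqrt_nonneg (transitDiscr r z)]

/-- Solving the quadratic inequality `‖x + s • v‖ ^ 2 ≤ r ^ 2` for `s`. -/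
lemma mem_closedBall_iff_mem_transit {r : ℝ} (hr : 0 ≤ r) {x v : E} (hv : v ≠ 0) (s : ℝ) :
    x + s • v ∈ Metric.closedBall (0 : E) r ↔
      (x, v) ∈ hitSet r ∧ entryTime r (x, v) ≤ s ∧ s ≤ exitTime r (x, v) := by
  have hV : 0 < ‖v‖ ^ 2 := by positivity
  have h1 : x + s • v ∈ Metric.closedBall (0 : E) r ↔
      (‖v‖ ^ 2 * s + inner ℝ x v) ^ 2 ≤ transitDiscr r (x, v) := by
    rw [mem_closedBall_zero_iff, ← sq_le_sq₀ (norm_nonneg _) hr, norm_add_sq_real,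
      inner_smul_right, norm_smul, mul_pow, Real.norm_eq_abs, sq_abs, transitDiscr]
    constructor
    · intro h
      nlinarith
    · intro h
      have : ‖v‖ ^ 2 * (‖x‖ ^ 2 + 2 * (s * inner ℝ x v) + s ^ 2 * ‖v‖ ^ 2) ≤ ‖v‖ ^ 2 * r ^ 2 := by
        simp only at h
        nlinarith
      exact le_of_mul_le_mul_left this hV
  rw [h1]
  constructor
  · intro h
    have h0 : 0 ≤ transitDiscr r (x, v) := (sq_nonneg _).trans h
    have h2 := Real.abs_le_sqrt h
    rw [abs_le] at h2
    refine ⟨⟨hv, h0⟩, ?_, ?_⟩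
    · rw [entryTime, div_le_iff₀ hV]; simp only; linarith
    · rw [exitTime, le_div_iff₀ hV]; simp only; linarith
  · rintro ⟨⟨-, h0⟩, h2, h3⟩
    rw [entryTime, div_le_iff₀ hV] at h2
    rw [exitTime, le_div_iff₀ hV] at h3
    simp only at h2 h3
    rw [← Real.sq_sqrt h0]
    exact sq_le_sq' (by linarith) (by linarith)

variable [MeasurableSpace E] [BorelSpace E] [SecondCountableTopology E]

lemma measurable_transitDiscr (r : ℝ) : Measurable (transitDiscr (E := E) r) := by
  unfold transitDiscr; fun_prop

lemma measurableSet_hitSet (r : ℝ) : MeasurableSet (hitSet (E := E) r) :=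
  (measurable_snd (measurableSet_singleton (0 : E)).compl).inter
    (measurableSet_le measurable_const (measurable_transitDiscr r))

lemma measurable_entryTime (r : ℝ) : Measurable (entryTime (E := E) r) := by
  have := measurable_transitDiscr (E := E) r
  unfold entryTime; fun_prop

lemma measurable_exitTime (r : ℝ) : Measurable (exitTime (E := E) r) := by
  have := measurable_transitDiscr (E := E) r
  unfold exitTime; fun_prop

end Transit

/-! ### Volume of the initial positions with a prescribed transit -/

section Volume

lemma volume_closedBall_fin (n : ℕ) {r : ℝ} (hr : 0 ≤ r) :
    volume (Metric.closedBall (0 : EuclideanSpace ℝ (Fin n)) r) =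
      ENNReal.ofReal (r ^ n * (√Real.pi ^ n / Real.Gamma (n / 2 + 1))) := by
  rcases Nat.eq_zero_or_pos n with rfl | hn
  · rw [volume_euclideanSpace_eq_dirac]
    simp [hr]
  · have : Nonempty (Fin n) := Fin.pos_iff_nonempty.1 hn
    rw [EuclideanSpace.volume_closedBall, Fintype.card_fin, ← ENNReal.ofReal_pow hr,
      ← ENNReal.ofReal_mul (by positivity)]

/-- The cross-sectional volume of the ball of radius `r` in dimension `d`, that is, the volume of
the ball of radius `r` in dimension `d - 1`. -/
noncomputable def crossSection (d : ℕ) (r : ℝ) : ℝ :=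
  r ^ (d - 1) * (√Real.pi ^ (d - 1) / Real.Gamma ((d - 1 : ℕ) / 2 + 1))

lemma crossSection_pos (d : ℕ) {r : ℝ} (hr : 0 < r) : 0 < crossSection d r := by
  have : 0 < Real.Gamma (((d - 1 : ℕ) : ℝ) / 2 + 1) := Real.Gamma_pos_of_pos (by positivity)
  unfold crossSection; positivity

/-- The entry rate is proportional to the cross-section and the mean count to the volume; their
ratio gives the constant of the estimator. -/
lemma crossSection_mul_beta {d : ℕ} (hd : 1 ≤ d) {r : ℝ} (hr : 0 ≤ r) :
    crossSection d r * (r * ProbabilityTheory.beta (((d : ℝ) + 1) / 2) (1 / 2)) =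
      (volume (Metric.closedBall (0 : EuclideanSpace ℝ (Fin d)) r)).toReal := by
  obtain ⟨n, rfl⟩ : ∃ n, d = n + 1 := ⟨d - 1, by omega⟩
  have h1 : 0 < Real.Gamma ((n : ℝ) / 2 + 1) := Real.Gamma_pos_of_pos (by positivity)
  have h2 : 0 < Real.Gamma (((n + 1 : ℕ) : ℝ) / 2 + 1) := Real.Gamma_pos_of_pos (by positivity)
  rw [volume_closedBall_fin _ hr, ENNReal.toReal_ofReal (by positivity), crossSection,
    ProbabilityTheory.beta, Nat.add_sub_cancel, Real.Gamma_one_half_eq]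
  have e1 : (((n + 1 : ℕ) : ℝ) + 1) / 2 = (n : ℝ) / 2 + 1 := by push_cast; ring
  have e2 : (n : ℝ) / 2 + 1 + 1 / 2 = ((n + 1 : ℕ) : ℝ) / 2 + 1 := by push_cast; ring
  rw [e1, e2]
  field_simp
  ring

variable {E : Type*} [NormedAddCommGroup E] [InnerProductSpace ℝ E] [FiniteDimensional ℝ E]
  [MeasurableSpace E] [BorelSpace E]

lemma volume_closedBall_finrank {r : ℝ} (hr : 0 ≤ r) :
    volume (Metric.closedBall (0 : E) r) = ENNReal.ofReal (r ^ Module.finrank ℝ E *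
      (√Real.pi ^ Module.finrank ℝ E / Real.Gamma (Module.finrank ℝ E / 2 + 1))) := by
  rw [← volume_closedBall_fin _ hr,
    ← ((stdOrthonormalBasis ℝ E).measurePreserving_repr).measure_preimage
      measurableSet_closedBall.nullMeasurableSet]
  simp

/-- The coordinate along `v` and the orthogonal component parametrize the space, preserving
volume. -/
lemma exists_measurePreserving_coordinates {v : E} (hv : v ≠ 0) :
    ∃ Ψ : ℝ × (Submodule.span ℝ {v})ᗮ → E, MeasurePreserving Ψ ∧
      ∀ p y, inner ℝ (Ψ (p, y)) v = p * ‖v‖ ∧ ‖Ψ (p, y)‖ ^ 2 = p ^ 2 + ‖y‖ ^ 2 := by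
  have hℓ : ‖v‖ ≠ 0 := by simpa using hv
  let u : E := ‖v‖⁻¹ • v
  have hu : ‖u‖ = 1 := by simp [u, norm_smul, hℓ]
  have hspan : Submodule.span ℝ {u} = Submodule.span ℝ {v} :=
    Submodule.span_singleton_smul_eq (IsUnit.mk0 _ (inv_ne_zero hℓ)) v
  rw [← hspan]
  let K := Submodule.span ℝ {u}
  let e1 : ℝ ≃ₗᵢ[ℝ] K := LinearIsometryEquiv.toSpanUnitSingleton u hu
  refine ⟨fun q => K.orthogonalDecomposition.symm (WithLp.toLp 2 (e1 q.1, q.2)), ?_, ?_⟩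
  · have h1 : MeasurePreserving (Prod.map e1 (id : Kᗮ → Kᗮ)) (volume.prod volume)
        (volume.prod volume) :=
      e1.measurePreserving.prod (MeasurePreserving.id _)
    exact K.orthogonalDecomposition.symm.measurePreserving.comp
      ((WithLp.volume_preserving_toLp K Kᗮ).comp h1)
  · intro p y
    have hval : K.orthogonalDecomposition.symm (WithLp.toLp 2 (e1 p, y)) = p • u + (y : E) := by
      rw [Submodule.orthogonalDecomposition_symm_apply]
      rfl
    have hyu : inner ℝ (y : E) u = 0 :=
      (Submodule.mem_orthogonal' K (y : E)).1 y.2 u (Submodule.mem_span_singleton_self u)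
    have hvu : v = ‖v‖ • u := by simp [u, smul_smul, hℓ]
    simp only [hval]
    constructor
    · have : inner ℝ (p • u + (y : E)) v = ‖v‖ * inner ℝ (p • u + (y : E)) u := by
        conv_lhs => rw [hvu]
        rw [inner_smul_right]
      rw [this, inner_add_left, inner_smul_left, real_inner_self_eq_norm_sq, hu, hyu]
      simp [mul_comm]
    · rw [norm_add_sq_real, inner_smul_left, real_inner_comm, hyu, norm_smul, hu]
      simp

/-- In coordinates `(p, y)` along `v` and orthogonal to `v`, the trajectory hits the ball if and
only if `‖y‖ ≤ r`; the half chord is then `√(r ^ 2 - ‖y‖ ^ 2)`, and `p` shifts the transit in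
time. -/
lemma volume_setOf_hitSet {r : ℝ} (hr : 0 ≤ r) {v : E} (hv : v ≠ 0) {S : Set (ℝ × ℝ)}
    (hS : MeasurableSet S) :
    volume {x : E | (x, v) ∈ hitSet r ∧ (entryTime r (x, v), exitTime r (x, v)) ∈ S} =
      ∫⁻ y in Metric.closedBall (0 : (Submodule.span ℝ {v})ᗮ) r,
        volume {p : ℝ |
          (-(p + √(r ^ 2 - ‖y‖ ^ 2)) / ‖v‖, -(p - √(r ^ 2 - ‖y‖ ^ 2)) / ‖v‖) ∈ S} := by
  have hℓ : 0 < ‖v‖ := by positivity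
  obtain ⟨Ψ, hΨ, hΨ'⟩ := exists_measurePreserving_coordinates hv
  have hm : MeasurableSet
      {x : E | (x, v) ∈ hitSet r ∧ (entryTime r (x, v), exitTime r (x, v)) ∈ S} := by
    have h1 : Measurable fun x : E => (x, v) := by fun_prop
    exact (h1 (measurableSet_hitSet r)).inter
      ((((measurable_entryTime r).comp h1).prodMk ((measurable_exitTime r).comp h1)) hS)
  rw [← hΨ.measure_preimage hm.nullMeasurableSet, Measure.volume_eq_prod,
    Measure.prod_apply_symm (hΨ.measurable hm), ← lintegral_indicator measurableSet_closedBall]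
  refine lintegral_congr fun y => ?_
  have hdisc : ∀ p, transitDiscr r (Ψ (p, y), v) = ‖v‖ ^ 2 * (r ^ 2 - ‖y‖ ^ 2) := by
    intro p
    rw [transitDiscr, (hΨ' p y).1, (hΨ' p y).2]; ring
  by_cases hy : y ∈ Metric.closedBall (0 : (Submodule.span ℝ {v})ᗮ) r
  · rw [Set.indicator_of_mem hy]
    rw [mem_closedBall_zero_iff] at hy
    have hyr : ‖y‖ ^ 2 ≤ r ^ 2 := pow_le_pow_left₀ (norm_nonneg _) hy 2
    congr 1
    ext p
    simp only [Set.mem_preimage, Set.mem_ofPred_eq, hitSet, hdisc, entryTime, exitTime,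
      (hΨ' p y).1]
    have h3 : 0 ≤ ‖v‖ ^ 2 * (r ^ 2 - ‖y‖ ^ 2) := by nlinarith [sq_nonneg ‖v‖]
    rw [Real.sqrt_mul (sq_nonneg _), Real.sqrt_sq (norm_nonneg v)]
    have e1 : (-(p * ‖v‖) - ‖v‖ * √(r ^ 2 - ‖y‖ ^ 2)) / ‖v‖ ^ 2 =
        -(p + √(r ^ 2 - ‖y‖ ^ 2)) / ‖v‖ := by field_simp; ring
    have e2 : (-(p * ‖v‖) + ‖v‖ * √(r ^ 2 - ‖y‖ ^ 2)) / ‖v‖ ^ 2 =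
        -(p - √(r ^ 2 - ‖y‖ ^ 2)) / ‖v‖ := by field_simp; ring
    rw [e1, e2]
    rw [and_iff_right (⟨hv, h3⟩ : _ ∧ _)]
  · rw [Set.indicator_of_notMem hy]
    rw [mem_closedBall_zero_iff, not_le] at hy
    have hyr : r ^ 2 < ‖y‖ ^ 2 := pow_lt_pow_left₀ hy hr two_ne_zero
    have : (fun p => (p, y)) ⁻¹' (Ψ ⁻¹'
        {x : E | (x, v) ∈ hitSet r ∧ (entryTime r (x, v), exitTime r (x, v)) ∈ S}) = ∅ := by
      ext p
      simp only [Set.mem_preimage, Set.mem_ofPred_eq, hitSet, hdisc, Set.mem_empty_iff_false,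
        iff_false]
      rintro ⟨⟨-, h⟩, -⟩
      have : 0 < ‖v‖ ^ 2 := by positivity
      nlinarith
    rw [this, measure_empty]

lemma volume_preimage_affine {ℓ : ℝ} (hℓ : 0 < ℓ) (w : ℝ) (I : Set ℝ) :
    volume {p : ℝ | -(p + w) / ℓ ∈ I} = ENNReal.ofReal ℓ * volume I := by
  have : {p : ℝ | -(p + w) / ℓ ∈ I} = (fun p => p + w) ⁻¹' ((fun q => (-ℓ⁻¹) * q) ⁻¹' I) := by
    ext p
    simp only [Set.mem_ofPred_eq, Set.mem_preimage]
    rw [show -(p + w) / ℓ = -ℓ⁻¹ * (p + w) by field_simp]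
  rw [this, measure_preimage_add_right, Real.volume_preimage_mul_left (by simp [hℓ.ne'])]
  simp [abs_of_pos hℓ]

omit [MeasurableSpace E] [BorelSpace E] in
lemma finrank_orthogonal_of_ne_zero {v : E} (hv : v ≠ 0) :
    Module.finrank ℝ (Submodule.span ℝ {v})ᗮ = Module.finrank ℝ E - 1 := by
  have := Submodule.finrank_add_finrank_orthogonal (Submodule.span ℝ {v})
  rw [finrank_span_singleton hv] at this
  omega

lemma volume_closedBall_orthogonal {r : ℝ} (hr : 0 ≤ r) {v : E} (hv : v ≠ 0) :
    volume (Metric.closedBall (0 : (Submodule.span ℝ {v})ᗮ) r) =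
      ENNReal.ofReal (crossSection (Module.finrank ℝ E) r) := by
  rw [volume_closedBall_finrank hr, finrank_orthogonal_of_ne_zero hv, crossSection]

lemma volume_entryTime_mem {r : ℝ} (hr : 0 ≤ r) {v : E} (hv : v ≠ 0) {I : Set ℝ}
    (hI : MeasurableSet I) :
    volume {x : E | (x, v) ∈ hitSet r ∧ entryTime r (x, v) ∈ I} =
      ENNReal.ofReal (crossSection (Module.finrank ℝ E) r) *
        (ENNReal.ofReal ‖v‖ * volume I) := by
  have h := volume_setOf_hitSet hr hv (S := Prod.fst ⁻¹' I) (measurable_fst hI)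
  simp only [Set.mem_preimage] at h
  rw [h]
  simp only [volume_preimage_affine (norm_pos_iff.2 hv)]
  rw [lintegral_const, Measure.restrict_apply_univ, volume_closedBall_orthogonal hr hv, mul_comm]

lemma volume_exitTime_mem {r : ℝ} (hr : 0 ≤ r) {v : E} (hv : v ≠ 0) {I : Set ℝ}
    (hI : MeasurableSet I) :
    volume {x : E | (x, v) ∈ hitSet r ∧ exitTime r (x, v) ∈ I} =
      ENNReal.ofReal (crossSection (Module.finrank ℝ E) r) *
        (ENNReal.ofReal ‖v‖ * volume I) := by
  have h := volume_setOf_hitSet hr hv (S := Prod.snd ⁻¹' I) (measurable_snd hI)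
  simp only [Set.mem_preimage, sub_eq_add_neg] at h
  rw [h]
  simp only [volume_preimage_affine (norm_pos_iff.2 hv)]
  rw [lintegral_const, Measure.restrict_apply_univ, volume_closedBall_orthogonal hr hv, mul_comm]

lemma one_sub_one_sub_pow_le {q : ℝ} (hq1 : q ≤ 1) (n : ℕ) :
    1 - (1 - q) ^ n ≤ n * q := by
  have := one_add_mul_le_pow (a := -q) (by linarith) n
  have e : 1 + -q = 1 - q := by ring
  rw [e] at this
  linarith

/-- Chords of length less than `2 q` stay within distance `q` of the boundary of the cross-section,
hence cover at most a fraction `d q / r` of it. -/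
lemma volume_short_chord_le {r : ℝ} (hr : 0 < r) {v : E} (hv : v ≠ 0) {q : ℝ} (hq : 0 ≤ q) :
    volume {y ∈ Metric.closedBall (0 : (Submodule.span ℝ {v})ᗮ) r | √(r ^ 2 - ‖y‖ ^ 2) < q} ≤
      ENNReal.ofReal (crossSection (Module.finrank ℝ E) r * (Module.finrank ℝ E * q / r)) := by
  have hd : 1 ≤ Module.finrank ℝ E := by
    have : Nontrivial E := ⟨v, 0, hv⟩
    exact Module.finrank_pos
  have hd' : (1 : ℝ) ≤ Module.finrank ℝ E := by exact_mod_cast hd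
  have hc := crossSection_pos (Module.finrank ℝ E) hr
  rcases le_or_gt r q with hqr | hqr
  · refine (measure_mono (Set.sep_subset _ _)).trans ?_
    rw [volume_closedBall_orthogonal hr.le hv]
    apply ENNReal.ofReal_le_ofReal
    have : 1 ≤ (Module.finrank ℝ E * q / r) := by
      rw [le_div_iff₀ hr]; nlinarith
    nlinarith
  · have hsub : {y ∈ Metric.closedBall (0 : (Submodule.span ℝ {v})ᗮ) r |
        √(r ^ 2 - ‖y‖ ^ 2) < q} ⊆ Metric.closedBall 0 r \ Metric.closedBall 0 (r - q) := by
      rintro y ⟨hy, hyq⟩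
      refine ⟨hy, fun hy' => ?_⟩
      rw [mem_closedBall_zero_iff] at hy'
      rw [Real.sqrt_lt' (lt_of_le_of_lt (Real.sqrt_nonneg _) hyq)] at hyq
      nlinarith [norm_nonneg y]
    refine (measure_mono hsub).trans ?_
    rw [measure_sdiff (Metric.closedBall_subset_closedBall (by linarith))
      measurableSet_closedBall.nullMeasurableSet measure_closedBall_lt_top.ne,
      volume_closedBall_orthogonal hr.le hv, volume_closedBall_orthogonal (by linarith) hv,
      ← ENNReal.ofReal_sub]
    · apply ENNReal.ofReal_le_ofReal
      obtain ⟨n, hn⟩ : ∃ n, Module.finrank ℝ E = n + 1 := ⟨Module.finrank ℝ E - 1, by omega⟩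
      rw [hn]
      have hG : 0 < Real.Gamma ((n : ℝ) / 2 + 1) := Real.Gamma_pos_of_pos (by positivity)
      simp only [crossSection, Nat.add_sub_cancel]
      have h1 := one_sub_one_sub_pow_le (q := q / r)
        ((div_le_one hr).2 hqr.le) n
      have h2 : (r - q) ^ n = r ^ n * (1 - q / r) ^ n := by
        rw [← mul_pow]; congr 1; field_simp
      rw [h2]
      have h3 : 1 - (1 - q / r) ^ n ≤ ((n + 1 : ℕ) : ℝ) * q / r := by
        refine h1.trans ?_
        rw [mul_div_assoc]
        have : 0 ≤ q / r := by positivity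
        push_cast
        nlinarith
      have h4 : 0 ≤ r ^ n * (√Real.pi ^ n / Real.Gamma ((n : ℝ) / 2 + 1)) := by positivity
      nlinarith [mul_le_mul_of_nonneg_left h3 h4]
    · exact (crossSection_pos _ (by linarith)).le

lemma volume_entryTime_mem_short_le {r : ℝ} (hr : 0 < r) {v : E} (hv : v ≠ 0) {I : Set ℝ}
    (hI : MeasurableSet I) {t : ℝ} (ht : 0 ≤ t) :
    volume {x : E | (x, v) ∈ hitSet r ∧ entryTime r (x, v) ∈ I ∧
        exitTime r (x, v) - entryTime r (x, v) < t} ≤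
      ENNReal.ofReal (crossSection (Module.finrank ℝ E) r *
        (Module.finrank ℝ E * (t * ‖v‖ / 2) / r)) * (ENNReal.ofReal ‖v‖ * volume I) := by
  have hℓ : 0 < ‖v‖ := norm_pos_iff.2 hv
  have hS : MeasurableSet {p : ℝ × ℝ | p.1 ∈ I ∧ p.2 - p.1 < t} :=
    (measurable_fst hI).inter
      (measurableSet_lt (measurable_snd.sub measurable_fst) measurable_const)
  have h := volume_setOf_hitSet hr.le hv hS
  simp only [Set.mem_ofPred_eq] at h
  rw [h]
  have hchord : ∀ (p w : ℝ), -(p - w) / ‖v‖ - -(p + w) / ‖v‖ < t ↔ w < t * ‖v‖ / 2 := by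
    intro p w
    rw [← sub_div, div_lt_iff₀ hℓ]
    constructor <;> intro h <;> linarith
  simp only [hchord]
  have hm : MeasurableSet {y : (Submodule.span ℝ {v})ᗮ | √(r ^ 2 - ‖y‖ ^ 2) < t * ‖v‖ / 2} :=
    measurableSet_lt (by fun_prop) measurable_const
  have hle : ∀ y : (Submodule.span ℝ {v})ᗮ,
      volume {p : ℝ | -(p + √(r ^ 2 - ‖y‖ ^ 2)) / ‖v‖ ∈ I ∧
        √(r ^ 2 - ‖y‖ ^ 2) < t * ‖v‖ / 2} ≤
      {y : (Submodule.span ℝ {v})ᗮ | √(r ^ 2 - ‖y‖ ^ 2) < t * ‖v‖ / 2}.indicator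
        (fun _ => ENNReal.ofReal ‖v‖ * volume I) y := by
    intro y
    by_cases hy : √(r ^ 2 - ‖y‖ ^ 2) < t * ‖v‖ / 2
    · rw [Set.indicator_of_mem (by exact hy), ← volume_preimage_affine hℓ (√(r ^ 2 - ‖y‖ ^ 2))]
      exact measure_mono fun p hp => hp.1
    · exact (measure_mono_null (t := ∅) (fun p hp => hy hp.2) measure_empty).trans_le zero_le
  refine (lintegral_mono hle).trans ?_
  rw [lintegral_indicator hm, lintegral_const, mul_comm, Measure.restrict_restrict hm,
    Measure.restrict_apply_univ]
  gcongr
  refine le_trans (measure_mono ?_)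
    (volume_short_chord_le hr hv (q := t * ‖v‖ / 2) (by positivity))
  rintro y ⟨h1, h2⟩
  exact ⟨h2, h1⟩

end Volume

/-! ### The flow of transits -/

/-- A stationary flow of transits: `Λ` is an intensity measure on a space of particles, each
particle of `A` is inside the observation window exactly during `[a z, b z]`, entries and exits
occur at rate `m`, transits of duration less than `t` occur at rate at most `c t`, and the expected
number of particles inside at any time is `ρ`. -/
structure IsTransitFlow {Z : Type*} [MeasurableSpace Z] (Λ : Measure Z) (A : Set Z) (a b : Z → ℝ)
    (m c ρ : ℝ) : Prop where
  measurableSet : MeasurableSet A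
  measurable_entry : Measurable a
  measurable_exit : Measurable b
  le : ∀ z, a z ≤ b z
  rate_nonneg : 0 ≤ m
  short_nonneg : 0 ≤ c
  mean_nonneg : 0 ≤ ρ
  entry : ∀ I, MeasurableSet I → Λ {z | z ∈ A ∧ a z ∈ I} = ENNReal.ofReal m * volume I
  exit : ∀ I, MeasurableSet I → Λ {z | z ∈ A ∧ b z ∈ I} = ENNReal.ofReal m * volume I
  short : ∀ I t, MeasurableSet I → 0 ≤ t →
    Λ {z | z ∈ A ∧ a z ∈ I ∧ b z - a z < t} ≤ ENNReal.ofReal (c * t) * volume I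
  inside : ∀ s, Λ {z | z ∈ A ∧ a z ≤ s ∧ s ≤ b z} = ENNReal.ofReal ρ

/-- Free particles started from a homogeneous Poisson process form a stationary flow of transits
through a ball. -/
lemma isTransitFlow_intensity {d : ℕ} {lam r : ℝ} (hlam : 0 ≤ lam) (hr : 0 < r)
    {G : Measure (EuclideanSpace ℝ (Fin d))} [IsProbabilityMeasure G] (hG0 : ∀ᵐ v ∂G, v ≠ 0)
    (hG1 : Integrable (fun v => ‖v‖) G) (hG2 : Integrable (fun v => ‖v‖ ^ 2) G) :
    IsTransitFlow (intensity lam G) (hitSet r) (entryTime r) (exitTime r)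
      (lam * crossSection d r * ∫ v, ‖v‖ ∂G)
      (lam * crossSection d r * (d / (2 * r)) * ∫ v, ‖v‖ ^ 2 ∂G) (meanCount d lam r) := by
  have hc := (crossSection_pos d hr).le
  have hsplit : ∀ (p : EuclideanSpace ℝ (Fin d) × EuclideanSpace ℝ (Fin d) → Prop),
      MeasurableSet {z | p z} → intensity lam G {z | p z} =
        ∫⁻ v, ENNReal.ofReal lam * volume {x | p (x, v)} ∂G := by
    intro p hp
    rw [intensity, Measure.prod_apply_symm hp]
    rfl
  have hμ1 : ∫⁻ v, ENNReal.ofReal ‖v‖ ∂G = ENNReal.ofReal (∫ v, ‖v‖ ∂G) :=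
    (ofReal_integral_eq_lintegral_ofReal hG1 (ae_of_all _ fun v => norm_nonneg v)).symm
  have hμ2 : ∫⁻ v, ENNReal.ofReal (‖v‖ ^ 2) ∂G = ENNReal.ofReal (∫ v, ‖v‖ ^ 2 ∂G) :=
    (ofReal_integral_eq_lintegral_ofReal hG2 (ae_of_all _ fun v => sq_nonneg _)).symm
  have hA := measurableSet_hitSet (E := EuclideanSpace ℝ (Fin d)) r
  have ha := measurable_entryTime (E := EuclideanSpace ℝ (Fin d)) r
  have hb := measurable_exitTime (E := EuclideanSpace ℝ (Fin d)) r
  have hrate : ∀ I : Set ℝ, ∫⁻ v : EuclideanSpace ℝ (Fin d), ENNReal.ofReal lam *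
      (ENNReal.ofReal (crossSection d r) * (ENNReal.ofReal ‖v‖ * volume I)) ∂G =
      ENNReal.ofReal (lam * crossSection d r * ∫ v, ‖v‖ ∂G) * volume I := by
    intro I
    rw [lintegral_const_mul _ (by fun_prop), lintegral_const_mul _ (by fun_prop),
      lintegral_mul_const _ (by fun_prop), hμ1, ENNReal.ofReal_mul (by positivity),
      ENNReal.ofReal_mul hlam]
    ring
  refine ⟨hA, ha, hb, entryTime_le_exitTime r, by positivity, by positivity,
    mul_nonneg hlam ENNReal.toReal_nonneg, fun I hI => ?_, fun I hI => ?_,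
    fun I t hI ht => ?_, fun s => ?_⟩
  · rw [hsplit (fun z => z ∈ hitSet r ∧ entryTime r z ∈ I) (hA.inter (ha hI)), ← hrate]
    refine lintegral_congr_ae ?_
    filter_upwards [hG0] with v hv
    rw [volume_entryTime_mem hr.le hv hI, finrank_euclideanSpace_fin]
  · rw [hsplit (fun z => z ∈ hitSet r ∧ exitTime r z ∈ I) (hA.inter (hb hI)), ← hrate]
    refine lintegral_congr_ae ?_
    filter_upwards [hG0] with v hv
    rw [volume_exitTime_mem hr.le hv hI, finrank_euclideanSpace_fin]
  · rw [hsplit (fun z => z ∈ hitSet r ∧ entryTime r z ∈ I ∧ exitTime r z - entryTime r z < t)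
      (hA.inter ((ha hI).inter (measurableSet_lt (hb.sub ha) measurable_const)))]
    have hle : ∫⁻ v, ENNReal.ofReal lam * volume {x : EuclideanSpace ℝ (Fin d) |
        (x, v) ∈ hitSet r ∧ entryTime r (x, v) ∈ I ∧
          exitTime r (x, v) - entryTime r (x, v) < t} ∂G ≤
        ∫⁻ v, ENNReal.ofReal (lam * crossSection d r * (d / (2 * r)) * t) *
          (ENNReal.ofReal (‖v‖ ^ 2) * volume I) ∂G := by
      refine lintegral_mono_ae ?_
      filter_upwards [hG0] with v hv
      refine (mul_le_mul_right (volume_entryTime_mem_short_le hr hv hI ht) _).trans_eq ?_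
      rw [finrank_euclideanSpace_fin, ← mul_assoc, ← mul_assoc, ← mul_assoc,
        ← ENNReal.ofReal_mul hlam, ← ENNReal.ofReal_mul (by positivity),
        ← ENNReal.ofReal_mul (by positivity)]
      congr 2
      field_simp
    refine hle.trans_eq ?_
    rw [lintegral_const_mul _ (by fun_prop), lintegral_mul_const _ (by fun_prop), hμ2, ← mul_assoc,
      ← ENNReal.ofReal_mul (by positivity)]
    congr 2
    ring
  · rw [hsplit (fun z => z ∈ hitSet r ∧ entryTime r z ≤ s ∧ s ≤ exitTime r z)
      (hA.inter ((measurableSet_le ha measurable_const).inter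
      (measurableSet_le measurable_const hb)))]
    have hval : ∀ᵐ v ∂G, ENNReal.ofReal lam * volume {x : EuclideanSpace ℝ (Fin d) |
        (x, v) ∈ hitSet r ∧ entryTime r (x, v) ≤ s ∧ s ≤ exitTime r (x, v)} =
        ENNReal.ofReal (meanCount d lam r) := by
      filter_upwards [hG0] with v hv
      have : {x : EuclideanSpace ℝ (Fin d) |
          (x, v) ∈ hitSet r ∧ entryTime r (x, v) ≤ s ∧ s ≤ exitTime r (x, v)} =
          (fun x => x + s • v) ⁻¹' Metric.closedBall 0 r := by
        ext x
        exact (mem_closedBall_iff_mem_transit hr.le hv s).symm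
      rw [this, measure_preimage_add_right, meanCount, ENNReal.ofReal_mul hlam,
        ENNReal.ofReal_toReal measure_closedBall_lt_top.ne]
    rw [lintegral_congr_ae hval]
    simp

/-! ### Sums over distinct indices -/

section DistinctSum

variable {ι : Type*}

/-- The sum of `∏ i, f i (j i)` over all families `j` of `k` distinct indices. -/
noncomputable def distinctSum {k : ℕ} (f : Fin k → ι → ℝ) : ℝ :=
  ∑' j : Fin k ↪ ι, ∏ i, f i (j i)

lemma finite_setOf_embedding {k : ℕ} {S : Set ι} (hS : S.Finite) :
    {j : Fin k ↪ ι | ∀ i, j i ∈ S}.Finite := by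
  have h : {j : Fin k → ι | ∀ i, j i ∈ S}.Finite := Set.Finite.pi' fun _ => hS
  refine Set.Finite.of_finite_image (f := fun j : Fin k ↪ ι => (j : Fin k → ι)) (h.subset ?_)
    DFunLike.coe_injective.injOn
  rintro _ ⟨j, hj, rfl⟩
  exact hj

lemma summable_prod_embedding {k : ℕ} {f : Fin k → ι → ℝ} {S : Set ι} (hS : S.Finite)
    (hf : ∀ i x, x ∉ S → f i x = 0) : Summable fun j : Fin k ↪ ι => ∏ i, f i (j i) := by
  refine summable_of_hasFiniteSupport ((finite_setOf_embedding hS).subset fun j hj i => ?_)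
  by_contra hi
  exact hj (Finset.prod_eq_zero (Finset.mem_univ i) (hf i _ hi))

lemma distinctSum_zero (f : Fin 0 → ι → ℝ) : distinctSum f = 1 := by
  simp [distinctSum]

/-- A sum over `k + 1` distinct indices is an iterated sum. -/
lemma tsum_embedding_succ {k : ℕ} (f : Fin (k + 1) → ι → ℝ)
    (hs : Summable fun j : Fin (k + 1) ↪ ι => ∏ i, f i (j i)) :
    ∑' j : Fin (k + 1) ↪ ι, ∏ i, f i (j i) =
      ∑' j : Fin k ↪ ι, ∑' x : {x // x ∉ Set.range j}, (∏ i, f i.succ (j i)) * f 0 x := by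
  obtain ⟨E, hE⟩ : ∃ E : (Σ j : Fin k ↪ ι, {x // x ∉ Set.range j}) ≃ (Fin (k + 1) ↪ ι),
      ∀ q, (E q : Fin (k + 1) → ι) = Fin.cons q.2.1 q.1 :=
    ⟨(Equiv.embeddingFinSucc k ι).symm, Equiv.coe_embeddingFinSucc_symm⟩
  have h1 : ∀ q : (Σ j : Fin k ↪ ι, {x // x ∉ Set.range j}),
      ∏ i, f i (E q i) = (∏ i, f i.succ (q.1 i)) * f 0 q.2.1 := by
    intro q
    rw [hE, Fin.prod_univ_succ, mul_comm]
    simp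
  generalize hF : (fun j : Fin (k + 1) ↪ ι => ∏ i, f i (j i)) = F at hs
  have h2 := E.summable_iff.2 hs
  have h3 : F ∘ E = fun q => (∏ i, f i.succ (q.1 i)) * f 0 q.2.1 := by
    rw [← hF]; exact funext h1
  rw [← E.tsum_eq F]
  rw [h3] at h2
  calc ∑' q, F (E q) = ∑' q : (Σ j : Fin k ↪ ι, {x // x ∉ Set.range j}),
        (∏ i, f i.succ (q.1 i)) * f 0 q.2.1 := congrArg tsum h3
    _ = _ := h2.tsum_sigma

/-- The last index ranges over everything except the indices already chosen. -/
lemma distinctSum_succ {k : ℕ} {f : Fin (k + 1) → ι → ℝ} {S : Set ι} (hS : S.Finite)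
    (hf : ∀ i x, x ∉ S → f i x = 0) :
    distinctSum f = distinctSum (fun i => f i.succ) * (∑' x, f 0 x) -
      ∑ l : Fin k, distinctSum fun i x => if i = l then f i.succ x * f 0 x else f i.succ x := by
  have hs0 : Summable (f 0) := summable_of_hasFiniteSupport (hS.subset fun x hx => by
    by_contra h; exact hx (hf 0 x h))
  have hs := summable_prod_embedding hS hf
  have hs' : Summable fun j : Fin k ↪ ι => ∏ i, f i.succ (j i) :=
    summable_prod_embedding hS fun i x hx => hf i.succ x hx
  have hsl : ∀ l : Fin k, Summable fun j : Fin k ↪ ι =>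
      ∏ i, (if i = l then f i.succ (j i) * f 0 (j i) else f i.succ (j i)) := fun l =>
    summable_prod_embedding (f := fun i x => if i = l then f i.succ x * f 0 x else f i.succ x) hS
      fun i x hx => by simp [hf _ x hx]
  have hprod : ∀ (j : Fin k ↪ ι) (l : Fin k),
      ∏ i, (if i = l then f i.succ (j i) * f 0 (j i) else f i.succ (j i)) =
        (∏ i, f i.succ (j i)) * f 0 (j l) := by
    intro j l
    have : ∀ i, (if i = l then f i.succ (j i) * f 0 (j i) else f i.succ (j i)) =
        f i.succ (j i) * (if i = l then f 0 (j i) else 1) := by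
      intro i; split_ifs <;> ring
    simp_rw [this]
    rw [Finset.prod_mul_distrib]
    simp
  have hstep := tsum_embedding_succ f hs
  have hinner : ∀ j : Fin k ↪ ι, ∑' x : {x // x ∉ Set.range j},
      (∏ i, f i.succ (j i)) * f 0 x =
        (∏ i, f i.succ (j i)) * (∑' x, f 0 x) -
          ∑ l, ∏ i, (if i = l then f i.succ (j i) * f 0 (j i) else f i.succ (j i)) := by
    intro j
    have h3 := hs0.tsum_subtype_add_tsum_subtype_compl (Set.range j)
    rw [tsum_range _ j.injective, tsum_fintype] at h3
    rw [tsum_mul_left]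
    simp_rw [hprod]
    rw [← Finset.mul_sum, ← mul_sub, ← h3]
    congr 1
    rw [add_sub_cancel_left]
    rfl
  rw [distinctSum, hstep]
  simp_rw [hinner]
  rw [Summable.tsum_sub (hs'.mul_right _) (summable_sum fun l _ => hsl l), tsum_mul_right,
    Summable.tsum_finsetSum fun l _ => hsl l]
  rfl

variable {a b c d : ι → ℝ} {S : Set ι}

lemma distinctSum_one (hS : S.Finite) (ha : ∀ x, x ∉ S → a x = 0) :
    distinctSum ![a] = ∑' x, a x := by
  rw [distinctSum_succ hS (by simpa using ha)]
  simp [distinctSum_zero]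

lemma distinctSum_two (hS : S.Finite) (ha : ∀ x, x ∉ S → a x = 0) (hb : ∀ x, x ∉ S → b x = 0) :
    distinctSum ![a, b] = (∑' x, a x) * (∑' x, b x) - ∑' x, a x * b x := by
  rw [distinctSum_succ hS (by simpa [Fin.forall_fin_succ] using ⟨ha, hb⟩), Fin.sum_univ_one]
  have e1 : (fun i : Fin 1 => ![a, b] i.succ) = ![b] := by ext i; fin_cases i; rfl
  have e2 : (fun (i : Fin 1) x => if i = 0 then ![a, b] i.succ x * ![a, b] 0 x
      else ![a, b] i.succ x) = ![fun x => a x * b x] := by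
    ext i x; fin_cases i; simp [mul_comm]
  rw [e1, e2, distinctSum_one hS hb, distinctSum_one hS fun x hx => by simp [ha x hx]]
  simp [mul_comm]

lemma distinctSum_three (hS : S.Finite) (ha : ∀ x, x ∉ S → a x = 0) (hb : ∀ x, x ∉ S → b x = 0)
    (hc : ∀ x, x ∉ S → c x = 0) :
    distinctSum ![a, b, c] = (∑' x, a x) * (∑' x, b x) * (∑' x, c x)
      - (∑' x, a x * b x) * (∑' x, c x) - (∑' x, a x * c x) * (∑' x, b x)
      - (∑' x, b x * c x) * (∑' x, a x) + 2 * ∑' x, a x * b x * c x := by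
  rw [distinctSum_succ hS (by simpa [Fin.forall_fin_succ] using ⟨ha, hb, hc⟩), Fin.sum_univ_two]
  have e1 : (fun i : Fin 2 => ![a, b, c] i.succ) = ![b, c] := by ext i; fin_cases i <;> rfl
  have e2 : (fun (i : Fin 2) x => if i = 0 then ![a, b, c] i.succ x * ![a, b, c] 0 x
      else ![a, b, c] i.succ x) = ![fun x => a x * b x, c] := by
    ext i x; fin_cases i <;> simp [mul_comm]
  have e3 : (fun (i : Fin 2) x => if i = 1 then ![a, b, c] i.succ x * ![a, b, c] 0 x
      else ![a, b, c] i.succ x) = ![b, fun x => a x * c x] := by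
    ext i x; fin_cases i <;> simp [mul_comm]
  rw [e1, e2, e3, distinctSum_two hS hb hc, distinctSum_two hS (fun x hx => by simp [ha x hx]) hc,
    distinctSum_two hS hb fun x hx => by simp [ha x hx]]
  have e4 : ∀ x, b x * (a x * c x) = a x * b x * c x := fun x => by ring
  simp only [e4, Matrix.cons_val_zero]
  ring

lemma distinctSum_four (hS : S.Finite) (ha : ∀ x, x ∉ S → a x = 0) (hb : ∀ x, x ∉ S → b x = 0)
    (hc : ∀ x, x ∉ S → c x = 0) (hd : ∀ x, x ∉ S → d x = 0) :
    distinctSum ![a, b, c, d] = distinctSum ![b, c, d] * (∑' x, a x)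
      - distinctSum ![fun x => a x * b x, c, d] - distinctSum ![fun x => a x * c x, b, d]
      - distinctSum ![fun x => a x * d x, b, c] := by
  rw [distinctSum_succ hS (by simpa [Fin.forall_fin_succ] using ⟨ha, hb, hc, hd⟩),
    Fin.sum_univ_three]
  have e1 : (fun i : Fin 3 => ![a, b, c, d] i.succ) = ![b, c, d] := by
    ext i; fin_cases i <;> rfl
  have e2 : (fun (i : Fin 3) x => if i = 0 then ![a, b, c, d] i.succ x * ![a, b, c, d] 0 x
      else ![a, b, c, d] i.succ x) = ![fun x => a x * b x, c, d] := by
    ext i x; fin_cases i <;> simp [mul_comm]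
  have e3 : (fun (i : Fin 3) x => if i = 1 then ![a, b, c, d] i.succ x * ![a, b, c, d] 0 x
      else ![a, b, c, d] i.succ x) = ![b, fun x => a x * c x, d] := by
    ext i x; fin_cases i <;> simp [mul_comm]
  have e4 : (fun (i : Fin 3) x => if i = 2 then ![a, b, c, d] i.succ x * ![a, b, c, d] 0 x
      else ![a, b, c, d] i.succ x) = ![b, c, fun x => a x * d x] := by
    ext i x; fin_cases i <;> simp [mul_comm]
  have hac : ∀ x, x ∉ S → a x * c x = 0 := fun x hx => by simp [ha x hx]
  have had : ∀ x, x ∉ S → a x * d x = 0 := fun x hx => by simp [ha x hx]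
  rw [e1, e2, e3, e4, distinctSum_three hS hb hac hd, distinctSum_three hS hb hc had,
    distinctSum_three hS hac hb hd, distinctSum_three hS had hb hc]
  have t1 : ∀ x, a x * c x * b x = b x * (a x * c x) := fun x => by ring
  have t2 : ∀ x, a x * d x * b x = b x * (a x * d x) := fun x => by ring
  have t3 : ∀ x, a x * d x * c x = c x * (a x * d x) := fun x => by ring
  have t4 : ∀ x, b x * (a x * d x) * c x = b x * c x * (a x * d x) := fun x => by ring
  simp only [t1, t2, t3, t4, Matrix.cons_val_zero]
  ring

/-- The product of two off-diagonal double sums, sorted by the coincidences among the four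
indices. -/
lemma offDiagonal_mul_offDiagonal (hS : S.Finite) (ha : ∀ x, x ∉ S → a x = 0)
    (hb : ∀ x, x ∉ S → b x = 0) :
    ((∑' x, a x) ^ 2 - ∑' x, a x ^ 2) * ((∑' x, b x) ^ 2 - ∑' x, b x ^ 2) =
      2 * distinctSum ![fun x => a x * b x, fun x => a x * b x] +
      4 * distinctSum ![fun x => a x * b x, a, b] + distinctSum ![a, a, b, b] := by
  have hab : ∀ x, x ∉ S → a x * b x = 0 := fun x hx => by simp [ha x hx]
  have haa : ∀ x, x ∉ S → a x * a x = 0 := fun x hx => by simp [ha x hx]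
  rw [distinctSum_two hS hab hab, distinctSum_three hS hab ha hb, distinctSum_four hS ha ha hb hb,
    distinctSum_three hS ha hb hb, distinctSum_three hS haa hb hb, distinctSum_three hS hab ha hb]
  have t1 : ∀ x, a x ^ 2 = a x * a x := fun x => by ring
  have t2 : ∀ x, b x ^ 2 = b x * b x := fun x => by ring
  have t3 : ∀ x, a x * a x * b x = a x * b x * a x := fun x => by ring
  have t4 : ∀ x, a x * b x * (a x * b x) = a x * b x * a x * b x := fun x => by ring
  simp only [t1, t2, t3, t4]
  ring

/-- The fourth central moment of a sum of indicators in terms of factorial moments. -/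
lemma tsum_sub_pow_four_of_sq_eq (hS : S.Finite) (ha : ∀ x, x ∉ S → a x = 0)
    (hsq : ∀ x, a x * a x = a x) (ρ : ℝ) :
    (∑' x, a x - ρ) ^ 4 = distinctSum ![a, a, a, a] + (6 - 4 * ρ) * distinctSum ![a, a, a] +
      (7 - 12 * ρ + 6 * ρ ^ 2) * distinctSum ![a, a] +
      (1 - 4 * ρ + 6 * ρ ^ 2 - 4 * ρ ^ 3) * distinctSum ![a] + ρ ^ 4 := by
  rw [distinctSum_four hS ha ha ha ha]
  simp only [hsq]
  rw [distinctSum_three hS ha ha ha, distinctSum_two hS ha ha, distinctSum_one hS ha]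
  simp only [hsq]
  ring

end DistinctSum

/-! ### Moments of linear statistics -/

section Moments

variable {Ω Z : Type*} [MeasurableSpace Ω] [MeasurableSpace Z]

/-- The point process with points `z j`, `j ∈ ℤ`, has the factorial moment measures of a Poisson
process with intensity measure `Λ`. -/
structure HasPoissonMoments (P : Measure Ω) (Λ : Measure Z) (z : ℤ → Ω → Z) : Prop where
  measurable : ∀ j, Measurable (z j)
  factorialMoment : ∀ k : ℕ, Measure.sum (fun j : Fin k ↪ ℤ => P.map fun ω i => z (j i) ω) =
    Measure.pi fun _ : Fin k => Λ

/-- Bounded measurable functions supported in a set of finite measure. -/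
structure IsTestFunction (Λ : Measure Z) (f : Z → ℝ) : Prop where
  measurable : Measurable f
  bounded : ∃ C, ∀ x, |f x| ≤ C
  support_ne_top : Λ {x | f x ≠ 0} ≠ ∞

/-- The linear statistic `∑_j f (z_j)` of a point process. -/
noncomputable def linearStat (z : ℤ → Ω → Z) (f : Z → ℝ) (ω : Ω) : ℝ := ∑' j, f (z j ω)

variable {P : Measure Ω} {Λ : Measure Z} {z : ℤ → Ω → Z} {f g : Z → ℝ}

lemma IsTestFunction.measurableSet_support (hf : IsTestFunction Λ f) :
    MeasurableSet {x | f x ≠ 0} :=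
  hf.measurable (measurableSet_singleton (0 : ℝ)).compl

lemma IsTestFunction.integrable (hf : IsTestFunction Λ f) : Integrable f Λ := by
  obtain ⟨C, hC⟩ := hf.bounded
  have h : IntegrableOn f {x | f x ≠ 0} Λ :=
    Measure.integrableOn_of_bounded hf.support_ne_top hf.measurable.aestronglyMeasurable
      (ae_of_all _ hC)
  exact (integrableOn_iff_integrable_of_support_subset fun x hx => hx).1 h

lemma IsTestFunction.mul (hf : IsTestFunction Λ f) (hg : IsTestFunction Λ g) :
    IsTestFunction Λ fun x => f x * g x := by
  obtain ⟨C, hC⟩ := hf.bounded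
  obtain ⟨D, hD⟩ := hg.bounded
  refine ⟨hf.measurable.mul hg.measurable, ⟨C * D, fun x => ?_⟩,
    ne_top_of_le_ne_top hf.support_ne_top (measure_mono fun x hx h => hx ?_)⟩
  · rw [abs_mul]
    exact mul_le_mul (hC x) (hD x) (abs_nonneg _) ((abs_nonneg _).trans (hC x))
  · rw [h, zero_mul]

lemma IsTestFunction.sub (hf : IsTestFunction Λ f) (hg : IsTestFunction Λ g) :
    IsTestFunction Λ fun x => f x - g x := by
  obtain ⟨C, hC⟩ := hf.bounded
  obtain ⟨D, hD⟩ := hg.bounded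
  refine ⟨hf.measurable.sub hg.measurable, ⟨C + D, fun x => ?_⟩,
    ne_top_of_le_ne_top (ENNReal.add_ne_top.2 ⟨hf.support_ne_top, hg.support_ne_top⟩)
      ((measure_mono fun x hx => ?_).trans (measure_union_le _ _))⟩
  · exact (abs_sub _ _).trans (add_le_add (hC x) (hD x))
  · by_contra h
    simp only [Set.mem_union, Set.mem_ofPred_eq, not_or, not_not] at h
    exact hx (by rw [h.1, h.2, sub_zero])

lemma vecCons_comp {ι Y : Type*} {k : ℕ} (p : Y → ℝ) (F : Fin k → Y → ℝ) (y : ι → Y) :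
    (fun i j => Matrix.vecCons p F i (y j)) =
      Matrix.vecCons (fun j => p (y j)) (fun i j => F i (y j)) := by
  ext i j
  exact Fin.cases rfl (fun _ => rfl) i

lemma vecEmpty_comp {ι Y : Type*} (y : ι → Y) :
    (fun i j => (![] : Fin 0 → Y → ℝ) i (y j)) = ![] := Subsingleton.elim _ _

namespace HasPoissonMoments

lemma tsum_measure_preimage [SigmaFinite Λ] (h : HasPoissonMoments P Λ z) {W : Set Z}
    (hW : MeasurableSet W) : ∑' j, P (z j ⁻¹' W) = Λ W := by
  have h1 := congrArg (fun m : Measure (Fin 1 → Z) => m (Set.univ.pi fun _ => W))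
    (h.factorialMoment 1)
  simp only [Measure.pi_pi, Finset.univ_unique, Finset.prod_const, Finset.card_singleton,
    pow_one] at h1
  have hpi : MeasurableSet (Set.univ.pi fun _ : Fin 1 => W) := MeasurableSet.univ_pi fun _ => hW
  rw [Measure.sum_apply _ hpi] at h1
  rw [← h1, ← (Function.Embedding.oneEmbeddingEquiv (one := Fin 1) (α := ℤ)).tsum_eq]
  refine tsum_congr fun j => ?_
  rw [Measure.map_apply (measurable_pi_lambda _ fun i => h.measurable _) hpi]
  congr 1
  ext ω
  simp [Function.Embedding.oneEmbeddingEquiv]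

lemma ae_finite [SigmaFinite Λ] (h : HasPoissonMoments P Λ z) {W : Set Z}
    (hW : MeasurableSet W) (hW' : Λ W ≠ ∞) : ∀ᵐ ω ∂P, {j | z j ω ∈ W}.Finite :=
  ae_finite_setOfPred_mem (s := fun j => z j ⁻¹' W) (by rwa [h.tsum_measure_preimage hW])

lemma integral_distinctSum [SigmaFinite Λ] (h : HasPoissonMoments P Λ z) {k : ℕ}
    (f : Fin k → Z → ℝ) (hf : ∀ i, IsTestFunction Λ (f i)) :
    Integrable (fun ω => distinctSum fun i j => f i (z j ω)) P ∧
      ∫ ω, distinctSum (fun i j => f i (z j ω)) ∂P = ∏ i, ∫ x, f i x ∂Λ := by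
  have : Countable (Fin k ↪ ℤ) := DFunLike.coe_injective.countable
  let F : (Fin k → Z) → ℝ := fun x => ∏ i, f i (x i)
  have hFm : Measurable F := by
    have := fun i => (hf i).measurable
    exact Finset.measurable_fun_prod _ fun i _ => (this i).comp (measurable_pi_apply i)
  have hFi : Integrable F (Measure.pi fun _ => Λ) :=
    Integrable.fintype_prod fun i => (hf i).integrable
  have hzm : ∀ j : Fin k ↪ ℤ, Measurable fun ω i => z (j i) ω := fun j =>
    measurable_pi_lambda _ fun i => h.measurable _
  have hFS := hFi
  rw [← h.factorialMoment k] at hFS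
  have hsum : ∑' j : Fin k ↪ ℤ, ∫⁻ ω, ‖F fun i => z (j i) ω‖ₑ ∂P ≠ ∞ := by
    have h1 := hFS.hasFiniteIntegral.ne
    rw [lintegral_sum_measure] at h1
    simp_rw [lintegral_map hFm.enorm (hzm _)] at h1
    exact h1
  have hm : ∀ j : Fin k ↪ ℤ, Measurable fun ω => F fun i => z (j i) ω := fun j =>
    hFm.comp (hzm j)
  refine ⟨⟨(Measurable.tsum hm).aestronglyMeasurable, ?_⟩, ?_⟩
  · refine lt_of_le_of_lt (lintegral_mono fun ω => enorm_tsum_le_tsum_enorm) ?_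
    rw [lintegral_tsum fun j => (hm j).enorm.aemeasurable]
    exact hsum.lt_top
  · have h2 : ∫ ω, distinctSum (fun i j => f i (z j ω)) ∂P =
        ∑' j : Fin k ↪ ℤ, ∫ ω, F (fun i => z (j i) ω) ∂P :=
      integral_tsum (fun j => (hm j).aestronglyMeasurable) hsum
    rw [h2]
    have h3 := (hasSum_integral_measure hFS).tsum_eq
    rw [h.factorialMoment k, integral_fintype_prod_eq_prod] at h3
    rw [← h3]
    exact tsum_congr fun j => (integral_map (hzm j).aemeasurable hFm.aestronglyMeasurable).symm

lemma measurable_linearStat (h : HasPoissonMoments P Λ z) (hf : Measurable f) :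
    Measurable (linearStat z f) :=
  Measurable.tsum fun j => hf.comp (h.measurable j)

variable [SigmaFinite Λ]

lemma ae_finite_support (h : HasPoissonMoments P Λ z) (hf : IsTestFunction Λ f) :
    ∀ᵐ ω ∂P, {j | f (z j ω) ≠ 0}.Finite :=
  h.ae_finite hf.measurableSet_support hf.support_ne_top

/-- The mean of a linear statistic. -/
lemma integral_linearStat (h : HasPoissonMoments P Λ z) (hf : IsTestFunction Λ f) :
    Integrable (linearStat z f) P ∧ ∫ ω, linearStat z f ω ∂P = ∫ x, f x ∂Λ := by
  have h1 := h.integral_distinctSum ![f] (by simpa using hf)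
  have hae : (fun ω => distinctSum fun i j => ![f] i (z j ω)) =ᵐ[P] linearStat z f := by
    filter_upwards [h.ae_finite_support hf] with ω hω
    have := distinctSum_one (a := fun j => f (z j ω)) hω (by simp)
    rw [linearStat, ← this]
    congr 1; ext i j; fin_cases i; rfl
  refine ⟨h1.1.congr hae, ?_⟩
  rw [← integral_congr_ae hae, h1.2]
  simp

/-- The second moment of a linear statistic. -/
lemma integral_linearStat_sq (h : HasPoissonMoments P Λ z) (hf : IsTestFunction Λ f) :
    Integrable (fun ω => linearStat z f ω ^ 2) P ∧
      ∫ ω, linearStat z f ω ^ 2 ∂P = ∫ x, f x ^ 2 ∂Λ + (∫ x, f x ∂Λ) ^ 2 := by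
  have h1 := h.integral_distinctSum ![f, f] (by simp [Fin.forall_fin_succ, hf])
  have h2 := h.integral_linearStat (hf.mul hf)
  have hae : (fun ω => (distinctSum fun i j => ![f, f] i (z j ω)) +
      linearStat z (fun x => f x * f x) ω) =ᵐ[P] fun ω => linearStat z f ω ^ 2 := by
    filter_upwards [h.ae_finite_support hf] with ω hω
    have h3 := distinctSum_two (a := fun j => f (z j ω)) (b := fun j => f (z j ω)) hω
      (by simp) (by simp)
    have h4 : (fun (i : Fin 2) j => ![f, f] i (z j ω)) =
        ![fun j => f (z j ω), fun j => f (z j ω)] := by ext i j; fin_cases i <;> rfl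
    rw [h4, h3]
    simp only [linearStat]
    ring
  refine ⟨(h1.1.add h2.1).congr hae, ?_⟩
  rw [← integral_congr_ae hae, integral_add h1.1 h2.1, h1.2, h2.2]
  simp only [Fin.prod_univ_two, Matrix.cons_val_zero, Matrix.cons_val_one, sq]
  ring

/-- Covariance of two off-diagonal double sums built from centred functions. -/
lemma integral_offDiagonal_mul (h : HasPoissonMoments P Λ z) (hf : IsTestFunction Λ f)
    (hg : IsTestFunction Λ g) (hf0 : ∫ x, f x ∂Λ = 0) (hg0 : ∫ x, g x ∂Λ = 0) :
    Integrable (fun ω => (linearStat z f ω ^ 2 - linearStat z (fun x => f x ^ 2) ω) *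
      (linearStat z g ω ^ 2 - linearStat z (fun x => g x ^ 2) ω)) P ∧
    ∫ ω, (linearStat z f ω ^ 2 - linearStat z (fun x => f x ^ 2) ω) *
      (linearStat z g ω ^ 2 - linearStat z (fun x => g x ^ 2) ω) ∂P =
        2 * (∫ x, f x * g x ∂Λ) ^ 2 := by
  have hfg := hf.mul hg
  have h2 := h.integral_distinctSum ![fun x => f x * g x, fun x => f x * g x]
    (by simp [Fin.forall_fin_succ, hfg])
  have h3 := h.integral_distinctSum ![fun x => f x * g x, f, g]
    (by simp [Fin.forall_fin_succ, hfg, hf, hg])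
  have h4 := h.integral_distinctSum ![f, f, g, g] (by simp [Fin.forall_fin_succ, hf, hg])
  have hae : (fun ω => 2 * (distinctSum fun i j =>
        ![fun x => f x * g x, fun x => f x * g x] i (z j ω)) +
      4 * (distinctSum fun i j => ![fun x => f x * g x, f, g] i (z j ω)) +
      distinctSum fun i j => ![f, f, g, g] i (z j ω)) =ᵐ[P]
      fun ω => (linearStat z f ω ^ 2 - linearStat z (fun x => f x ^ 2) ω) *
      (linearStat z g ω ^ 2 - linearStat z (fun x => g x ^ 2) ω) := by
    filter_upwards [h.ae_finite_support hf, h.ae_finite_support hg] with ω hω hω'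
    have key := offDiagonal_mul_offDiagonal (a := fun j => f (z j ω)) (b := fun j => g (z j ω))
      (hω.union hω') (fun j hj => by by_contra hn; exact hj (Or.inl hn))
      (fun j hj => by by_contra hn; exact hj (Or.inr hn))
    simp only [linearStat, vecCons_comp, vecEmpty_comp]
    rw [key]
  refine ⟨(((h2.1.const_mul 2).fun_add (h3.1.const_mul 4)).fun_add h4.1).congr hae, ?_⟩
  rw [← integral_congr_ae hae, integral_add ((h2.1.const_mul 2).fun_add (h3.1.const_mul 4)) h4.1,
    integral_add (h2.1.const_mul 2) (h3.1.const_mul 4), integral_const_mul, integral_const_mul,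
    h2.2, h3.2, h4.2]
  -- The terms in which some index occurs only once vanish, because `f` and `g` are centred.
  simp only [Fin.prod_univ_succ, Matrix.cons_val_zero, Matrix.cons_val_succ, hf0, hg0]
  simp [sq]

/-- The fourth central moment of a count. -/
lemma integral_count_sub_pow_four (h : HasPoissonMoments P Λ z) (hf : IsTestFunction Λ f)
    (hsq : ∀ x, f x * f x = f x) {ρ : ℝ} (hρ : ∫ x, f x ∂Λ = ρ) [IsProbabilityMeasure P] :
    Integrable (fun ω => (linearStat z f ω - ρ) ^ 4) P ∧
      ∫ ω, (linearStat z f ω - ρ) ^ 4 ∂P = ρ + 3 * ρ ^ 2 := by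
  have h1 := h.integral_distinctSum ![f] (by simpa using hf)
  have h2 := h.integral_distinctSum ![f, f] (by simp [Fin.forall_fin_succ, hf])
  have h3 := h.integral_distinctSum ![f, f, f] (by simp [Fin.forall_fin_succ, hf])
  have h4 := h.integral_distinctSum ![f, f, f, f] (by simp [Fin.forall_fin_succ, hf])
  have hae : (fun ω => (distinctSum fun i j => ![f, f, f, f] i (z j ω)) +
      (6 - 4 * ρ) * (distinctSum fun i j => ![f, f, f] i (z j ω)) +
      (7 - 12 * ρ + 6 * ρ ^ 2) * (distinctSum fun i j => ![f, f] i (z j ω)) +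
      (1 - 4 * ρ + 6 * ρ ^ 2 - 4 * ρ ^ 3) * (distinctSum fun i j => ![f] i (z j ω)) + ρ ^ 4)
      =ᵐ[P] fun ω => (linearStat z f ω - ρ) ^ 4 := by
    filter_upwards [h.ae_finite_support hf] with ω hω
    have key := tsum_sub_pow_four_of_sq_eq (a := fun j => f (z j ω)) hω (by simp)
      (fun j => hsq _) ρ
    simp only [linearStat, vecCons_comp, vecEmpty_comp]
    rw [key]
  have i3 := h3.1.const_mul (6 - 4 * ρ)
  have i2 := h2.1.const_mul (7 - 12 * ρ + 6 * ρ ^ 2)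
  have i1 := h1.1.const_mul (1 - 4 * ρ + 6 * ρ ^ 2 - 4 * ρ ^ 3)
  refine ⟨((((h4.1.fun_add i3).fun_add i2).fun_add i1).fun_add
    (integrable_const (ρ ^ 4))).congr hae, ?_⟩
  rw [← integral_congr_ae hae,
    integral_add (((h4.1.fun_add i3).fun_add i2).fun_add i1) (integrable_const (ρ ^ 4)),
    integral_add ((h4.1.fun_add i3).fun_add i2) i1, integral_add (h4.1.fun_add i3) i2,
    integral_add h4.1 i3, integral_const_mul, integral_const_mul, integral_const_mul,
    h1.2, h2.2, h3.2, h4.2]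
  simp [Fin.prod_univ_succ, hρ]
  ring

end HasPoissonMoments

end Moments

/-! ### A single transit -/

section SingleTransit

/-- The squared increment over `[s, s + t]` of the indicator of `[α, β]`. -/
noncomputable def sqIncr (α β t s : ℝ) : ℝ :=
  ((Set.Icc α β).indicator 1 (s + t) - (Set.Icc α β).indicator 1 s) ^ 2

lemma sqIncr_nonneg (α β t s : ℝ) : 0 ≤ sqIncr α β t s := sq_nonneg _

lemma sqIncr_le {α β t : ℝ} (ht : 0 ≤ t) (s : ℝ) :
    sqIncr α β t s ≤
      (Set.Icc (α - t) α).indicator 1 s + (Set.Icc (β - t) β).indicator 1 s := by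
  simp only [sqIncr, Set.indicator_apply, Set.mem_Icc, Pi.one_apply]
  split_ifs with h1 h2 h3 h4 h5 h6 h7 h8 h9 h10 h11 h12 <;> norm_num <;> grind

lemma sqIncr_eq {α β t : ℝ} (ht : 0 ≤ t) (hαβ : t ≤ β - α) (s : ℝ) :
    sqIncr α β t s =
      (Set.Ico (α - t) α).indicator 1 s + (Set.Ioc (β - t) β).indicator 1 s := by
  simp only [sqIncr, Set.indicator_apply, Set.mem_Icc, Set.mem_Ico, Set.mem_Ioc, Pi.one_apply]
  split_ifs <;> norm_num <;> grind

lemma integral_indicator_one_inter {X : Set ℝ} (hX : MeasurableSet X) (u : ℝ) :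
    ∫ s in Set.Ioc 0 u, X.indicator (1 : ℝ → ℝ) s = volume.real (X ∩ Set.Ioc 0 u) := by
  rw [integral_indicator_one hX, measureReal_restrict_apply hX]

lemma integrableOn_indicator_one {X : Set ℝ} (hX : MeasurableSet X) (u : ℝ) :
    IntegrableOn (X.indicator (1 : ℝ → ℝ)) (Set.Ioc 0 u) :=
  (integrableOn_const (by simp)).indicator hX

lemma measurable_sqIncr (α β t : ℝ) : Measurable (sqIncr α β t) := by
  have h : Measurable ((Set.Icc α β).indicator (1 : ℝ → ℝ)) :=
    measurable_one.indicator measurableSet_Icc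
  exact ((h.comp (measurable_add_const t)).sub h).pow_const 2

lemma integrableOn_sqIncr {α β t : ℝ} (ht : 0 ≤ t) (u : ℝ) :
    IntegrableOn (sqIncr α β t) (Set.Ioc 0 u) := by
  refine ((integrableOn_indicator_one measurableSet_Icc u).add
    (integrableOn_indicator_one measurableSet_Icc u)).mono'
      (g := fun s => (Set.Icc (α - t) α).indicator 1 s + (Set.Icc (β - t) β).indicator 1 s)
      (measurable_sqIncr α β t).aestronglyMeasurable (ae_of_all _ fun s => ?_)
  rw [Real.norm_of_nonneg (sqIncr_nonneg _ _ _ _)]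
  exact sqIncr_le ht s

lemma integral_sqIncr_le {α β t : ℝ} (ht : 0 ≤ t) (u : ℝ) :
    ∫ s in Set.Ioc 0 u, sqIncr α β t s ≤ 2 * t := by
  have h1 := integrableOn_indicator_one (X := Set.Icc (α - t) α) measurableSet_Icc u
  have h2 := integrableOn_indicator_one (X := Set.Icc (β - t) β) measurableSet_Icc u
  have hle : ∀ γ : ℝ, volume.real (Set.Icc (γ - t) γ ∩ Set.Ioc 0 u) ≤ t := by
    intro γ
    refine (measureReal_mono Set.inter_subset_left (by simp)).trans ?_
    rw [Real.volume_real_Icc_of_le (by linarith)]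
    linarith
  refine (setIntegral_mono (integrableOn_sqIncr ht u) (h1.add h2) (sqIncr_le ht)).trans ?_
  rw [integral_add' h1 h2, integral_indicator_one_inter measurableSet_Icc,
    integral_indicator_one_inter measurableSet_Icc]
  linarith [hle α, hle β]

lemma integral_sqIncr_eq_zero {α β t T : ℝ} (ht : 0 ≤ t)
    (hα : α < 0 ∨ T < α) (hβ : β < 0 ∨ T < β) :
    ∫ s in Set.Ioc 0 (T - t), sqIncr α β t s = 0 := by
  refine setIntegral_eq_zero_of_forall_eq_zero fun s hs => ?_
  refine le_antisymm ((sqIncr_le ht s).trans ?_) (sqIncr_nonneg _ _ _ _)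
  rw [Set.indicator_of_notMem, Set.indicator_of_notMem, add_zero]
  · rintro ⟨h1, h2⟩; obtain ⟨h3, h4⟩ := hs; rcases hβ with h | h <;> linarith
  · rintro ⟨h1, h2⟩; obtain ⟨h3, h4⟩ := hs; rcases hα with h | h <;> linarith

/-- Away from the ends of the observation period a transit of duration at least `t` contributes `t`
for its entry and `t` for its exit. -/
lemma integral_sqIncr_eq {α β t T : ℝ} (ht : 0 ≤ t) (hαβ : α ≤ β)
    (hα : α ∉ Set.Icc 0 t ∪ Set.Icc (T - t) T) (hβ : β ∉ Set.Icc 0 t ∪ Set.Icc (T - t) T)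
    (hshort : ¬ (α ∈ Set.Icc (-t) T ∧ β - α < t)) :
    ∫ s in Set.Ioc 0 (T - t), sqIncr α β t s =
      t * ((Set.Ioc 0 T).indicator 1 α + (Set.Ioc 0 T).indicator 1 β) := by
  simp only [Set.mem_union, Set.mem_Icc, not_or, not_and, not_le, not_lt] at hα hβ hshort
  have hout : ∀ γ : ℝ, (γ < 0 ∨ T < γ) → (Set.Ioc 0 T).indicator (1 : ℝ → ℝ) γ = 0 := by
    intro γ hγ
    refine Set.indicator_of_notMem ?_ _
    rintro ⟨h1, h2⟩
    rcases hγ with h | h <;> linarith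
  have hin : ∀ γ : ℝ, 0 < γ → γ ≤ T → (Set.Ioc 0 T).indicator (1 : ℝ → ℝ) γ = 1 := fun γ h1 h2 =>
    Set.indicator_of_mem (show γ ∈ Set.Ioc 0 T from ⟨h1, h2⟩) _
  rcases lt_or_ge (β - α) t with hlt | hge
  · have hα' : α < -t ∨ T < α := by
      by_contra hcon
      push Not at hcon
      linarith [hshort ⟨hcon.1, hcon.2⟩]
    have hα'' : α < 0 ∨ T < α := hα'.imp (fun h => by linarith) id
    have hβ' : β < 0 ∨ T < β := hα'.imp (fun h => by linarith) (fun h => by linarith)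
    rw [integral_sqIncr_eq_zero ht hα'' hβ', hout _ hα'', hout _ hβ']
    ring
  · have hsplit : ∀ γ : ℝ, (0 ≤ γ → t < γ) → (T - t ≤ γ → T < γ) →
        (γ < 0 ∨ T < γ) ∨ (t < γ ∧ γ < T - t) := by
      intro γ h1 h2
      rcases lt_or_ge γ 0 with h | h
      · exact Or.inl (Or.inl h)
      · rcases lt_or_ge γ (T - t) with h' | h'
        · exact Or.inr ⟨h1 h, h'⟩
        · exact Or.inl (Or.inr (h2 h'))
    have hval : ∀ (γ : ℝ) (X : Set ℝ), (0 ≤ γ → t < γ) → (T - t ≤ γ → T < γ) →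
        X ⊆ Set.Icc (γ - t) γ → volume.real X = t →
        volume.real (X ∩ Set.Ioc 0 (T - t)) = t * (Set.Ioc 0 T).indicator (1 : ℝ → ℝ) γ := by
      intro γ X h1 h2 hX hXt
      rcases hsplit γ h1 h2 with h | h
      · rw [hout _ h]
        have : X ∩ Set.Ioc 0 (T - t) = ∅ := by
          rw [Set.eq_empty_iff_forall_notMem]
          rintro s ⟨hs, h3, h4⟩
          obtain ⟨h5, h6⟩ := hX hs
          rcases h with h | h <;> linarith
        rw [this]; simp
      · rw [hin _ (by linarith) (by linarith), mul_one, Set.inter_eq_left.2, hXt]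
        intro s hs
        obtain ⟨h5, h6⟩ := hX hs
        exact ⟨by linarith, by linarith⟩
    have h1 := integrableOn_indicator_one (X := Set.Ico (α - t) α) measurableSet_Ico (T - t)
    have h2 := integrableOn_indicator_one (X := Set.Ioc (β - t) β) measurableSet_Ioc (T - t)
    have hfun : sqIncr α β t = (Set.Ico (α - t) α).indicator (1 : ℝ → ℝ) +
        (Set.Ioc (β - t) β).indicator (1 : ℝ → ℝ) := funext fun s => sqIncr_eq ht hge s
    rw [hfun, integral_add' h1 h2, integral_indicator_one_inter measurableSet_Ico,
      integral_indicator_one_inter measurableSet_Ioc,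
      hval α _ hα.1 hα.2 Set.Ico_subset_Icc_self
        (by rw [Real.volume_real_Ico_of_le (by linarith)]; ring),
      hval β _ hβ.1 hβ.2 Set.Ioc_subset_Icc_self
        (by rw [Real.volume_real_Ioc_of_le (by linarith)]; ring)]
    ring

end SingleTransit

/-! ### Statistics of the transit flow -/

section Flow

variable {Z : Type*}

/-- The indicator that the particle `x` is inside at time `s`. -/
noncomputable def occ (A : Set Z) (a b : Z → ℝ) (s : ℝ) (x : Z) : ℝ :=
  A.indicator (fun x => (Set.Icc (a x) (b x)).indicator 1 s) x

/-- The increment over `[s, s + t]` of the indicator that the particle `x` is inside. -/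
noncomputable def incr (A : Set Z) (a b : Z → ℝ) (t s : ℝ) (x : Z) : ℝ :=
  occ A a b (s + t) x - occ A a b s x

/-- The number of entries and exits of the particle `x` during `(0, T]`. -/
noncomputable def ends (A : Set Z) (a b : Z → ℝ) (T : ℝ) (x : Z) : ℝ :=
  A.indicator (fun x => (Set.Ioc 0 T).indicator 1 (a x) + (Set.Ioc 0 T).indicator 1 (b x)) x

/-- The contribution of the particle `x` alone to the integrated squared increments over lag `t`
of the number of particles inside. -/
noncomputable def cross (A : Set Z) (a b : Z → ℝ) (T t : ℝ) (x : Z) : ℝ :=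
  ∫ s in Set.Ioc 0 (T - t), incr A a b t s x ^ 2

/-- The particles that are inside at some time of `[0, T]`. -/
def visitors (A : Set Z) (a b : Z → ℝ) (T : ℝ) : Set Z := {x | x ∈ A ∧ a x ≤ T ∧ 0 ≤ b x}

variable {A : Set Z} {a b : Z → ℝ}

lemma occ_eq_indicator (s : ℝ) :
    occ A a b s = Set.indicator {x | x ∈ A ∧ a x ≤ s ∧ s ≤ b x} 1 := by
  ext x
  by_cases h : x ∈ A ∧ a x ≤ s ∧ s ≤ b x
  · rw [occ, Set.indicator_of_mem h.1, Set.indicator_of_mem (s := Set.Icc (a x) (b x)) h.2]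
    exact (Set.indicator_of_mem (s := {x | x ∈ A ∧ a x ≤ s ∧ s ≤ b x}) h 1).symm
  · refine Eq.trans ?_ (Set.indicator_of_notMem (s := {x | x ∈ A ∧ a x ≤ s ∧ s ≤ b x}) h 1).symm
    by_cases hx : x ∈ A
    · rw [occ, Set.indicator_of_mem hx]
      exact Set.indicator_of_notMem (s := Set.Icc (a x) (b x)) (fun hs => h ⟨hx, hs⟩) 1
    · rw [occ, Set.indicator_of_notMem hx]

lemma indicator_setOf_and {x : Z} (hx : x ∈ A) (α : Z → ℝ) (I : Set ℝ) :
    {x | x ∈ A ∧ α x ∈ I}.indicator (1 : Z → ℝ) x = I.indicator 1 (α x) := by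
  by_cases h : α x ∈ I
  · exact (Set.indicator_of_mem (s := {x | x ∈ A ∧ α x ∈ I}) ⟨hx, h⟩ _).trans
      (Set.indicator_of_mem h (1 : ℝ → ℝ)).symm
  · exact (Set.indicator_of_notMem (s := {x | x ∈ A ∧ α x ∈ I}) (fun h' => h h'.2) _).trans
      (Set.indicator_of_notMem h (1 : ℝ → ℝ)).symm

lemma occ_eq_zero_or_one (s : ℝ) (x : Z) : occ A a b s x = 0 ∨ occ A a b s x = 1 := by
  rw [occ_eq_indicator]
  by_cases hx : x ∈ {x | x ∈ A ∧ a x ≤ s ∧ s ≤ b x}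
  · exact Or.inr (Set.indicator_of_mem hx _)
  · exact Or.inl (Set.indicator_of_notMem hx _)

lemma occ_mul_self (s : ℝ) (x : Z) : occ A a b s x * occ A a b s x = occ A a b s x := by
  rcases occ_eq_zero_or_one (A := A) (a := a) (b := b) s x with h | h <;> simp [h]

lemma occ_eq_zero_of_notMem_visitors {T s : ℝ} (hs0 : 0 ≤ s) (hsT : s ≤ T) {x : Z}
    (hx : x ∉ visitors A a b T) : occ A a b s x = 0 := by
  rw [occ_eq_indicator]
  refine Set.indicator_of_notMem (fun h => hx ⟨h.1, h.2.1.trans hsT, hs0.trans h.2.2⟩) _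

lemma incr_sq_eq (t s : ℝ) (x : Z) :
    incr A a b t s x ^ 2 = A.indicator (fun x => sqIncr (a x) (b x) t s) x := by
  by_cases hx : x ∈ A <;> simp [incr, occ, sqIncr, hx]

lemma abs_incr (t s : ℝ) (x : Z) : |incr A a b t s x| = incr A a b t s x ^ 2 := by
  rcases occ_eq_zero_or_one (A := A) (a := a) (b := b) s x with h | h <;>
    rcases occ_eq_zero_or_one (A := A) (a := a) (b := b) (s + t) x with h' | h' <;>
      simp [incr, h, h']

lemma incr_sq_le_one (t s : ℝ) (x : Z) : incr A a b t s x ^ 2 ≤ 1 := by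
  rcases occ_eq_zero_or_one (A := A) (a := a) (b := b) s x with h | h <;>
    rcases occ_eq_zero_or_one (A := A) (a := a) (b := b) (s + t) x with h' | h' <;>
      simp [incr, h, h']

lemma incr_eq_zero_of_notMem_visitors {T t s : ℝ} (ht : 0 ≤ t) (hs : s ∈ Set.Ioc 0 (T - t)) {x : Z}
    (hx : x ∉ visitors A a b T) : incr A a b t s x = 0 := by
  rw [incr, occ_eq_zero_of_notMem_visitors (by linarith [hs.1]) (by linarith [hs.2]) hx,
    occ_eq_zero_of_notMem_visitors hs.1.le (by linarith [hs.2]) hx, sub_zero]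

lemma cross_eq (T t : ℝ) (x : Z) :
    cross A a b T t x =
      A.indicator (fun x => ∫ s in Set.Ioc 0 (T - t), sqIncr (a x) (b x) t s) x := by
  simp only [cross, incr_sq_eq]
  by_cases hx : x ∈ A <;> simp [hx]

lemma cross_nonneg (T t : ℝ) (x : Z) : 0 ≤ cross A a b T t x :=
  integral_nonneg fun _ => sq_nonneg _

lemma cross_le {t : ℝ} (ht : 0 ≤ t) (T : ℝ) (x : Z) : cross A a b T t x ≤ 2 * t := by
  rw [cross_eq]
  by_cases hx : x ∈ A
  · rw [Set.indicator_of_mem hx]; exact integral_sqIncr_le ht _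
  · rw [Set.indicator_of_notMem hx]; positivity

lemma cross_eq_zero_of_notMem_visitors {T t : ℝ} (ht : 0 ≤ t) {x : Z}
    (hx : x ∉ visitors A a b T) : cross A a b T t x = 0 :=
  setIntegral_eq_zero_of_forall_eq_zero fun s hs => by
    rw [incr_eq_zero_of_notMem_visitors ht hs hx]; ring

lemma ends_nonneg (T : ℝ) (x : Z) : 0 ≤ ends A a b T x :=
  Set.indicator_nonneg (fun _ _ => add_nonneg
    (Set.indicator_nonneg (fun _ _ => zero_le_one) _)
    (Set.indicator_nonneg (fun _ _ => zero_le_one) _)) _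

lemma ends_le_two (T : ℝ) (x : Z) : ends A a b T x ≤ 2 := by
  have h : ∀ y : ℝ, (Set.Ioc 0 T).indicator (1 : ℝ → ℝ) y ≤ 1 := fun y =>
    Set.indicator_le_self' (fun _ _ => zero_le_one) y
  by_cases hx : x ∈ A
  · rw [ends, Set.indicator_of_mem hx]; linarith [h (a x), h (b x)]
  · rw [ends, Set.indicator_of_notMem hx]; norm_num

/-- The particles for which `cross` may differ from `t * ends`: those with an entry or exit close to
an end of the observation period, and those with a short transit. -/
def irregular (A : Set Z) (a b : Z → ℝ) (T t : ℝ) : Set Z :=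
  {x | x ∈ A ∧ a x ∈ Set.Icc 0 t ∪ Set.Icc (T - t) T} ∪
  {x | x ∈ A ∧ b x ∈ Set.Icc 0 t ∪ Set.Icc (T - t) T} ∪
  {x | x ∈ A ∧ a x ∈ Set.Icc (-t) T ∧ b x - a x < t}

/-- The deviation of the normalized `cross` from its approximation by `ends`. -/
noncomputable def crossDev (A : Set Z) (a b : Z → ℝ) (T t : ℝ) (x : Z) : ℝ :=
  cross A a b T t x / (2 * (T - t)) - t * ends A a b T x / (2 * T)

lemma cross_eq_of_notMem_irregular (hab : ∀ x, a x ≤ b x) {T t : ℝ} (ht : 0 ≤ t) {x : Z}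
    (hx : x ∉ irregular A a b T t) : cross A a b T t x = t * ends A a b T x := by
  rw [cross_eq, ends]
  by_cases hA : x ∈ A
  · rw [Set.indicator_of_mem hA, Set.indicator_of_mem hA]
    exact integral_sqIncr_eq ht (hab x) (fun h => hx (Or.inl (Or.inl ⟨hA, h⟩)))
      (fun h => hx (Or.inl (Or.inr ⟨hA, h⟩))) (fun h => hx (Or.inr ⟨hA, h⟩))
  · rw [Set.indicator_of_notMem hA, Set.indicator_of_notMem hA, mul_zero]

lemma abs_crossDev_le (hab : ∀ x, a x ≤ b x) {T t : ℝ} (ht : 0 ≤ t) (hT : 0 < T)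
    (htT : t ≤ T / 2) (x : Z) :
    |crossDev A a b T t x| ≤
      t / T ^ 2 * cross A a b T t x + t / T * (irregular A a b T t).indicator 1 x := by
  have h0 := cross_nonneg (A := A) (a := a) (b := b) T t x
  have hTt : T / 2 ≤ T - t := by linarith
  have hTt' : 0 < T - t := by linarith
  have e : crossDev A a b T t x = cross A a b T t x * (t / (2 * T * (T - t))) +
      (cross A a b T t x - t * ends A a b T x) / (2 * T) := by
    rw [crossDev]; field_simp; ring
  have h1 : t / (2 * T * (T - t)) ≤ t / T ^ 2 := by
    apply div_le_div_of_nonneg_left ht (by positivity)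
    nlinarith
  have h2 : |cross A a b T t x * (t / (2 * T * (T - t)))| ≤ t / T ^ 2 * cross A a b T t x := by
    rw [abs_of_nonneg (by positivity), mul_comm]
    exact mul_le_mul_of_nonneg_right h1 h0
  have h3 : |(cross A a b T t x - t * ends A a b T x) / (2 * T)| ≤
      t / T * (irregular A a b T t).indicator 1 x := by
    by_cases hx : x ∈ irregular A a b T t
    · rw [Set.indicator_of_mem hx, abs_div, abs_of_pos (by positivity : 0 < 2 * T),
        div_le_iff₀ (by positivity)]
      have h4 := cross_le (A := A) (a := a) (b := b) ht T x
      have h5 : t * ends A a b T x ≤ t * 2 := mul_le_mul_of_nonneg_left (ends_le_two T x) ht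
      have h6 : 0 ≤ t * ends A a b T x := mul_nonneg ht (ends_nonneg T x)
      have h7 : t / T * (1 : Z → ℝ) x * (2 * T) = 2 * t := by
        rw [Pi.one_apply]; field_simp
      rw [h7, abs_le]
      constructor <;> linarith
    · rw [cross_eq_of_notMem_irregular hab ht hx]
      simp [hx]
  rw [e]
  exact (abs_add_le _ _).trans (add_le_add h2 h3)

lemma abs_crossDev_le_const {T t : ℝ} (hT : 0 < T) (ht : 0 ≤ t) (htT : t ≤ T / 2) (x : Z) :
    |crossDev A a b T t x| ≤ 2 * t / T := by
  have h1 := cross_nonneg (A := A) (a := a) (b := b) T t x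
  have h2 := cross_le (A := A) (a := a) (b := b) ht T x
  have h3 : 0 ≤ t * ends A a b T x := mul_nonneg ht (ends_nonneg T x)
  have h4 : t * ends A a b T x ≤ t * 2 := mul_le_mul_of_nonneg_left (ends_le_two T x) ht
  have hTt : 0 < 2 * (T - t) := by linarith
  have h5 : cross A a b T t x / (2 * (T - t)) ≤ 2 * t / T :=
    div_le_div₀ (by positivity) h2 hT (by linarith)
  have h6 : t * ends A a b T x / (2 * T) ≤ 2 * t / T :=
    div_le_div₀ (by positivity) (by linarith) hT (by linarith)
  have h7 : 0 ≤ cross A a b T t x / (2 * (T - t)) := by positivity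
  have h8 : 0 ≤ t * ends A a b T x / (2 * T) := by positivity
  rw [crossDev, abs_le]
  constructor <;> linarith

variable [MeasurableSpace Z] {Λ : Measure Z} {m c ρ : ℝ}

namespace IsTransitFlow

variable (hF : IsTransitFlow Λ A a b m c ρ)
include hF

lemma measurable_occ_uncurry : Measurable fun p : ℝ × Z => occ A a b p.1 p.2 := by
  have ha := hF.measurable_entry
  have hb := hF.measurable_exit
  have : (fun p : ℝ × Z => occ A a b p.1 p.2) =
      Set.indicator {p : ℝ × Z | p.2 ∈ A ∧ a p.2 ≤ p.1 ∧ p.1 ≤ b p.2} 1 := by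
    ext p
    rw [occ_eq_indicator]
    rfl
  rw [this]
  exact measurable_one.indicator ((measurable_snd hF.measurableSet).inter
    ((measurableSet_le (ha.comp measurable_snd) measurable_fst).inter
      (measurableSet_le measurable_fst (hb.comp measurable_snd))))

lemma measurable_occ {Y : Type*} [MeasurableSpace Y] {f : Y → ℝ} {g : Y → Z} (hf : Measurable f)
    (hg : Measurable g) : Measurable fun y => occ A a b (f y) (g y) :=
  hF.measurable_occ_uncurry.comp (hf.prodMk hg)

lemma measurable_incr {Y : Type*} [MeasurableSpace Y] {e f : Y → ℝ} {g : Y → Z}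
    (he : Measurable e) (hf : Measurable f) (hg : Measurable g) :
    Measurable fun y => incr A a b (e y) (f y) (g y) :=
  (hF.measurable_occ (hf.add he) hg).sub (hF.measurable_occ hf hg)

lemma measurable_ends (T : ℝ) : Measurable (ends A a b T) := by
  have h : Measurable ((Set.Ioc 0 T).indicator (1 : ℝ → ℝ)) :=
    measurable_one.indicator measurableSet_Ioc
  exact ((h.comp hF.measurable_entry).add (h.comp hF.measurable_exit)).indicator hF.measurableSet

lemma measurable_cross_uncurry (T : ℝ) :
    Measurable fun p : ℝ × Z => cross A a b T p.1 p.2 := by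
  have h : (fun p : ℝ × Z => cross A a b T p.1 p.2) = fun p : ℝ × Z => ∫ s,
      {q : (ℝ × Z) × ℝ | 0 < q.2 ∧ q.2 ≤ T - q.1.1}.indicator
        (fun q => incr A a b q.1.1 q.2 q.1.2 ^ 2) (p, s) := by
    ext p
    rw [cross, ← integral_indicator measurableSet_Ioc]
    rfl
  rw [h]
  refine (StronglyMeasurable.integral_prod_right' (f := fun q : (ℝ × Z) × ℝ =>
    {q : (ℝ × Z) × ℝ | 0 < q.2 ∧ q.2 ≤ T - q.1.1}.indicator
        (fun q => incr A a b q.1.1 q.2 q.1.2 ^ 2) q) ?_).measurable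
  refine (Measurable.indicator ?_ ?_).stronglyMeasurable
  · exact (hF.measurable_incr (by fun_prop) (by fun_prop) (by fun_prop)).pow_const 2
  · exact (measurableSet_lt measurable_const measurable_snd).inter
      (measurableSet_le measurable_snd (by fun_prop))

lemma measurable_cross (T t : ℝ) : Measurable (cross A a b T t) :=
  (hF.measurable_cross_uncurry T).comp measurable_prodMk_left

lemma measurableSet_visitors (T : ℝ) : MeasurableSet (visitors A a b T) :=
  hF.measurableSet.inter ((measurableSet_le hF.measurable_entry measurable_const).inter
    (measurableSet_le measurable_const hF.measurable_exit))

lemma visitors_ne_top (T : ℝ) : Λ (visitors A a b T) ≠ ∞ := by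
  have hsub : visitors A a b T ⊆ {x | x ∈ A ∧ a x ∈ Set.Ioc 0 T} ∪
      {x | x ∈ A ∧ a x ≤ 0 ∧ 0 ≤ b x} := by
    rintro x ⟨h1, h2, h3⟩
    rcases lt_or_ge 0 (a x) with h | h
    · exact Or.inl ⟨h1, h, h2⟩
    · exact Or.inr ⟨h1, h, h3⟩
  refine ne_top_of_le_ne_top ?_ ((measure_mono hsub).trans (measure_union_le _ _))
  rw [hF.entry _ measurableSet_Ioc, hF.inside, Real.volume_Ioc]
  exact ENNReal.add_ne_top.2 ⟨ENNReal.mul_ne_top ENNReal.ofReal_ne_top ENNReal.ofReal_ne_top,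
    ENNReal.ofReal_ne_top⟩

lemma isTestFunction_of_visitors {f : Z → ℝ} (hf : Measurable f) {C : ℝ} (hC : ∀ x, |f x| ≤ C)
    (T : ℝ) (hv : ∀ x, x ∉ visitors A a b T → f x = 0) : IsTestFunction Λ f :=
  ⟨hf, ⟨C, hC⟩, ne_top_of_le_ne_top (hF.visitors_ne_top T) (measure_mono fun x hx => by
    by_contra h; exact hx (hv x h))⟩

lemma measurableSet_inside (s : ℝ) : MeasurableSet {x | x ∈ A ∧ a x ≤ s ∧ s ≤ b x} :=
  hF.measurableSet.inter ((measurableSet_le hF.measurable_entry measurable_const).inter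
    (measurableSet_le measurable_const hF.measurable_exit))

lemma isTestFunction_occ (s : ℝ) : IsTestFunction Λ (occ A a b s) := by
  refine ⟨hF.measurable_occ measurable_const measurable_id, ⟨1, fun x => ?_⟩, ?_⟩
  · rcases occ_eq_zero_or_one (A := A) (a := a) (b := b) s x with h | h <;> simp [h]
  · refine ne_top_of_le_ne_top (b := Λ {x | x ∈ A ∧ a x ≤ s ∧ s ≤ b x}) ?_
      (measure_mono fun x hx => ?_)
    · rw [hF.inside]; exact ENNReal.ofReal_ne_top
    · by_contra h
      exact hx (by rw [occ_eq_indicator]; exact Set.indicator_of_notMem h _)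

lemma integral_occ (s : ℝ) : ∫ x, occ A a b s x ∂Λ = ρ := by
  rw [occ_eq_indicator, integral_indicator_one (hF.measurableSet_inside s), Measure.real,
    hF.inside, ENNReal.toReal_ofReal hF.mean_nonneg]

lemma isTestFunction_incr (t s : ℝ) : IsTestFunction Λ (incr A a b t s) :=
  (hF.isTestFunction_occ (s + t)).sub (hF.isTestFunction_occ s)

lemma integral_incr (t s : ℝ) : ∫ x, incr A a b t s x ∂Λ = 0 := by
  have := integral_sub (hF.isTestFunction_occ (s + t)).integrable
    (hF.isTestFunction_occ s).integrable
  rw [hF.integral_occ, hF.integral_occ, sub_self] at this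
  exact this

lemma measurableSet_entry {I : Set ℝ} (hI : MeasurableSet I) :
    MeasurableSet {x | x ∈ A ∧ a x ∈ I} := hF.measurableSet.inter (hF.measurable_entry hI)

lemma measurableSet_exit {I : Set ℝ} (hI : MeasurableSet I) :
    MeasurableSet {x | x ∈ A ∧ b x ∈ I} := hF.measurableSet.inter (hF.measurable_exit hI)

lemma measureReal_entry {I : Set ℝ} (hI : MeasurableSet I) :
    Λ.real {x | x ∈ A ∧ a x ∈ I} = m * volume.real I := by
  rw [Measure.real, hF.entry I hI, ENNReal.toReal_mul, ENNReal.toReal_ofReal hF.rate_nonneg]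
  rfl

lemma measureReal_exit {I : Set ℝ} (hI : MeasurableSet I) :
    Λ.real {x | x ∈ A ∧ b x ∈ I} = m * volume.real I := by
  rw [Measure.real, hF.exit I hI, ENNReal.toReal_mul, ENNReal.toReal_ofReal hF.rate_nonneg]
  rfl

lemma entry_ne_top {I : Set ℝ} (hI : MeasurableSet I) (hI' : volume I ≠ ∞) :
    Λ {x | x ∈ A ∧ a x ∈ I} ≠ ∞ := by
  rw [hF.entry I hI]; exact ENNReal.mul_ne_top ENNReal.ofReal_ne_top hI'

lemma exit_ne_top {I : Set ℝ} (hI : MeasurableSet I) (hI' : volume I ≠ ∞) :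
    Λ {x | x ∈ A ∧ b x ∈ I} ≠ ∞ := by
  rw [hF.exit I hI]; exact ENNReal.mul_ne_top ENNReal.ofReal_ne_top hI'

lemma integral_incr_sq_le {t : ℝ} (ht : 0 ≤ t) (s : ℝ) :
    ∫ x, incr A a b t s x ^ 2 ∂Λ ≤ 2 * m * t := by
  have hint : Integrable (fun x => incr A a b t s x ^ 2) Λ := by
    simp only [sq]
    exact ((hF.isTestFunction_incr t s).mul (hF.isTestFunction_incr t s)).integrable
  have hvol : volume (Set.Icc s (s + t)) ≠ ∞ := by simp
  have i1 : Integrable ({x | x ∈ A ∧ a x ∈ Set.Icc s (s + t)}.indicator (1 : Z → ℝ)) Λ :=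
    (integrable_indicator_iff (hF.measurableSet_entry measurableSet_Icc)).2
      (integrableOn_const (hF.entry_ne_top measurableSet_Icc hvol))
  have i2 : Integrable ({x | x ∈ A ∧ b x ∈ Set.Icc s (s + t)}.indicator (1 : Z → ℝ)) Λ :=
    (integrable_indicator_iff (hF.measurableSet_exit measurableSet_Icc)).2
      (integrableOn_const (hF.exit_ne_top measurableSet_Icc hvol))
  have hle : ∀ x, incr A a b t s x ^ 2 ≤
      ({x | x ∈ A ∧ a x ∈ Set.Icc s (s + t)}.indicator (1 : Z → ℝ) +
        {x | x ∈ A ∧ b x ∈ Set.Icc s (s + t)}.indicator (1 : Z → ℝ)) x := by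
    intro x
    rw [incr_sq_eq]
    by_cases hx : x ∈ A
    · rw [Set.indicator_of_mem hx]
      refine (sqIncr_le ht s).trans (le_of_eq ?_)
      have e : ∀ γ : ℝ, (s ∈ Set.Icc (γ - t) γ) ↔ (γ ∈ Set.Icc s (s + t)) := fun γ => by
        simp only [Set.mem_Icc]; constructor <;> rintro ⟨h1, h2⟩ <;> constructor <;> linarith
      rw [Pi.add_apply, indicator_setOf_and hx, indicator_setOf_and hx]
      simp only [Set.indicator_apply, e]
      rfl
    · rw [Set.indicator_of_notMem hx]
      exact add_nonneg (Set.indicator_nonneg (fun _ _ => zero_le_one) _)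
        (Set.indicator_nonneg (fun _ _ => zero_le_one) _)
  refine (integral_mono hint (i1.add i2) hle).trans (le_of_eq ?_)
  rw [integral_add' i1 i2, integral_indicator_one (hF.measurableSet_entry measurableSet_Icc),
    integral_indicator_one (hF.measurableSet_exit measurableSet_Icc),
    hF.measureReal_entry measurableSet_Icc, hF.measureReal_exit measurableSet_Icc,
    Real.volume_real_Icc_of_le (by linarith)]
  ring

lemma isTestFunction_ends (T : ℝ) : IsTestFunction Λ (ends A a b T) := by
  refine ⟨hF.measurable_ends T, ⟨2, fun x => ?_⟩, ?_⟩
  · rw [abs_of_nonneg (ends_nonneg T x)]; exact ends_le_two T x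
  · refine ne_top_of_le_ne_top (ENNReal.add_ne_top.2
      ⟨hF.entry_ne_top (I := Set.Ioc 0 T) measurableSet_Ioc (by simp),
        hF.exit_ne_top (I := Set.Ioc 0 T) measurableSet_Ioc (by simp)⟩)
      ((measure_mono fun x hx => ?_).trans (measure_union_le _ _))
    by_contra h
    apply hx
    by_cases hA : x ∈ A
    · simp only [Set.mem_union, Set.mem_ofPred_eq, hA, true_and, not_or] at h
      rw [ends, Set.indicator_of_mem hA, Set.indicator_of_notMem h.1, Set.indicator_of_notMem h.2,
        add_zero]
    · rw [ends, Set.indicator_of_notMem hA]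

lemma integral_ends {T : ℝ} (hT : 0 ≤ T) : ∫ x, ends A a b T x ∂Λ = 2 * T * m := by
  have e : ends A a b T = {x | x ∈ A ∧ a x ∈ Set.Ioc 0 T}.indicator (1 : Z → ℝ) +
      {x | x ∈ A ∧ b x ∈ Set.Ioc 0 T}.indicator (1 : Z → ℝ) := by
    ext x
    by_cases hx : x ∈ A
    · rw [Pi.add_apply, indicator_setOf_and hx, indicator_setOf_and hx, ends,
        Set.indicator_of_mem hx]
    · rw [Pi.add_apply, ends, Set.indicator_of_notMem hx, Set.indicator_of_notMem (fun h => hx h.1),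
        Set.indicator_of_notMem (fun h => hx h.1), add_zero]
  have i1 : Integrable ({x | x ∈ A ∧ a x ∈ Set.Ioc 0 T}.indicator (1 : Z → ℝ)) Λ :=
    (integrable_indicator_iff (hF.measurableSet_entry measurableSet_Ioc)).2
      (integrableOn_const (hF.entry_ne_top measurableSet_Ioc (by simp)))
  have i2 : Integrable ({x | x ∈ A ∧ b x ∈ Set.Ioc 0 T}.indicator (1 : Z → ℝ)) Λ :=
    (integrable_indicator_iff (hF.measurableSet_exit measurableSet_Ioc)).2
      (integrableOn_const (hF.exit_ne_top measurableSet_Ioc (by simp)))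
  rw [e, integral_add' i1 i2, integral_indicator_one (hF.measurableSet_entry measurableSet_Ioc),
    integral_indicator_one (hF.measurableSet_exit measurableSet_Ioc),
    hF.measureReal_entry measurableSet_Ioc, hF.measureReal_exit measurableSet_Ioc,
    Real.volume_real_Ioc_of_le (by linarith)]
  ring

lemma integral_ends_sq_le {T : ℝ} (hT : 0 ≤ T) : ∫ x, ends A a b T x ^ 2 ∂Λ ≤ 4 * T * m := by
  have h := hF.isTestFunction_ends T
  have h2 : Integrable (fun x => ends A a b T x ^ 2) Λ := by
    simp only [sq]; exact (h.mul h).integrable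
  have := integral_mono h2 (h.integrable.const_mul 2) fun x => by
    nlinarith [ends_nonneg (A := A) (a := a) (b := b) T x,
      ends_le_two (A := A) (a := a) (b := b) T x]
  rw [integral_const_mul, hF.integral_ends hT] at this
  linarith

lemma isTestFunction_cross (T : ℝ) {t : ℝ} (ht : 0 ≤ t) : IsTestFunction Λ (cross A a b T t) :=
  hF.isTestFunction_of_visitors (hF.measurable_cross T t) (C := 2 * t)
    (fun x => by rw [abs_of_nonneg (cross_nonneg T t x)]; exact cross_le ht T x) T
    fun _ hx => cross_eq_zero_of_notMem_visitors ht hx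

/-- A function that is bounded by one and vanishes off the visitors is integrable on
the product with a finite measure. -/
lemma integrable_prod_of_visitors {Y : Type*} [MeasurableSpace Y] {ν : Measure Y}
    [IsFiniteMeasure ν] [SFinite Λ] (T : ℝ) {G : Y × Z → ℝ} (hG : Measurable G)
    (hG1 : ∀ p, |G p| ≤ 1) (hG0 : ∀ᵐ y ∂ν, ∀ x, x ∉ visitors A a b T → G (y, x) = 0) :
    Integrable G (ν.prod Λ) := by
  have h1 : Integrable ((visitors A a b T).indicator (1 : Z → ℝ)) Λ :=
    (integrable_indicator_iff (hF.measurableSet_visitors T)).2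
      (integrableOn_const (hF.visitors_ne_top T))
  refine (h1.comp_snd ν).mono' hG.aestronglyMeasurable ?_
  have h2 : ∀ᵐ p ∂(ν.prod Λ), ∀ x, x ∉ visitors A a b T → G (p.1, x) = 0 :=
    Measure.quasiMeasurePreserving_fst.ae hG0
  filter_upwards [h2] with p hp
  by_cases hx : p.2 ∈ visitors A a b T
  · simpa [hx] using hG1 p
  · simp [hx, hp p.2 hx]

lemma integral_cross_le [SFinite Λ] {T t : ℝ} (ht : 0 ≤ t) (htT : t ≤ T) :
    ∫ x, cross A a b T t x ∂Λ ≤ 2 * m * t * T := by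
  have hint : Integrable (fun p : ℝ × Z => incr A a b t p.1 p.2 ^ 2)
      ((volume.restrict (Set.Ioc 0 (T - t))).prod Λ) := by
    refine hF.integrable_prod_of_visitors T
      ((hF.measurable_incr measurable_const measurable_fst measurable_snd).pow_const 2)
      (fun p => ?_) ?_
    · rw [abs_of_nonneg (sq_nonneg _)]; exact incr_sq_le_one _ _ _
    · filter_upwards [ae_restrict_mem measurableSet_Ioc] with s hs x hx
      simp [incr_eq_zero_of_notMem_visitors ht hs hx]
  simp only [cross]
  rw [← integral_integral_swap (f := fun s x => incr A a b t s x ^ 2) hint]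
  have h1 : ∫ s in Set.Ioc 0 (T - t), ∫ x, incr A a b t s x ^ 2 ∂Λ ≤
      ∫ s in Set.Ioc 0 (T - t), 2 * m * t :=
    integral_mono hint.integral_prod_left (integrable_const _)
      fun s => hF.integral_incr_sq_le ht s
  refine h1.trans ?_
  rw [setIntegral_const, Real.volume_real_Ioc_of_le (by linarith), smul_eq_mul]
  have := mul_nonneg (mul_nonneg (mul_nonneg zero_le_two hF.rate_nonneg) ht) ht
  nlinarith

lemma abs_integral_incr_mul_le {t : ℝ} (ht : 0 ≤ t) (s s' : ℝ) :
    |∫ x, incr A a b t s x * incr A a b t s' x ∂Λ| ≤ 2 * m * t ∧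
    |∫ x, incr A a b t s x * incr A a b t s' x ∂Λ| ≤
      ∫ x, incr A a b t s x ^ 2 * incr A a b t s' x ^ 2 ∂Λ := by
  have h1 : |∫ x, incr A a b t s x * incr A a b t s' x ∂Λ| ≤
      ∫ x, incr A a b t s x ^ 2 * incr A a b t s' x ^ 2 ∂Λ := by
    refine abs_integral_le_integral_abs.trans (le_of_eq ?_)
    simp only [abs_mul, abs_incr]
  have hi := hF.isTestFunction_incr t s
  have hi' := hF.isTestFunction_incr t s'
  refine ⟨h1.trans ((integral_mono ?_ ?_ fun x => ?_).trans (hF.integral_incr_sq_le ht s)), h1⟩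
  · simp only [sq]; exact ((hi.mul hi).mul (hi'.mul hi')).integrable
  · simp only [sq]; exact (hi.mul hi).integrable
  · exact mul_le_of_le_one_right (sq_nonneg _) (incr_sq_le_one _ _ _)

/-- The covariances of the increments are small in mean square: they are bounded by `2 m t`, and
the integral of their absolute values is at most that of `cross ^ 2`. -/
lemma integral_sq_integral_incr_mul_le [SFinite Λ] {T t : ℝ} (ht : 0 ≤ t) (htT : t ≤ T) :
    ∫ p : ℝ × ℝ, 2 * (∫ x, incr A a b t p.1 x * incr A a b t p.2 x ∂Λ) ^ 2
      ∂((volume.restrict (Set.Ioc 0 (T - t))).prod (volume.restrict (Set.Ioc 0 (T - t)))) ≤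
      16 * m ^ 2 * t ^ 3 * T := by
  set ν := (volume.restrict (Set.Ioc 0 (T - t))).prod (volume.restrict (Set.Ioc 0 (T - t)))
  have hm := hF.rate_nonneg
  have hint : Integrable (fun q : (ℝ × ℝ) × Z =>
      incr A a b t q.1.1 q.2 ^ 2 * incr A a b t q.1.2 q.2 ^ 2) (ν.prod Λ) := by
    refine hF.integrable_prod_of_visitors T
      (((hF.measurable_incr measurable_const (by fun_prop) (by fun_prop)).pow_const 2).mul
        ((hF.measurable_incr measurable_const (by fun_prop) (by fun_prop)).pow_const 2))
      (fun q => ?_) ?_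
    · rw [abs_of_nonneg (by positivity)]
      exact mul_le_one₀ (incr_sq_le_one _ _ _) (sq_nonneg _) (incr_sq_le_one _ _ _)
    · have h1 : ∀ᵐ p ∂ν, p.1 ∈ Set.Ioc 0 (T - t) :=
        Measure.quasiMeasurePreserving_fst.ae (ae_restrict_mem measurableSet_Ioc)
      filter_upwards [h1] with p hp x hx
      simp [incr_eq_zero_of_notMem_visitors ht hp hx]
  have hle : ∀ p : ℝ × ℝ, 2 * (∫ x, incr A a b t p.1 x * incr A a b t p.2 x ∂Λ) ^ 2 ≤
      4 * m * t * ∫ x, incr A a b t p.1 x ^ 2 * incr A a b t p.2 x ^ 2 ∂Λ := by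
    intro p
    obtain ⟨h1, h2⟩ := hF.abs_integral_incr_mul_le ht p.1 p.2
    have h3 := abs_nonneg (∫ x, incr A a b t p.1 x * incr A a b t p.2 x ∂Λ)
    rw [← sq_abs, sq]
    have h4 := mul_le_mul h1 h2 h3 (by positivity)
    linarith
  have hg := hint.integral_prod_left
  refine (integral_mono_of_nonneg (ae_of_all _ fun p => by positivity) (hg.const_mul (4 * m * t))
    (ae_of_all _ hle)).trans ?_
  rw [integral_const_mul, integral_integral_swap hint]
  have hinner : ∀ x, ∫ p, incr A a b t p.1 x ^ 2 * incr A a b t p.2 x ^ 2 ∂ν =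
      cross A a b T t x ^ 2 := by
    intro x
    rw [sq (cross A a b T t x)]
    exact integral_prod_mul (fun s => incr A a b t s x ^ 2) fun s => incr A a b t s x ^ 2
  simp only [hinner]
  have hc := hF.isTestFunction_cross T ht
  have h5 : ∫ x, cross A a b T t x ^ 2 ∂Λ ≤ 2 * t * ∫ x, cross A a b T t x ∂Λ := by
    rw [← integral_const_mul]
    refine integral_mono ?_ (hc.integrable.const_mul _) fun x => ?_
    · simp only [sq]; exact (hc.mul hc).integrable
    · simp only [sq]
      exact mul_le_mul_of_nonneg_right (cross_le ht T x) (cross_nonneg T t x)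
  have h6 := hF.integral_cross_le ht htT
  calc 4 * m * t * ∫ x, cross A a b T t x ^ 2 ∂Λ
      ≤ 4 * m * t * (2 * t * (2 * m * t * T)) := by gcongr; exact h5.trans (by gcongr)
    _ = 16 * m ^ 2 * t ^ 3 * T := by ring

lemma measurableSet_irregular (T t : ℝ) : MeasurableSet (irregular A a b T t) := by
  refine ((hF.measurableSet_entry (measurableSet_Icc.union measurableSet_Icc)).union
    (hF.measurableSet_exit (measurableSet_Icc.union measurableSet_Icc))).union ?_
  exact hF.measurableSet.inter ((hF.measurable_entry measurableSet_Icc).inter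
    (measurableSet_lt (hF.measurable_exit.sub hF.measurable_entry) measurable_const))

lemma measure_irregular_le {T t : ℝ} (ht : 0 ≤ t) (htT : t ≤ T) :
    Λ (irregular A a b T t) ≤ ENNReal.ofReal (4 * m * t + 2 * c * t * T) := by
  have hm := hF.rate_nonneg
  have hc := hF.short_nonneg
  have hvol : volume (Set.Icc 0 t ∪ Set.Icc (T - t) T) ≤ ENNReal.ofReal (2 * t) := by
    refine (measure_union_le _ _).trans (le_of_eq ?_)
    rw [Real.volume_Icc, Real.volume_Icc, ← ENNReal.ofReal_add (by linarith) (by linarith)]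
    congr 1; ring
  have hmeas := (measurableSet_Icc (a := (0 : ℝ)) (b := t)).union
    (measurableSet_Icc (a := T - t) (b := T))
  refine (measure_union_le _ _).trans ((add_le_add_left (measure_union_le _ _) _).trans ?_)
  rw [hF.entry _ hmeas, hF.exit _ hmeas]
  have h3 := hF.short (Set.Icc (-t) T) t measurableSet_Icc ht
  rw [Real.volume_Icc, ← ENNReal.ofReal_mul (by positivity)] at h3
  have h4 : ENNReal.ofReal m * volume (Set.Icc 0 t ∪ Set.Icc (T - t) T) ≤
      ENNReal.ofReal (m * (2 * t)) := by
    rw [ENNReal.ofReal_mul hm]; gcongr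
  refine (add_le_add (add_le_add h4 h4) h3).trans ?_
  have hT : 0 ≤ T := ht.trans htT
  rw [← ENNReal.ofReal_add (by positivity) (by positivity),
    ← ENNReal.ofReal_add (by positivity) (mul_nonneg (by positivity) (by linarith))]
  apply ENNReal.ofReal_le_ofReal
  have : 0 ≤ c * t * (T - t) := mul_nonneg (by positivity) (by linarith)
  nlinarith

lemma integrable_indicator_irregular {T t : ℝ} (ht : 0 ≤ t) (htT : t ≤ T) :
    Integrable ((irregular A a b T t).indicator (1 : Z → ℝ)) Λ :=
  (integrable_indicator_iff (hF.measurableSet_irregular T t)).2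
    (integrableOn_const (ne_top_of_le_ne_top ENNReal.ofReal_ne_top
      (hF.measure_irregular_le ht htT)))

lemma isTestFunction_crossDev {T t : ℝ} (hT : 0 < T) (ht : 0 ≤ t) (htT : t ≤ T / 2) :
    IsTestFunction Λ (crossDev A a b T t) := by
  refine ⟨((hF.measurable_cross T t).div_const _).sub
    (((hF.measurable_ends T).const_mul t).div_const _), ⟨_, abs_crossDev_le_const hT ht htT⟩,
    ne_top_of_le_ne_top (ENNReal.add_ne_top.2 ⟨(hF.isTestFunction_cross T ht).support_ne_top,
      (hF.isTestFunction_ends T).support_ne_top⟩)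
      ((measure_mono fun x hx => ?_).trans (measure_union_le _ _))⟩
  by_contra h
  have h1 : cross A a b T t x = 0 := by_contra fun h' => h (Or.inl h')
  have h2 : ends A a b T x = 0 := by_contra fun h' => h (Or.inr h')
  exact hx (by rw [crossDev, h1, h2]; simp)

lemma integral_abs_crossDev_le [SFinite Λ] {T t : ℝ} (hT : 1 ≤ T) (ht : 0 ≤ t) (htT : t ≤ T / 2) :
    ∫ x, |crossDev A a b T t x| ∂Λ ≤ (6 * m + 2 * c) * t ^ 2 := by
  have hT0 : 0 < T := by linarith
  have htT' : t ≤ T := by linarith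
  have hm := hF.rate_nonneg
  have hc := hF.short_nonneg
  have i1 := (hF.isTestFunction_cross T ht).integrable.const_mul (t / T ^ 2)
  have i2 := (hF.integrable_indicator_irregular ht htT').const_mul (t / T)
  refine (integral_mono (hF.isTestFunction_crossDev hT0 ht htT).integrable.abs (i1.add i2)
    fun x => abs_crossDev_le hF.le ht hT0 htT x).trans ?_
  rw [integral_add' i1 i2, integral_const_mul, integral_const_mul,
    integral_indicator_one (hF.measurableSet_irregular T t)]
  have h1 : Λ.real (irregular A a b T t) ≤ 4 * m * t + 2 * c * t * T :=
    ENNReal.toReal_le_of_le_ofReal (by positivity) (hF.measure_irregular_le ht htT')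
  calc t / T ^ 2 * ∫ x, cross A a b T t x ∂Λ + t / T * Λ.real (irregular A a b T t)
      ≤ t / T ^ 2 * (2 * m * t * T) + t / T * (4 * m * t + 2 * c * t * T) := by
        gcongr; exact hF.integral_cross_le ht htT'
    _ = 6 * m * t ^ 2 / T + 2 * c * t ^ 2 := by field_simp; ring
    _ ≤ 6 * m * t ^ 2 + 2 * c * t ^ 2 := by gcongr; exact div_le_self (by positivity) hT
    _ = (6 * m + 2 * c) * t ^ 2 := by ring

lemma integral_crossDev_sq_le [SFinite Λ] {T t : ℝ} (hT : 1 ≤ T) (ht : 0 ≤ t) (htT : t ≤ T / 2) :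
    ∫ x, crossDev A a b T t x ^ 2 ∂Λ ≤ 2 * t / T * ((6 * m + 2 * c) * t ^ 2) := by
  have hT0 : 0 < T := by linarith
  have h := hF.isTestFunction_crossDev hT0 ht htT
  have h2 : Integrable (fun x => crossDev A a b T t x ^ 2) Λ := by
    simp only [sq]; exact (h.mul h).integrable
  refine (integral_mono h2 (h.integrable.abs.const_mul (2 * t / T)) fun x => ?_).trans ?_
  · simp only [← sq_abs (crossDev A a b T t x), sq]
    exact mul_le_mul_of_nonneg_right (abs_crossDev_le_const hT0 ht htT x) (abs_nonneg _)
  · rw [integral_const_mul]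
    exact mul_le_mul_of_nonneg_left (hF.integral_abs_crossDev_le hT ht htT) (by positivity)

end IsTransitFlow

end Flow

/-! ### Mean square bounds -/

section MeanSquare

variable {Y Ω : Type*} [MeasurableSpace Y] [MeasurableSpace Ω]

lemma sq_lintegral_le {ν : Measure Y} {f : Y → ℝ≥0∞} (hf : AEMeasurable f ν) :
    (∫⁻ y, f y ∂ν) ^ 2 ≤ ν Set.univ * ∫⁻ y, f y ^ 2 ∂ν := by
  have h := ENNReal.lintegral_mul_le_Lp_mul_Lq ν Real.HolderConjugate.two_two hf
    (aemeasurable_const (b := (1 : ℝ≥0∞)))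
  simp only [Pi.mul_apply, mul_one, ENNReal.one_rpow, lintegral_one] at h
  have h2 := pow_le_pow_left' h 2
  rw [mul_pow, ← ENNReal.rpow_mul_natCast, ← ENNReal.rpow_mul_natCast] at h2
  norm_num at h2
  rwa [mul_comm]

/-- The mean square of an integral of random variables whose mean squares are bounded. -/
lemma lintegral_sq_lintegral_le {ν : Measure Y} {P : Measure Ω} [SFinite ν] [SFinite P]
    {B : Y → Ω → ℝ≥0∞} (hB : Measurable (Function.uncurry B)) {η : ℝ≥0∞}
    (hη : ∀ᵐ y ∂ν, ∫⁻ ω, B y ω ^ 2 ∂P ≤ η) :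
    ∫⁻ ω, (∫⁻ y, B y ω ∂ν) ^ 2 ∂P ≤ ν Set.univ ^ 2 * η := by
  have hBm : ∀ ω, Measurable fun y => B y ω := fun ω => hB.comp measurable_prodMk_right
  calc ∫⁻ ω, (∫⁻ y, B y ω ∂ν) ^ 2 ∂P
      ≤ ∫⁻ ω, ν Set.univ * ∫⁻ y, B y ω ^ 2 ∂ν ∂P :=
        lintegral_mono fun ω => sq_lintegral_le (hBm ω).aemeasurable
    _ = ν Set.univ * ∫⁻ ω, ∫⁻ y, B y ω ^ 2 ∂ν ∂P :=
        lintegral_const_mul _ (Measurable.lintegral_prod_right'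
          (f := fun p : Ω × Y => B p.2 p.1 ^ 2) ((hB.comp measurable_swap).pow_const 2))
    _ = ν Set.univ * ∫⁻ y, ∫⁻ ω, B y ω ^ 2 ∂P ∂ν := by
        rw [lintegral_lintegral_swap]
        exact ((hB.comp measurable_swap).pow_const 2).aemeasurable
    _ ≤ ν Set.univ * ∫⁻ _, η ∂ν := by gcongr 1; exact lintegral_mono_ae hη
    _ = ν Set.univ ^ 2 * η := by rw [lintegral_const]; ring

lemma enorm_sq_eq_ofReal (x : ℝ) : ‖x‖ₑ ^ 2 = ENNReal.ofReal (x ^ 2) := by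
  rw [Real.enorm_eq_ofReal_abs, ← ENNReal.ofReal_pow (abs_nonneg x), sq_abs]

lemma lintegral_enorm_sq_eq {P : Measure Ω} {X : Ω → ℝ} (hX : Integrable (fun ω => X ω ^ 2) P) :
    ∫⁻ ω, ‖X ω‖ₑ ^ 2 ∂P = ENNReal.ofReal (∫ ω, X ω ^ 2 ∂P) := by
  simp only [enorm_sq_eq_ofReal]
  rw [ofReal_integral_eq_lintegral_ofReal hX (ae_of_all _ fun _ => sq_nonneg _)]

lemma add_sq_le_two_mul (x y : ℝ≥0∞) : (x + y) ^ 2 ≤ 2 * x ^ 2 + 2 * y ^ 2 := by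
  have h := ENNReal.rpow_add_le_mul_rpow_add_rpow x y (p := 2) one_le_two
  norm_num [← mul_add] at h ⊢
  exact h

end MeanSquare

section Flow

variable {Z Ω : Type*} [MeasurableSpace Z] [MeasurableSpace Ω] {A : Set Z} {a b : Z → ℝ}
  {Λ : Measure Z} {m c ρ : ℝ} {P : Measure Ω} {z : ℤ → Ω → Z}

/-- The deviation from `ρ` of the number of particles inside at time `s`. -/
noncomputable def dev (A : Set Z) (a b : Z → ℝ) (z : ℤ → Ω → Z) (ρ s : ℝ) (ω : Ω) : ℝ :=
  linearStat z (occ A a b s) ω - ρ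

/-- The contribution of pairs of distinct particles to the squared increment over `[s, s + t]` of
the number of particles inside. -/
noncomputable def offDiag (A : Set Z) (a b : Z → ℝ) (z : ℤ → Ω → Z) (t s : ℝ) (ω : Ω) : ℝ :=
  linearStat z (incr A a b t s) ω ^ 2 - linearStat z (fun x => incr A a b t s x ^ 2) ω

/-- The integral of the squared deviation over a set of times, with values in `ℝ≥0∞` so that no
integrability is needed. -/
noncomputable def energy (A : Set Z) (a b : Z → ℝ) (z : ℤ → Ω → Z) (ρ : ℝ) (I : Set ℝ) (ω : Ω) :
    ℝ≥0∞ := ∫⁻ s in I, ‖dev A a b z ρ s ω ^ 2‖ₑ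

/-- A bound for the error, divided by `t`, of the approximation of the covariance estimator at lag
`t` by an affine function of `t`. -/
noncomputable def errBound (A : Set Z) (a b : Z → ℝ) (z : ℤ → Ω → Z) (ρ T t : ℝ) (ω : Ω) : ℝ≥0∞ :=
  (ENNReal.ofReal (2 / T ^ 2) * energy A a b z ρ (Set.Ioc 0 T) ω +
    (ENNReal.ofReal (1 / (t * T)) * energy A a b z ρ (Set.Ioc 0 t) ω +
      ENNReal.ofReal (1 / (t * T)) * energy A a b z ρ (Set.Ioc (T - t) T) ω)) +
  (ENNReal.ofReal (1 / t) * ‖linearStat z (crossDev A a b T t) ω‖ₑ +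
    ENNReal.ofReal (1 / (t * T)) * ‖∫ s in Set.Ioc 0 (T - t), offDiag A a b z t s ω‖ₑ)

section Measurability

variable (hF : IsTransitFlow Λ A a b m c ρ) (h : HasPoissonMoments P Λ z)
include hF h

lemma measurable_dev {W : Type*} [MeasurableSpace W] {f : W → ℝ} {g : W → Ω} (hf : Measurable f)
    (hg : Measurable g) : Measurable fun w => dev A a b z ρ (f w) (g w) :=
  (Measurable.tsum fun j => hF.measurable_occ hf ((h.measurable j).comp hg)).sub_const ρ

lemma measurable_offDiag {W : Type*} [MeasurableSpace W] {e f : W → ℝ} {g : W → Ω}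
    (he : Measurable e) (hf : Measurable f) (hg : Measurable g) :
    Measurable fun w => offDiag A a b z (e w) (f w) (g w) :=
  ((Measurable.tsum fun j => hF.measurable_incr he hf ((h.measurable j).comp hg)).pow_const 2).sub
    (Measurable.tsum fun j => (hF.measurable_incr he hf ((h.measurable j).comp hg)).pow_const 2)

lemma measurable_energy {W : Type*} [MeasurableSpace W] {e f : W → ℝ} {g : W → Ω}
    (he : Measurable e) (hf : Measurable f) (hg : Measurable g) :
    Measurable fun w => energy A a b z ρ (Set.Ioc (e w) (f w)) (g w) := by
  have e1 : (fun w => energy A a b z ρ (Set.Ioc (e w) (f w)) (g w)) = fun w => ∫⁻ s,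
      {q : W × ℝ | e q.1 < q.2 ∧ q.2 ≤ f q.1}.indicator
        (fun q => ‖dev A a b z ρ q.2 (g q.1) ^ 2‖ₑ) (w, s) := by
    ext w
    rw [energy, ← lintegral_indicator measurableSet_Ioc]
    rfl
  rw [e1]
  refine Measurable.lintegral_prod_right' (f := fun q : W × ℝ =>
    {q : W × ℝ | e q.1 < q.2 ∧ q.2 ≤ f q.1}.indicator
        (fun q => ‖dev A a b z ρ q.2 (g q.1) ^ 2‖ₑ) q) (Measurable.indicator ?_ ?_)
  · exact ((measurable_dev hF h measurable_snd (hg.comp measurable_fst)).pow_const 2).enorm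
  · exact (measurableSet_lt (he.comp measurable_fst) measurable_snd).inter
      (measurableSet_le measurable_snd (hf.comp measurable_fst))

lemma measurable_integral_offDiag (T : ℝ) :
    Measurable fun p : ℝ × Ω => ∫ s in Set.Ioc 0 (T - p.1), offDiag A a b z p.1 s p.2 := by
  have e1 : (fun p : ℝ × Ω => ∫ s in Set.Ioc 0 (T - p.1), offDiag A a b z p.1 s p.2) =
      fun p : ℝ × Ω => ∫ s, {q : (ℝ × Ω) × ℝ | 0 < q.2 ∧ q.2 ≤ T - q.1.1}.indicator
        (fun q => offDiag A a b z q.1.1 q.2 q.1.2) (p, s) := by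
    ext p
    rw [← integral_indicator measurableSet_Ioc]
    rfl
  rw [e1]
  refine (StronglyMeasurable.integral_prod_right' (f := fun q : (ℝ × Ω) × ℝ =>
    {q : (ℝ × Ω) × ℝ | 0 < q.2 ∧ q.2 ≤ T - q.1.1}.indicator
        (fun q => offDiag A a b z q.1.1 q.2 q.1.2) q) ?_).measurable
  refine (Measurable.indicator ?_ ?_).stronglyMeasurable
  · exact measurable_offDiag hF h (by fun_prop) (by fun_prop) (by fun_prop)
  · exact (measurableSet_lt measurable_const measurable_snd).inter
      (measurableSet_le measurable_snd (by fun_prop))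

lemma measurable_linearStat_crossDev (T : ℝ) :
    Measurable fun p : ℝ × Ω => linearStat z (crossDev A a b T p.1) p.2 := by
  refine Measurable.tsum fun j => ?_
  have hj : Measurable fun p : ℝ × Ω => (p.1, z j p.2) :=
    measurable_fst.prodMk ((h.measurable j).comp measurable_snd)
  exact (((hF.measurable_cross_uncurry T).comp hj).div (by fun_prop)).sub
    ((measurable_fst.mul ((hF.measurable_ends T).comp hj.snd)).div_const _)

lemma measurable_errBound (T : ℝ) :
    Measurable fun p : ℝ × Ω => errBound A a b z ρ T p.1 p.2 := by
  have h1 : Measurable fun p : ℝ × Ω => ENNReal.ofReal (1 / (p.1 * T)) := by fun_prop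
  have h2 : Measurable fun p : ℝ × Ω => ENNReal.ofReal (1 / p.1) := by fun_prop
  exact ((measurable_const.mul (measurable_energy hF h measurable_const measurable_const
      measurable_snd)).add
    ((h1.mul (measurable_energy hF h measurable_const measurable_fst measurable_snd)).add
      (h1.mul (measurable_energy hF h (by fun_prop) measurable_const measurable_snd)))).add
    ((h2.mul (measurable_linearStat_crossDev hF h T).enorm).add
      (h1.mul (measurable_integral_offDiag hF h T).enorm))

end Measurability

variable [SigmaFinite Λ]
  (hF : IsTransitFlow Λ A a b m c ρ) (h : HasPoissonMoments P Λ z)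
include hF h

lemma lintegral_energy_sq_le [IsProbabilityMeasure P] (I : Set ℝ) :
    ∫⁻ ω, energy A a b z ρ I ω ^ 2 ∂P ≤ volume I ^ 2 * ENNReal.ofReal (ρ + 3 * ρ ^ 2) := by
  have hB : Measurable (Function.uncurry fun (s : ℝ) (ω : Ω) => ‖dev A a b z ρ s ω ^ 2‖ₑ) :=
    ((measurable_dev hF h measurable_fst measurable_snd).pow_const 2).enorm
  have := lintegral_sq_lintegral_le (ν := volume.restrict I) (P := P) hB
    (η := ENNReal.ofReal (ρ + 3 * ρ ^ 2)) (ae_of_all _ fun s => by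
      obtain ⟨h1, h2⟩ := h.integral_count_sub_pow_four (hF.isTestFunction_occ s) (occ_mul_self s)
        (hF.integral_occ s)
      have e : ∀ ω, (linearStat z (occ A a b s) ω - ρ) ^ 4 = (dev A a b z ρ s ω ^ 2) ^ 2 :=
        fun ω => by rw [dev]; ring
      simp only [e] at h1 h2
      rw [lintegral_enorm_sq_eq h1, h2])
  rwa [Measure.restrict_apply_univ] at this

lemma integral_offDiag_mul {t : ℝ} (s s' : ℝ) :
    Integrable (fun ω => offDiag A a b z t s ω * offDiag A a b z t s' ω) P ∧
      ∫ ω, offDiag A a b z t s ω * offDiag A a b z t s' ω ∂P =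
        2 * (∫ x, incr A a b t s x * incr A a b t s' x ∂Λ) ^ 2 :=
  h.integral_offDiagonal_mul (hF.isTestFunction_incr t s) (hF.isTestFunction_incr t s')
    (hF.integral_incr t s) (hF.integral_incr t s')

lemma integral_abs_offDiag_mul_le {t : ℝ} (ht : 0 ≤ t) (s s' : ℝ) :
    ∫ ω, |offDiag A a b z t s ω * offDiag A a b z t s' ω| ∂P ≤ 2 * (2 * m * t) ^ 2 := by
  obtain ⟨i, -⟩ := integral_offDiag_mul hF h (t := t) s s'
  have hb : ∀ u, Integrable (fun ω => offDiag A a b z t u ω * offDiag A a b z t u ω) P ∧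
      ∫ ω, offDiag A a b z t u ω * offDiag A a b z t u ω ∂P ≤ 2 * (2 * m * t) ^ 2 := fun u => by
    obtain ⟨i, e⟩ := integral_offDiag_mul hF h (t := t) u u
    refine ⟨i, e.le.trans ?_⟩
    have := (hF.abs_integral_incr_mul_le ht u u).1
    have h3 := pow_le_pow_left₀ (abs_nonneg _) this 2
    rw [sq_abs] at h3
    linarith
  obtain ⟨i1, e1⟩ := hb s
  obtain ⟨i2, e2⟩ := hb s'
  have := integral_mono i.abs ((i1.add i2).const_mul (1 / 2)) fun ω => by
    rw [Pi.add_apply, abs_mul]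
    nlinarith [sq_nonneg (|offDiag A a b z t s ω| - |offDiag A a b z t s' ω|),
      sq_abs (offDiag A a b z t s ω), sq_abs (offDiag A a b z t s' ω)]
  rw [integral_const_mul, integral_add' i1 i2] at this
  linarith

/-- By orthogonality, the off-diagonal part of the integrated squared increments is negligible. -/
lemma lintegral_integral_offDiag_sq_le [IsProbabilityMeasure P] {T t : ℝ} (ht : 0 ≤ t)
    (htT : t ≤ T) :
    ∫⁻ ω, ‖∫ s in Set.Ioc 0 (T - t), offDiag A a b z t s ω‖ₑ ^ 2 ∂P ≤
      ENNReal.ofReal (16 * m ^ 2 * t ^ 3 * T) := by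
  set ν := volume.restrict (Set.Ioc 0 (T - t))
  have hmeas : Measurable fun q : Ω × (ℝ × ℝ) =>
      offDiag A a b z t q.2.1 q.1 * offDiag A a b z t q.2.2 q.1 :=
    (measurable_offDiag hF h measurable_const (by fun_prop) (by fun_prop)).mul
      (measurable_offDiag hF h measurable_const (by fun_prop) (by fun_prop))
  have hint : Integrable (fun q : Ω × (ℝ × ℝ) =>
      offDiag A a b z t q.2.1 q.1 * offDiag A a b z t q.2.2 q.1) (P.prod (ν.prod ν)) := by
    rw [integrable_prod_iff' hmeas.aestronglyMeasurable]
    refine ⟨ae_of_all _ fun p => (integral_offDiag_mul hF h p.1 p.2).1, ?_⟩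
    refine (integrable_const (2 * (2 * m * t) ^ 2)).mono'
      (hmeas.norm.stronglyMeasurable.integral_prod_left').aestronglyMeasurable
      (ae_of_all _ fun p => ?_)
    rw [Real.norm_of_nonneg (integral_nonneg fun _ => norm_nonneg _)]
    exact integral_abs_offDiag_mul_le hF h ht p.1 p.2
  have e1 : ∀ ω, ∫ p, offDiag A a b z t p.1 ω * offDiag A a b z t p.2 ω ∂(ν.prod ν) =
      (∫ s, offDiag A a b z t s ω ∂ν) ^ 2 := fun ω => by
    rw [sq]
    exact integral_prod_mul (fun s => offDiag A a b z t s ω) fun s => offDiag A a b z t s ω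
  have hi : Integrable (fun ω => (∫ s, offDiag A a b z t s ω ∂ν) ^ 2) P :=
    hint.integral_prod_left.congr (ae_of_all _ e1)
  rw [lintegral_enorm_sq_eq hi]
  apply ENNReal.ofReal_le_ofReal
  simp only [← e1]
  rw [integral_integral_swap hint]
  simp only [(integral_offDiag_mul hF h _ _).2]
  exact hF.integral_sq_integral_incr_mul_le ht htT

lemma lintegral_linearStat_crossDev_sq_le {T t : ℝ} (hT : 1 ≤ T) (ht : 0 ≤ t) (htT : t ≤ T / 2) :
    ∫⁻ ω, ‖linearStat z (crossDev A a b T t) ω‖ₑ ^ 2 ∂P ≤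
      ENNReal.ofReal (2 * t / T * ((6 * m + 2 * c) * t ^ 2) + ((6 * m + 2 * c) * t ^ 2) ^ 2) := by
  have hT0 : 0 < T := by linarith
  obtain ⟨i, e⟩ := h.integral_linearStat_sq (hF.isTestFunction_crossDev hT0 ht htT)
  rw [lintegral_enorm_sq_eq i, e]
  apply ENNReal.ofReal_le_ofReal
  refine add_le_add (hF.integral_crossDev_sq_le hT ht htT) ?_
  rw [← sq_abs]
  exact pow_le_pow_left₀ (abs_nonneg _)
    (abs_integral_le_integral_abs.trans (hF.integral_abs_crossDev_le hT ht htT)) 2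

/-- The number of entries and exits has mean `2 T m` and variance at most `4 T m`. -/
lemma lintegral_linearStat_ends_sub_sq_le [IsProbabilityMeasure P] {T : ℝ} (hT : 0 ≤ T) :
    ∫⁻ ω, ‖linearStat z (ends A a b T) ω - 2 * T * m‖ₑ ^ 2 ∂P ≤ ENNReal.ofReal (4 * T * m) := by
  have ht := hF.isTestFunction_ends T
  obtain ⟨i2, e2⟩ := h.integral_linearStat_sq ht
  obtain ⟨i1, e1⟩ := h.integral_linearStat ht
  rw [hF.integral_ends hT] at e1 e2
  have e : ∀ ω, (linearStat z (ends A a b T) ω - 2 * T * m) ^ 2 =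
      linearStat z (ends A a b T) ω ^ 2 - (4 * T * m * linearStat z (ends A a b T) ω -
        (2 * T * m) ^ 2) := fun ω => by ring
  have i3 : Integrable (fun ω => 4 * T * m * linearStat z (ends A a b T) ω - (2 * T * m) ^ 2) P :=
    (i1.const_mul (4 * T * m)).sub (integrable_const ((2 * T * m) ^ 2))
  have i : Integrable (fun ω => (linearStat z (ends A a b T) ω - 2 * T * m) ^ 2) P := by
    simp only [e]; exact i2.sub i3
  rw [lintegral_enorm_sq_eq i]
  apply ENNReal.ofReal_le_ofReal
  simp only [e]
  rw [integral_sub i2 i3, integral_sub (i1.const_mul (4 * T * m)) (integrable_const _), e2,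
    integral_const_mul, e1]
  have := hF.integral_ends_sq_le hT
  simp
  nlinarith

lemma lintegral_errBound_sq_le [IsProbabilityMeasure P] {T t H : ℝ} (hT : 1 ≤ T) (ht : 0 < t)
    (htH : t ≤ H) (hHT : H ≤ T / 2) :
    ∫⁻ ω, errBound A a b z ρ T t ω ^ 2 ∂P ≤ ENNReal.ofReal
      (8 * (6 * (ρ + 3 * ρ ^ 2) / T ^ 2 + 2 * (6 * m + 2 * c) * H / T +
        (6 * m + 2 * c) ^ 2 * H ^ 2 + 16 * m ^ 2 * H / T)) := by
  have hT0 : 0 < T := by linarith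
  have hm := hF.rate_nonneg
  have hc := hF.short_nonneg
  have hρ := hF.mean_nonneg
  have scale : ∀ {k C D : ℝ} {X : Ω → ℝ≥0∞}, 0 ≤ k → k ^ 2 * C ≤ D →
      ∫⁻ ω, X ω ^ 2 ∂P ≤ ENNReal.ofReal C →
      ∫⁻ ω, (ENNReal.ofReal k * X ω) ^ 2 ∂P ≤ ENNReal.ofReal D := by
    intro k C D X hk hD hX
    simp only [mul_pow, ← ENNReal.ofReal_pow hk]
    rw [lintegral_const_mul' _ _ ENNReal.ofReal_ne_top]
    refine (mul_le_mul_right hX _).trans ?_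
    rw [← ENNReal.ofReal_mul (by positivity)]
    exact ENNReal.ofReal_le_ofReal hD
  have en : ∀ u w : ℝ, u ≤ w → ∫⁻ ω, energy A a b z ρ (Set.Ioc u w) ω ^ 2 ∂P ≤
      ENNReal.ofReal ((w - u) ^ 2 * (ρ + 3 * ρ ^ 2)) := fun u w huw => by
    refine (lintegral_energy_sq_le hF h _).trans (le_of_eq ?_)
    rw [Real.volume_Ioc, ENNReal.ofReal_mul (sq_nonneg _), ENNReal.ofReal_pow (by linarith)]
  set σ := ρ + 3 * ρ ^ 2
  set D := 6 * m + 2 * c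
  have hσ : 0 ≤ σ := by positivity
  have hD : 0 ≤ D := by positivity
  have b1 := scale (D := 4 * σ / T ^ 2) (by positivity : 0 ≤ 2 / T ^ 2)
    (le_of_eq (by field_simp; ring)) (en 0 T hT0.le)
  have b2 := scale (D := σ / T ^ 2) (by positivity : 0 ≤ 1 / (t * T))
    (le_of_eq (by field_simp; ring)) (en 0 t ht.le)
  have b3 := scale (D := σ / T ^ 2) (by positivity : 0 ≤ 1 / (t * T))
    (le_of_eq (by field_simp; ring)) (en (T - t) T (by linarith))
  have b4 := scale (D := 2 * D * H / T + D ^ 2 * H ^ 2) (by positivity : 0 ≤ 1 / t)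
    (by
      have : (1 / t) ^ 2 * (2 * t / T * (D * t ^ 2) + (D * t ^ 2) ^ 2) =
        2 * D * t / T + D ^ 2 * t ^ 2 := by field_simp
      rw [this]; gcongr)
    (lintegral_linearStat_crossDev_sq_le hF h hT ht.le (by linarith))
  have b5 := scale (D := 16 * m ^ 2 * H / T) (by positivity : 0 ≤ 1 / (t * T))
    (by
      have : (1 / (t * T)) ^ 2 * (16 * m ^ 2 * t ^ 3 * T) = 16 * m ^ 2 * t / T := by field_simp
      rw [this]; gcongr)
    (lintegral_integral_offDiag_sq_le hF h ht.le (by linarith))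
  have m1 : Measurable fun ω => ENNReal.ofReal (2 / T ^ 2) *
      energy A a b z ρ (Set.Ioc 0 T) ω :=
    measurable_const.mul (measurable_energy hF h measurable_const measurable_const measurable_id)
  have m2 : Measurable fun ω => ENNReal.ofReal (1 / (t * T)) *
      energy A a b z ρ (Set.Ioc 0 t) ω :=
    measurable_const.mul (measurable_energy hF h measurable_const measurable_const measurable_id)
  have m3 : Measurable fun ω => ENNReal.ofReal (1 / (t * T)) *
      energy A a b z ρ (Set.Ioc (T - t) T) ω :=
    measurable_const.mul (measurable_energy hF h measurable_const measurable_const measurable_id)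
  have m4 : Measurable fun ω => ENNReal.ofReal (1 / t) * ‖linearStat z (crossDev A a b T t) ω‖ₑ :=
    measurable_const.mul
      ((measurable_linearStat_crossDev hF h T).comp measurable_prodMk_left).enorm
  have add2 : ∀ {X X' : Ω → ℝ≥0∞} {C C' : ℝ}, 0 ≤ C → 0 ≤ C' → Measurable X →
      ∫⁻ ω, X ω ^ 2 ∂P ≤ ENNReal.ofReal C → ∫⁻ ω, X' ω ^ 2 ∂P ≤ ENNReal.ofReal C' →
      ∫⁻ ω, (X ω + X' ω) ^ 2 ∂P ≤ ENNReal.ofReal (2 * C + 2 * C') := by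
    intro X X' C C' hC hC' hX h1 h2
    refine (lintegral_mono fun ω => add_sq_le_two_mul (X ω) (X' ω)).trans ?_
    rw [lintegral_add_left ((hX.pow_const 2).const_mul 2), lintegral_const_mul' _ _ (by simp),
      lintegral_const_mul' _ _ (by simp), ENNReal.ofReal_add (by positivity) (by positivity),
      ENNReal.ofReal_mul zero_le_two, ENNReal.ofReal_mul zero_le_two, ENNReal.ofReal_ofNat]
    gcongr
  have hH : 0 ≤ H := by linarith
  have := add2 (by positivity) (by positivity) (m1.add (m2.add m3))
    (add2 (by positivity) (by positivity) m1 b1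
      (add2 (by positivity) (by positivity) m2 b2 b3))
    (add2 (by positivity) (by positivity) m4 b4 b5)
  refine this.trans (ENNReal.ofReal_le_ofReal ?_)
  have p1 : 0 ≤ σ / T ^ 2 := by positivity
  have p2 : 0 ≤ D * H / T := by positivity
  have p3 : 0 ≤ D ^ 2 * H ^ 2 := by positivity
  have p4 : 0 ≤ m ^ 2 * H / T := by positivity
  have e1 : 4 * σ / T ^ 2 = 4 * (σ / T ^ 2) := by ring
  have e2 : 6 * σ / T ^ 2 = 6 * (σ / T ^ 2) := by ring
  have e3 : 2 * D * H / T = 2 * (D * H / T) := by ring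
  have e4 : 16 * m ^ 2 * H / T = 16 * (m ^ 2 * H / T) := by ring
  rw [e1, e2, e3, e4]
  linarith

end Flow

/-! ### Expansion of the covariance estimator along a path -/

section Path

variable {Z Ω : Type*} [MeasurableSpace Z] [MeasurableSpace Ω] {A : Set Z} {a b : Z → ℝ}
  {Λ : Measure Z} {m c ρ : ℝ} {P : Measure Ω} {z : ℤ → Ω → Z}

omit [MeasurableSpace Z] [MeasurableSpace Ω] in
lemma ends_eq_zero_of_notMem_visitors (hab : ∀ x, a x ≤ b x) {T : ℝ} {x : Z}
    (hx : x ∉ visitors A a b T) : ends A a b T x = 0 := by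
  by_cases hA : x ∈ A
  · rw [ends, Set.indicator_of_mem hA,
      Set.indicator_of_notMem fun h => hx ⟨hA, h.2, h.1.le.trans (hab x)⟩,
      Set.indicator_of_notMem fun h => hx ⟨hA, (hab x).trans h.2, h.1.le⟩, add_zero]
  · rw [ends, Set.indicator_of_notMem hA]

omit [MeasurableSpace Z] [MeasurableSpace Ω] in
lemma linearStat_eq_sum {T : ℝ} {ω : Ω} (hfin : {j | z j ω ∈ visitors A a b T}.Finite) {f : Z → ℝ}
    (hf : ∀ x, x ∉ visitors A a b T → f x = 0) :
    linearStat z f ω = ∑ j ∈ hfin.toFinset, f (z j ω) :=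
  tsum_eq_sum fun _ hj => hf _ fun h => hj (hfin.mem_toFinset.2 h)

omit [MeasurableSpace Z] [MeasurableSpace Ω] in
lemma abs_dev_le {T s : ℝ} {ω : Ω} (hfin : {j | z j ω ∈ visitors A a b T}.Finite)
    (hs : s ∈ Set.Icc 0 T) : |dev A a b z ρ s ω| ≤ hfin.toFinset.card + |ρ| := by
  rw [dev, linearStat_eq_sum hfin fun x hx => occ_eq_zero_of_notMem_visitors hs.1 hs.2 hx]
  refine (abs_sub _ _).trans (add_le_add_left ?_ _)
  refine (Finset.abs_sum_le_sum_abs _ _).trans ?_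
  refine (Finset.sum_le_card_nsmul _ _ 1 fun j _ => ?_).trans (by simp)
  rcases occ_eq_zero_or_one (A := A) (a := a) (b := b) s (z j ω) with h | h <;> simp [h]

omit [MeasurableSpace Z] [MeasurableSpace Ω] in
lemma linearStat_incr {T t s : ℝ} {ω : Ω} (hfin : {j | z j ω ∈ visitors A a b T}.Finite)
    (ht : 0 ≤ t) (hs : s ∈ Set.Ioc 0 (T - t)) :
    linearStat z (incr A a b t s) ω = dev A a b z ρ (s + t) ω - dev A a b z ρ s ω := by
  rw [dev, dev, linearStat_eq_sum hfin fun x hx => incr_eq_zero_of_notMem_visitors ht hs hx,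
    linearStat_eq_sum hfin fun x hx =>
      occ_eq_zero_of_notMem_visitors (by linarith [hs.1]) (by linarith [hs.2]) hx,
    linearStat_eq_sum hfin fun x hx =>
      occ_eq_zero_of_notMem_visitors hs.1.le (by linarith [hs.2]) hx]
  simp only [incr, Finset.sum_sub_distrib]
  ring

omit [MeasurableSpace Ω] in
lemma linearStat_cross_eq (hF : IsTransitFlow Λ A a b m c ρ) {T t : ℝ} {ω : Ω}
    (hfin : {j | z j ω ∈ visitors A a b T}.Finite) (ht : 0 ≤ t) : linearStat z (cross A a b T t) ω =
      ∫ s in Set.Ioc 0 (T - t), ∑ j ∈ hfin.toFinset, incr A a b t s (z j ω) ^ 2 := by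
  rw [linearStat_eq_sum hfin fun x hx => cross_eq_zero_of_notMem_visitors ht hx,
    integral_finsetSum]
  · rfl
  · intro j _
    refine Measure.integrableOn_of_bounded (M := 1) (by simp) ?_ (ae_of_all _ fun s => ?_)
    · exact ((hF.measurable_incr measurable_const measurable_id
        measurable_const).pow_const 2).aestronglyMeasurable
    · rw [Real.norm_of_nonneg (sq_nonneg _)]; exact incr_sq_le_one _ _ _

variable (hF : IsTransitFlow Λ A a b m c ρ) (h : HasPoissonMoments P Λ z)
include hF h

lemma integrableOn_dev_mul_dev {T u w e f : ℝ} {ω : Ω}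
    (hfin : {j | z j ω ∈ visitors A a b T}.Finite)
    (he : ∀ s ∈ Set.Ioc u w, s + e ∈ Set.Icc 0 T) (hf : ∀ s ∈ Set.Ioc u w, s + f ∈ Set.Icc 0 T) :
    IntegrableOn (fun s => dev A a b z ρ (s + e) ω * dev A a b z ρ (s + f) ω) (Set.Ioc u w) := by
  refine Measure.integrableOn_of_bounded (M := (hfin.toFinset.card + |ρ|) ^ 2) (by simp)
    ((measurable_dev hF h (by fun_prop) measurable_const).mul
      (measurable_dev hF h (by fun_prop) measurable_const)).aestronglyMeasurable ?_
  filter_upwards [ae_restrict_mem measurableSet_Ioc] with s hs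
  rw [norm_mul, sq]
  exact mul_le_mul (abs_dev_le hfin (he s hs)) (abs_dev_le hfin (hf s hs)) (norm_nonneg _)
    (by positivity)

lemma integrableOn_dev_sq {T u w : ℝ} {ω : Ω} (hfin : {j | z j ω ∈ visitors A a b T}.Finite)
    (hu : 0 ≤ u) (hw : w ≤ T) :
    IntegrableOn (fun s => dev A a b z ρ s ω ^ 2) (Set.Ioc u w) := by
  have hs : ∀ s ∈ Set.Ioc u w, s + 0 ∈ Set.Icc 0 T := fun s hs =>
    ⟨by linarith [hs.1], by linarith [hs.2]⟩
  have := integrableOn_dev_mul_dev hF h hfin hs hs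
  simpa only [add_zero, ← sq] using this

lemma energy_eq_ofReal {T u w : ℝ} {ω : Ω} (hfin : {j | z j ω ∈ visitors A a b T}.Finite)
    (hu : 0 ≤ u) (hw : w ≤ T) : energy A a b z ρ (Set.Ioc u w) ω =
      ENNReal.ofReal (∫ s in Set.Ioc u w, dev A a b z ρ s ω ^ 2) := by
  rw [ofReal_integral_eq_lintegral_ofReal (integrableOn_dev_sq hF h hfin hu hw)
    (ae_of_all _ fun _ => sq_nonneg _), energy]
  refine lintegral_congr fun s => ?_
  rw [Real.enorm_eq_ofReal (sq_nonneg _)]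

/-- The polarization `2 M(s) M(s + t) = M(s)² + M(s + t)² - (M(s + t) - M(s))²`, integrated, with
the squared increments split into their diagonal and off-diagonal parts. -/
lemma integral_dev_mul_dev {T t : ℝ} {ω : Ω} (hfin : {j | z j ω ∈ visitors A a b T}.Finite)
    (ht : 0 ≤ t) (htT : t ≤ T) :
    2 * ∫ s in Set.Ioc 0 (T - t), dev A a b z ρ s ω * dev A a b z ρ (s + t) ω =
      2 * (∫ s in Set.Ioc 0 T, dev A a b z ρ s ω ^ 2) -
        ((∫ s in Set.Ioc 0 t, dev A a b z ρ s ω ^ 2) +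
          ∫ s in Set.Ioc (T - t) T, dev A a b z ρ s ω ^ 2) -
        (∫ s in Set.Ioc 0 (T - t), offDiag A a b z t s ω) - linearStat z (cross A a b T t) ω := by
  have hs0 : ∀ s ∈ Set.Ioc 0 (T - t), s + 0 ∈ Set.Icc 0 T := fun s hs =>
    ⟨by linarith [hs.1], by linarith [hs.2]⟩
  have hst : ∀ s ∈ Set.Ioc 0 (T - t), s + t ∈ Set.Icc 0 T := fun s hs =>
    ⟨by linarith [hs.1], by linarith [hs.2]⟩
  have i1 : IntegrableOn (fun s => dev A a b z ρ s ω ^ 2) (Set.Ioc 0 (T - t)) :=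
    integrableOn_dev_sq hF h hfin le_rfl (by linarith)
  have i2 : IntegrableOn (fun s => dev A a b z ρ (s + t) ω ^ 2) (Set.Ioc 0 (T - t)) := by
    simpa only [← sq] using integrableOn_dev_mul_dev hF h hfin hst hst
  have i3 : IntegrableOn (fun s => dev A a b z ρ s ω * dev A a b z ρ (s + t) ω)
      (Set.Ioc 0 (T - t)) := by
    simpa only [add_zero] using integrableOn_dev_mul_dev hF h hfin hs0 hst
  have i4 : IntegrableOn (fun s => ∑ j ∈ hfin.toFinset, incr A a b t s (z j ω) ^ 2)
      (Set.Ioc 0 (T - t)) := by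
    refine integrable_finsetSum _ fun j _ =>
      Measure.integrableOn_of_bounded (M := 1) (by simp) ?_ (ae_of_all _ fun s => ?_)
    · exact ((hF.measurable_incr measurable_const measurable_id
        measurable_const).pow_const 2).aestronglyMeasurable
    · rw [Real.norm_of_nonneg (sq_nonneg _)]; exact incr_sq_le_one _ _ _
  have hoff : ∫ s in Set.Ioc 0 (T - t), offDiag A a b z t s ω =
      (∫ s in Set.Ioc 0 (T - t), dev A a b z ρ s ω ^ 2) +
        (∫ s in Set.Ioc 0 (T - t), dev A a b z ρ (s + t) ω ^ 2) -
        2 * (∫ s in Set.Ioc 0 (T - t), dev A a b z ρ s ω * dev A a b z ρ (s + t) ω) -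
        linearStat z (cross A a b T t) ω := by
    rw [linearStat_cross_eq hF hfin ht, ← integral_const_mul, ← integral_add i1 i2,
      ← integral_sub (i1.fun_add i2) (i3.const_mul 2),
      ← integral_sub ((i1.fun_add i2).fun_sub (i3.const_mul 2)) i4]
    refine setIntegral_congr_fun measurableSet_Ioc fun s hs => ?_
    simp only [offDiag]
    rw [linearStat_incr (ρ := ρ) hfin ht hs, linearStat_eq_sum hfin fun x hx => by
      rw [incr_eq_zero_of_notMem_visitors ht hs hx]; ring]
    ring
  have split : ∀ u, 0 ≤ u → u ≤ T → (∫ s in Set.Ioc 0 T, dev A a b z ρ s ω ^ 2) =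
      (∫ s in Set.Ioc 0 u, dev A a b z ρ s ω ^ 2) +
        ∫ s in Set.Ioc u T, dev A a b z ρ s ω ^ 2 := fun u hu huT => by
    rw [← Set.Ioc_union_Ioc_eq_Ioc hu huT]
    exact setIntegral_union (Set.Ioc_disjoint_Ioc_of_le le_rfl) measurableSet_Ioc
      (integrableOn_dev_sq hF h hfin le_rfl huT) (integrableOn_dev_sq hF h hfin hu le_rfl)
  have shift : ∫ s in Set.Ioc 0 (T - t), dev A a b z ρ (s + t) ω ^ 2 =
      ∫ s in Set.Ioc t T, dev A a b z ρ s ω ^ 2 := by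
    rw [← intervalIntegral.integral_of_le (by linarith), ← intervalIntegral.integral_of_le htT,
      intervalIntegral.integral_comp_add_right fun s => dev A a b z ρ s ω ^ 2]
    simp
  have s1 := split t ht htT
  have s2 := split (T - t) (by linarith) (by linarith)
  rw [shift] at hoff
  linarith

/-- Near the origin the covariance estimator is affine up to an error of smaller order; its slope
is determined by the number of entries and exits. -/
lemma enorm_covEstimator_sub_le {T t : ℝ} {ω : Ω}
    (hfin : {j | z j ω ∈ visitors A a b T}.Finite) (ht : 0 < t) (htT : t ≤ T / 2) :
    ‖covEstimator ρ T (fun s => linearStat z (occ A a b s) ω) t -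
        ((∫ s in Set.Ioc 0 T, dev A a b z ρ s ω ^ 2) / T -
          t * linearStat z (ends A a b T) ω / (2 * T))‖ₑ ≤
      ENNReal.ofReal t * errBound A a b z ρ T t ω := by
  have hT : 0 < T := by linarith
  have hTt : 0 < T - t := by linarith
  have key := integral_dev_mul_dev hF h hfin ht.le (by linarith)
  have hcov : covEstimator ρ T (fun s => linearStat z (occ A a b s) ω) t =
      1 / (T - t) * ∫ s in Set.Ioc 0 (T - t), dev A a b z ρ s ω * dev A a b z ρ (s + t) ω := by
    rw [covEstimator, intervalIntegral.integral_of_le hTt.le]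
    simp only [dev, add_comm t]
  have hdev : linearStat z (crossDev A a b T t) ω =
      linearStat z (cross A a b T t) ω / (2 * (T - t)) -
        t * linearStat z (ends A a b T) ω / (2 * T) := by
    have h1 : ∀ x, x ∉ visitors A a b T → cross A a b T t x = 0 := fun x hx =>
      cross_eq_zero_of_notMem_visitors ht.le hx
    have h2 : ∀ x, x ∉ visitors A a b T → ends A a b T x = 0 := fun x hx =>
      ends_eq_zero_of_notMem_visitors hF.le hx
    rw [linearStat_eq_sum hfin h1, linearStat_eq_sum hfin h2,
      linearStat_eq_sum hfin fun x hx => by rw [crossDev, h1 x hx, h2 x hx]; simp]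
    simp only [crossDev, Finset.sum_sub_distrib, ← Finset.sum_div, ← Finset.mul_sum]
  have hQ : 0 ≤ ∫ s in Set.Ioc 0 T, dev A a b z ρ s ω ^ 2 :=
    integral_nonneg fun _ => sq_nonneg _
  have hE1 : 0 ≤ ∫ s in Set.Ioc 0 t, dev A a b z ρ s ω ^ 2 :=
    integral_nonneg fun _ => sq_nonneg _
  have hE2 : 0 ≤ ∫ s in Set.Ioc (T - t) T, dev A a b z ρ s ω ^ 2 :=
    integral_nonneg fun _ => sq_nonneg _
  rw [errBound, energy_eq_ofReal hF h hfin le_rfl le_rfl,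
    energy_eq_ofReal hF h hfin le_rfl (by linarith : t ≤ T),
    energy_eq_ofReal hF h hfin (by linarith : 0 ≤ T - t) le_rfl, hcov]
  generalize (∫ s in Set.Ioc 0 T, dev A a b z ρ s ω ^ 2) = Q at *
  generalize (∫ s in Set.Ioc 0 t, dev A a b z ρ s ω ^ 2) = E1 at *
  generalize (∫ s in Set.Ioc (T - t) T, dev A a b z ρ s ω ^ 2) = E2 at *
  generalize (∫ s in Set.Ioc 0 (T - t), dev A a b z ρ s ω * dev A a b z ρ (s + t) ω) = I at *
  generalize (∫ s in Set.Ioc 0 (T - t), offDiag A a b z t s ω) = U at *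
  generalize linearStat z (cross A a b T t) ω = X at *
  generalize linearStat z (ends A a b T) ω = n at *
  rw [hdev]
  simp only [Real.enorm_eq_ofReal_abs]
  repeat rw [← ENNReal.ofReal_mul (by positivity)]
  repeat rw [← ENNReal.ofReal_add (by positivity) (by positivity)]
  rw [← ENNReal.ofReal_mul ht.le]
  apply ENNReal.ofReal_le_ofReal
  have hid : 1 / (T - t) * I - (Q / T - t * n / (2 * T)) =
      Q * (t / (T * (T - t))) - (E1 + E2) / (2 * (T - t)) - U / (2 * (T - t)) -
        (X / (2 * (T - t)) - t * n / (2 * T)) := by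
    have : I = (2 * Q - (E1 + E2) - U - X) / 2 := by linarith
    rw [this]; field_simp; ring
  have hinv : 1 / (2 * (T - t)) ≤ 1 / T := one_div_le_one_div_of_le hT (by linarith)
  have q1 : |Q * (t / (T * (T - t)))| ≤ 2 * t / T ^ 2 * Q := by
    rw [abs_of_nonneg (by positivity), mul_comm]
    gcongr ?_ * Q
    rw [div_le_div_iff₀ (by positivity) (by positivity)]
    nlinarith [mul_pos ht hT]
  have q2 : |(E1 + E2) / (2 * (T - t))| ≤ 1 / T * E1 + 1 / T * E2 := by
    rw [abs_of_nonneg (by positivity), div_eq_mul_one_div, mul_comm, ← mul_add]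
    gcongr
  have q3 : |U / (2 * (T - t))| ≤ 1 / T * |U| := by
    rw [abs_div, abs_of_pos (by positivity : 0 < 2 * (T - t)), div_eq_mul_one_div, mul_comm]
    gcongr
  rw [hid]
  set Y := X / (2 * (T - t)) - t * n / (2 * T)
  have hY : t * (2 / T ^ 2 * Q + (1 / (t * T) * E1 + 1 / (t * T) * E2) +
      (1 / t * |Y| + 1 / (t * T) * |U|)) =
      2 * t / T ^ 2 * Q + (1 / T * E1 + 1 / T * E2) + 1 / T * |U| + |Y| := by
    field_simp; ring
  rw [hY]
  refine (abs_sub _ _).trans (add_le_add_left ((abs_sub _ _).trans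
    (add_le_add ((abs_sub _ _).trans (add_le_add q1 q2)) q3)) _)

end Path

/-! ### The mean squared error for a flow of transits -/

section Risk

/-- The measure `x |K(x)| dx` on `(0, 1]`. -/
noncomputable def kernelMeasure (K : ℝ → ℝ) : Measure ℝ :=
  (volume.restrict (Set.Ioc 0 1)).withDensity fun x => ‖K x‖ₑ * ENNReal.ofReal x

section Kernel

variable {K : ℝ → ℝ} (hK : IsKernel K)
include hK

lemma IsKernel.integrableOn_Ioc : IntegrableOn K (Set.Ioc 0 1) :=
  hK.integrableOn.mono_set Set.Ioc_subset_Icc_self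

lemma IsKernel.integrableOn_mul : IntegrableOn (fun x => x * K x) (Set.Ioc 0 1) := by
  refine hK.integrableOn_Ioc.bdd_mul (c := 1) measurable_id.aestronglyMeasurable ?_
  filter_upwards [ae_restrict_mem measurableSet_Ioc] with x hx
  exact (Real.norm_of_nonneg hx.1.le).trans_le hx.2

lemma IsKernel.aemeasurable_density :
    AEMeasurable (fun x => ‖K x‖ₑ * ENNReal.ofReal x) (volume.restrict (Set.Ioc 0 1)) :=
  hK.integrableOn_Ioc.aestronglyMeasurable.enorm.mul ENNReal.measurable_ofReal.aemeasurable

lemma IsKernel.lintegral_kernelMeasure {f : ℝ → ℝ≥0∞} (hf : Measurable f) :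
    ∫⁻ x, f x ∂kernelMeasure K = ∫⁻ x in Set.Ioc 0 1, ‖K x‖ₑ * ENNReal.ofReal x * f x :=
  lintegral_withDensity_eq_lintegral_mul₀ hK.aemeasurable_density hf.aemeasurable

lemma IsKernel.kernelMeasure_univ_ne_top : kernelMeasure K Set.univ ≠ ∞ := by
  rw [kernelMeasure, withDensity_apply _ MeasurableSet.univ, Measure.restrict_univ]
  refine ne_top_of_le_ne_top hK.integrableOn_mul.hasFiniteIntegral.ne
    (setLIntegral_mono' measurableSet_Ioc fun x hx => le_of_eq ?_)
  rw [enorm_mul, Real.enorm_eq_ofReal hx.1.le, mul_comm]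

/-- The kernel annihilates constants and extracts the slope of an affine function. -/
lemma IsKernel.enorm_integral_add_slope_le {H Q q : ℝ} (hH : 0 < H) {R : ℝ → ℝ} {B : ℝ → ℝ≥0∞}
    (hR : AEStronglyMeasurable (fun x => R (H * x)) (volume.restrict (Set.Ioc 0 1)))
    (hB : Measurable B)
    (hRB : ∀ t ∈ Set.Ioc 0 H, ‖R t - (Q - t * q)‖ₑ ≤ ENNReal.ofReal t * B t) :
    ‖1 / H ^ 2 * (∫ t in (0 : ℝ)..H, K (t / H) * R t) + q‖ₑ ≤
      ∫⁻ x, B (H * x) ∂kernelMeasure K := by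
  rcases eq_or_ne (∫⁻ x, B (H * x) ∂kernelMeasure K) ∞ with hB' | hB'
  · rw [hB']; exact le_top
  let err : ℝ → ℝ := fun x => R (H * x) - (Q - H * x * q)
  have herr : ∫⁻ x in Set.Ioc 0 1, ‖K x * err x‖ₑ ≤
      ENNReal.ofReal H * ∫⁻ x, B (H * x) ∂kernelMeasure K := by
    rw [hK.lintegral_kernelMeasure (f := fun x => B (H * x)) (hB.comp (measurable_const_mul H)),
      ← lintegral_const_mul' _ _ ENNReal.ofReal_ne_top]
    refine setLIntegral_mono' measurableSet_Ioc fun x hx => ?_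
    rw [enorm_mul]
    refine (mul_le_mul_right (hRB (H * x) ⟨mul_pos hH hx.1,
      mul_le_of_le_one_right hH.le hx.2⟩) _).trans (le_of_eq ?_)
    rw [ENNReal.ofReal_mul hH.le]
    ring
  have hi : IntegrableOn (fun x => K x * err x) (Set.Ioc 0 1) := by
    refine ⟨hK.integrableOn_Ioc.aestronglyMeasurable.mul (hR.sub ?_),
      herr.trans_lt (ENNReal.mul_lt_top ENNReal.ofReal_lt_top hB'.lt_top)⟩
    exact Measurable.aestronglyMeasurable (by fun_prop)
  have i1 := hK.integrableOn_Ioc.const_mul Q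
  have i2 := hK.integrableOn_mul.const_mul (H * q)
  have k0 := hK.integral_eq_zero
  have k1 := hK.integral_mul_eq_one
  rw [intervalIntegral.integral_of_le zero_le_one] at k0 k1
  have hint : ∫ t in (0 : ℝ)..H, K (t / H) * R t =
      H * ((∫ x in Set.Ioc 0 1, K x * err x) - H * q) := by
    have e1 : ∀ t, K (t / H) * R t = (fun x => K x * R (H * x)) (t / H) := fun t => by
      simp only [mul_div_cancel₀ t hH.ne']
    simp only [e1]
    rw [intervalIntegral.integral_comp_div (fun x => K x * R (H * x)) hH.ne', zero_div,
      div_self hH.ne', intervalIntegral.integral_of_le zero_le_one, smul_eq_mul]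
    have e2 : ∀ x, K x * R (H * x) = K x * err x + Q * K x - H * q * (x * K x) :=
      fun x => by simp only [err]; ring
    simp only [e2]
    rw [integral_sub (hi.fun_add i1) i2, integral_add hi i1, integral_const_mul,
      integral_const_mul, k0, k1]
    ring
  have hid : 1 / H ^ 2 * (∫ t in (0 : ℝ)..H, K (t / H) * R t) + q =
      1 / H * ∫ x in Set.Ioc 0 1, K x * err x := by
    rw [hint]
    field_simp
    ring
  rw [hid, enorm_mul, Real.enorm_eq_ofReal (by positivity : 0 ≤ 1 / H)]
  refine (mul_le_mul_right ((enorm_integral_le_lintegral_enorm _).trans herr) _).trans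
    (le_of_eq ?_)
  rw [← mul_assoc, ← ENNReal.ofReal_mul (by positivity), one_div_mul_cancel hH.ne',
    ENNReal.ofReal_one, one_mul]

end Kernel

variable {Z Ω : Type*} [MeasurableSpace Z] [MeasurableSpace Ω] {A : Set Z} {a b : Z → ℝ}
  {Λ : Measure Z} {m c ρ : ℝ} {P : Measure Ω} {z : ℤ → Ω → Z} {K : ℝ → ℝ}
  (hF : IsTransitFlow Λ A a b m c ρ) (h : HasPoissonMoments P Λ z) (hK : IsKernel K)
include hF h

lemma measurable_errBound_left (T : ℝ) (ω : Ω) : Measurable fun t => errBound A a b z ρ T t ω := by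
  have h1 : Measurable fun t : ℝ => (t, ω) := measurable_id.prodMk measurable_const
  have h2 := (measurable_errBound hF h T).comp h1
  exact h2

lemma aestronglyMeasurable_covEstimator {T H : ℝ} (hH : 0 ≤ H) (hHT : H ≤ T) (ω : Ω) :
    AEStronglyMeasurable
      (fun x => covEstimator ρ T (fun s => linearStat z (occ A a b s) ω) (H * x))
      (volume.restrict (Set.Ioc 0 1)) := by
  have hd : Measurable fun s => dev A a b z ρ s ω := measurable_dev hF h measurable_id
    measurable_const
  have hmeas : Measurable fun t => 1 / (T - t) * ∫ s,
      {q : ℝ × ℝ | 0 < q.2 ∧ q.2 ≤ T - q.1}.indicator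
        (fun q => dev A a b z ρ q.2 ω * dev A a b z ρ (q.1 + q.2) ω) (t, s) := by
    refine Measurable.mul (by fun_prop) (StronglyMeasurable.integral_prod_right'
      (f := fun q : ℝ × ℝ => {q : ℝ × ℝ | 0 < q.2 ∧ q.2 ≤ T - q.1}.indicator
        (fun q => dev A a b z ρ q.2 ω * dev A a b z ρ (q.1 + q.2) ω) q) ?_).measurable
    refine (Measurable.indicator ?_ ?_).stronglyMeasurable
    · exact (hd.comp measurable_snd).mul (hd.comp (measurable_fst.add measurable_snd))
    · exact (measurableSet_lt measurable_const measurable_snd).inter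
        (measurableSet_le measurable_snd (by fun_prop))
  refine (hmeas.comp (measurable_const_mul H)).aestronglyMeasurable.congr ?_
  filter_upwards [ae_restrict_mem measurableSet_Ioc] with x hx
  have hx1 : H * x ≤ T := (mul_le_of_le_one_right hH hx.2).trans hHT
  rw [covEstimator, intervalIntegral.integral_of_le (by linarith),
    ← integral_indicator measurableSet_Ioc]
  rfl

include hK

/-- The error of the mean speed estimator, along a path, is dominated by the fluctuation of
the number of entries and exits: the kernel annihilates the constant term of the expansion of
the covariance estimator and extracts its slope. -/
lemma enorm_meanSpeedEstimator_sub_le {d : ℕ} {r T H : ℝ} {ω : Ω}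
    (hfin : {j | z j ω ∈ visitors A a b T}.Finite) (hρ : 0 < ρ) (hH : 0 < H) (hHT : H ≤ T / 2)
    {W : ℝ} (hW : W = r * ProbabilityTheory.beta (((d : ℝ) + 1) / 2) (1 / 2)) (hW0 : 0 < W) :
    ‖meanSpeedEstimator d r ρ K H T (fun s => linearStat z (occ A a b s) ω) - W / ρ * m‖ₑ ≤
      ENNReal.ofReal (W / ρ) * (ENNReal.ofReal (1 / (2 * T)) *
        ‖linearStat z (ends A a b T) ω - 2 * T * m‖ₑ +
          ∫⁻ x, errBound A a b z ρ T (H * x) ω ∂kernelMeasure K) := by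
  have hT : 0 < T := by linarith
  have hB := measurable_errBound_left hF h T ω
  have hR := aestronglyMeasurable_covEstimator hF h hH.le (by linarith : H ≤ T) ω
  have hRB : ∀ t ∈ Set.Ioc 0 H, ‖covEstimator ρ T (fun s => linearStat z (occ A a b s) ω) t -
      ((∫ s in Set.Ioc 0 T, dev A a b z ρ s ω ^ 2) / T -
        t * (linearStat z (ends A a b T) ω / (2 * T)))‖ₑ ≤
      ENNReal.ofReal t * errBound A a b z ρ T t ω := fun t ht => by
    rw [← mul_div_assoc]
    exact enorm_covEstimator_sub_le hF h hfin ht.1 (ht.2.trans hHT)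
  have key := hK.enorm_integral_add_slope_le hH hR hB hRB
  have hid : meanSpeedEstimator d r ρ K H T (fun s => linearStat z (occ A a b s) ω) - W / ρ * m =
      W / ρ * (1 / (2 * T) * (linearStat z (ends A a b T) ω - 2 * T * m) -
        (1 / H ^ 2 * (∫ t in (0 : ℝ)..H, K (t / H) *
          covEstimator ρ T (fun s => linearStat z (occ A a b s) ω) t) +
            linearStat z (ends A a b T) ω / (2 * T))) := by
    rw [meanSpeedEstimator, ← hW]
    generalize (∫ t in (0 : ℝ)..H, K (t / H) *
      covEstimator ρ T (fun s => linearStat z (occ A a b s) ω) t) = I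
    field_simp
    ring
  rw [hid, enorm_mul, Real.enorm_eq_ofReal (by positivity : 0 ≤ W / ρ)]
  refine mul_le_mul_right (enorm_sub_le.trans (add_le_add (le_of_eq ?_) key)) _
  rw [enorm_mul, Real.enorm_eq_ofReal (by positivity : 0 ≤ 1 / (2 * T))]

lemma lintegral_meanSpeedEstimator_sub_sq_le [SigmaFinite Λ] [IsProbabilityMeasure P] {d : ℕ}
    {r T H : ℝ} (hρ : 0 < ρ) (hT : 1 ≤ T) (hH : 0 < H) (hHT : H ≤ T / 2)
    {W : ℝ} (hW : W = r * ProbabilityTheory.beta (((d : ℝ) + 1) / 2) (1 / 2)) (hW0 : 0 < W) :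
    ∫⁻ ω, ‖meanSpeedEstimator d r ρ K H T (fun s => linearStat z (occ A a b s) ω) -
        W / ρ * m‖ₑ ^ 2 ∂P ≤
      ENNReal.ofReal (2 * (W / ρ) ^ 2 * (m / T + (kernelMeasure K Set.univ).toReal ^ 2 *
        (8 * (6 * (ρ + 3 * ρ ^ 2) / T ^ 2 + 2 * (6 * m + 2 * c) * H / T +
        (6 * m + 2 * c) ^ 2 * H ^ 2 + 16 * m ^ 2 * H / T)))) := by
  have hT0 : 0 < T := by linarith
  have hm := hF.rate_nonneg
  have hc := hF.short_nonneg
  set η := 8 * (6 * (ρ + 3 * ρ ^ 2) / T ^ 2 + 2 * (6 * m + 2 * c) * H / T +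
        (6 * m + 2 * c) ^ 2 * H ^ 2 + 16 * m ^ 2 * H / T) with hη
  have hη0 : 0 ≤ η := by positivity
  set κ := (kernelMeasure K Set.univ).toReal with hκ
  have hκ' : kernelMeasure K Set.univ = ENNReal.ofReal κ :=
    (ENNReal.ofReal_toReal hK.kernelMeasure_univ_ne_top).symm
  have : IsFiniteMeasure (kernelMeasure K) := ⟨hK.kernelMeasure_univ_ne_top.lt_top⟩
  let X : Ω → ℝ≥0∞ := fun ω => ENNReal.ofReal (1 / (2 * T)) *
    ‖linearStat z (ends A a b T) ω - 2 * T * m‖ₑ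
  let X' : Ω → ℝ≥0∞ := fun ω => ∫⁻ x, errBound A a b z ρ T (H * x) ω ∂kernelMeasure K
  have hX : Measurable X := measurable_const.mul
    ((h.measurable_linearStat (hF.measurable_ends T)).sub_const _).enorm
  have b1 : ∫⁻ ω, X ω ^ 2 ∂P ≤ ENNReal.ofReal (m / T) := by
    simp only [X, mul_pow]
    rw [lintegral_const_mul' _ _ (by simp), ← ENNReal.ofReal_pow (by positivity)]
    refine (mul_le_mul_right (lintegral_linearStat_ends_sub_sq_le hF h hT0.le) _).trans ?_
    rw [← ENNReal.ofReal_mul (by positivity)]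
    exact ENNReal.ofReal_le_ofReal (le_of_eq (by field_simp; ring))
  have b2 : ∫⁻ ω, X' ω ^ 2 ∂P ≤ ENNReal.ofReal (κ ^ 2 * η) := by
    have hmeas : Measurable (Function.uncurry fun (x : ℝ) (ω : Ω) =>
        errBound A a b z ρ T (H * x) ω) :=
      (measurable_errBound hF h T).comp ((measurable_fst.const_mul H).prodMk measurable_snd)
    refine (lintegral_sq_lintegral_le hmeas (η := ENNReal.ofReal η) ?_).trans (le_of_eq ?_)
    · refine (withDensity_absolutelyContinuous _ _).ae_le ?_
      filter_upwards [ae_restrict_mem measurableSet_Ioc] with x hx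
      exact lintegral_errBound_sq_le hF h hT (mul_pos hH hx.1)
        (mul_le_of_le_one_right hH.le hx.2) hHT
    · rw [hκ', ← ENNReal.ofReal_pow ENNReal.toReal_nonneg, ← ENNReal.ofReal_mul (sq_nonneg _)]
  calc ∫⁻ ω, ‖meanSpeedEstimator d r ρ K H T (fun s => linearStat z (occ A a b s) ω) -
        W / ρ * m‖ₑ ^ 2 ∂P
      ≤ ∫⁻ ω, ENNReal.ofReal (W / ρ) ^ 2 * (2 * X ω ^ 2 + 2 * X' ω ^ 2) ∂P := by
        refine lintegral_mono_ae ?_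
        filter_upwards [h.ae_finite (hF.measurableSet_visitors T) (hF.visitors_ne_top T)]
          with ω hω
        refine (pow_le_pow_left' (enorm_meanSpeedEstimator_sub_le hF h hK hω hρ hH hHT hW hW0)
          2).trans ?_
        rw [mul_pow]
        gcongr
        exact add_sq_le_two_mul (X ω) (X' ω)
    _ = ENNReal.ofReal (W / ρ) ^ 2 * (2 * ∫⁻ ω, X ω ^ 2 ∂P + 2 * ∫⁻ ω, X' ω ^ 2 ∂P) := by
        rw [lintegral_const_mul' _ _ (by simp), lintegral_add_left ((hX.pow_const 2).const_mul 2),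
          lintegral_const_mul' _ _ (by simp), lintegral_const_mul' _ _ (by simp)]
    _ ≤ ENNReal.ofReal (W / ρ) ^ 2 *
          (2 * ENNReal.ofReal (m / T) + 2 * ENNReal.ofReal (κ ^ 2 * η)) := by gcongr
    _ = ENNReal.ofReal (2 * (W / ρ) ^ 2 * (m / T + κ ^ 2 * η)) := by
        rw [← mul_add, ← ENNReal.ofReal_add (by positivity) (by positivity),
          ← ENNReal.ofReal_pow (by positivity), ← ENNReal.ofReal_ofNat 2,
          ← ENNReal.ofReal_mul (by norm_num), ← ENNReal.ofReal_mul (by positivity)]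
        congr 1; ring

end Risk

/-! ### The class of speed distributions -/

section SpeedClass

variable {L : ℝ} {F : Measure ℝ}

lemma speedClass_ae_pos (hF : F ∈ speedClass L) : ∀ᵐ x ∂F, 0 < x := by
  obtain ⟨-, f, -, rfl, -, -⟩ := hF
  exact (withDensity_absolutelyContinuous _ _).ae_le (ae_restrict_mem measurableSet_Ioi)

lemma lintegral_sq_le_of_mem_speedClass (hF : F ∈ speedClass L) :
    ∫⁻ x, ENNReal.ofReal (x ^ 2) ∂F ≤ ENNReal.ofReal L := by
  obtain ⟨-, f, hf0, rfl, hfd, hl⟩ := hF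
  have hfm : AEMeasurable (fun x => ENNReal.ofReal (f x)) (volume.restrict (Set.Ioi 0)) := by
    have : ContinuousOn f (Set.Ioi 0) := fun x hx => (hfd x hx).continuousAt.continuousWithinAt
    exact (this.aemeasurable measurableSet_Ioi).ennreal_ofReal
  rw [lintegral_withDensity_eq_lintegral_mul₀ hfm (by fun_prop)]
  refine le_trans (setLIntegral_mono' measurableSet_Ioi fun x hx => le_of_eq ?_)
    (hl 0 zero_le_one).2
  rw [iteratedDeriv_zero, abs_of_nonneg (hf0 x hx), Pi.mul_apply,
    ← ENNReal.ofReal_mul (hf0 x hx), zero_add, mul_comm]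

/-- A density in the class has mass at most `L` on each of `(0, 1]` and `(1, ∞)`. -/
lemma one_le_two_mul_of_mem_speedClass (hL : 0 ≤ L) (hF : F ∈ speedClass L) : 1 ≤ 2 * L := by
  have hP : IsProbabilityMeasure F := hF.1
  have h2 := lintegral_sq_le_of_mem_speedClass hF
  have hpos := speedClass_ae_pos hF
  have htail : F (Set.Ioi 1) ≤ ENNReal.ofReal L := by
    refine le_trans ?_ h2
    rw [← lintegral_indicator_one measurableSet_Ioi]
    refine lintegral_mono fun x => ?_
    by_cases hx : x ∈ Set.Ioi (1 : ℝ)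
    · rw [Set.indicator_of_mem hx, Pi.one_apply, ENNReal.one_le_ofReal]
      exact one_le_pow₀ (le_of_lt hx)
    · rw [Set.indicator_of_notMem hx]; exact zero_le
  have hhead : F (Set.Ioc 0 1) ≤ ENNReal.ofReal L := by
    obtain ⟨-, f, hf0, rfl, hfd, hl⟩ := hF
    rw [withDensity_apply _ measurableSet_Ioc, Measure.restrict_restrict measurableSet_Ioc,
      Set.inter_eq_left.2 fun x hx => hx.1]
    refine (setLIntegral_mono' (g := fun _ => ENNReal.ofReal L) measurableSet_Ioc
      fun x hx => ENNReal.ofReal_le_ofReal ?_).trans (by simp)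
    have h3 := (hl 0 zero_le_one).1 x hx.1
    rw [iteratedDeriv_zero, abs_of_nonneg (hf0 x hx.1), zero_add] at h3
    nlinarith [mul_nonneg (sq_nonneg x) (hf0 x hx.1)]
  have h1 : (1 : ℝ≥0∞) ≤ ENNReal.ofReal (2 * L) := by
    calc (1 : ℝ≥0∞) = F (Set.Ioi 0) :=
          ((prob_compl_eq_zero_iff measurableSet_Ioi).1 hpos).symm
      _ ≤ F (Set.Ioc 0 1) + F (Set.Ioi 1) := by
          rw [← Set.Ioc_union_Ioi_eq_Ioi (zero_le_one' ℝ)]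
          exact measure_union_le _ _
      _ ≤ ENNReal.ofReal L + ENNReal.ofReal L := add_le_add hhead htail
      _ = ENNReal.ofReal (2 * L) := by rw [← ENNReal.ofReal_add hL hL, two_mul]
  exact ENNReal.one_le_ofReal.1 h1

end SpeedClass

/-! ### From particle systems to transits -/

section Motion

variable {Ω : Type u} [MeasurableSpace Ω] {d : ℕ} {lam r : ℝ}
  {G : Measure (EuclideanSpace ℝ (Fin d))} {P : Measure Ω}
  {ξ v : ℤ → Ω → EuclideanSpace ℝ (Fin d)}

lemma IsUndeviatedMotion.isProbabilityMeasure_velocity (hM : IsUndeviatedMotion lam G P ξ v) :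
    IsProbabilityMeasure G := by
  have := hM.isProbabilityMeasure
  rw [← hM.law_velocity 0]
  exact Measure.isProbabilityMeasure_map (hM.measurable_velocity 0).aemeasurable

lemma IsUndeviatedMotion.hasPoissonMoments (hM : IsUndeviatedMotion lam G P ξ v)
    (hlam : 0 ≤ lam) : HasPoissonMoments P (intensity lam G) fun j ω => (ξ j ω, v j ω) :=
  ⟨fun j => (hM.poisson.measurable j).prodMk (hM.measurable_velocity j),
    hM.factorialMoment hlam⟩

omit [MeasurableSpace Ω] in
lemma count_toReal_eq (hr : 0 ≤ r) {ω : Ω} (hv : ∀ j, v j ω ≠ 0) (t : ℝ) :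
    (count r ξ v ω t).toReal = linearStat (fun j ω => (ξ j ω, v j ω))
      (occ (hitSet r) (entryTime r) (exitTime r) t) ω := by
  have h1 : ∀ j, (Metric.closedBall (0 : EuclideanSpace ℝ (Fin d)) r).indicator
      (fun _ => (1 : ℝ≥0∞)) (ξ j ω + t • v j ω) ≠ ∞ := fun j => by
    by_cases hx : ξ j ω + t • v j ω ∈ Metric.closedBall (0 : EuclideanSpace ℝ (Fin d)) r
    · rw [Set.indicator_of_mem hx]; exact ENNReal.one_ne_top
    · rw [Set.indicator_of_notMem hx]; exact ENNReal.zero_ne_top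
  rw [count, ENNReal.tsum_toReal_eq h1, linearStat]
  refine tsum_congr fun j => ?_
  have h2 := mem_closedBall_iff_mem_transit hr (hv j) t (x := ξ j ω)
  rw [occ_eq_indicator]
  set S : Set (EuclideanSpace ℝ (Fin d) × EuclideanSpace ℝ (Fin d)) :=
    {x | x ∈ hitSet r ∧ entryTime r x ≤ t ∧ t ≤ exitTime r x}
  by_cases hx : ξ j ω + t • v j ω ∈ Metric.closedBall (0 : EuclideanSpace ℝ (Fin d)) r
  · rw [Set.indicator_of_mem hx, Set.indicator_of_mem (s := S) (h2.1 hx)]; simp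
  · rw [Set.indicator_of_notMem hx, Set.indicator_of_notMem (s := S) fun h => hx (h2.2 h)]; simp

lemma ae_velocity_ne_zero {L : ℝ} (hG : G.map (fun w => ‖w‖) ∈ speedClass L) :
    ∀ᵐ w ∂G, w ≠ 0 := by
  filter_upwards [ae_of_ae_map measurable_norm.aemeasurable (speedClass_ae_pos hG)] with w hw
  exact norm_pos_iff.1 hw

lemma integral_speed_sq_le {L : ℝ} (hL : 0 ≤ L) (hG : G.map (fun w => ‖w‖) ∈ speedClass L) :
    Integrable (fun w => ‖w‖ ^ 2) G ∧ ∫ w, ‖w‖ ^ 2 ∂G ≤ L := by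
  have h := lintegral_sq_le_of_mem_speedClass hG
  rw [lintegral_map (by fun_prop) measurable_norm] at h
  have hm : Measurable fun w : EuclideanSpace ℝ (Fin d) => ‖w‖ ^ 2 := by fun_prop
  constructor
  · refine ⟨hm.aestronglyMeasurable, ?_⟩
    rw [hasFiniteIntegral_iff_ofReal (ae_of_all _ fun _ => sq_nonneg _)]
    exact h.trans_lt ENNReal.ofReal_lt_top
  · rw [integral_eq_lintegral_of_nonneg_ae (ae_of_all _ fun _ => sq_nonneg _)
      hm.aestronglyMeasurable]
    exact ENNReal.toReal_le_of_le_ofReal hL h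

lemma integral_speed_le [IsProbabilityMeasure G] {L : ℝ} (hL : 0 ≤ L)
    (hG : G.map (fun w => ‖w‖) ∈ speedClass L) :
    Integrable (fun w => ‖w‖) G ∧ ∫ w, ‖w‖ ∂G ≤ 1 + L := by
  obtain ⟨h2, h2'⟩ := integral_speed_sq_le hL hG
  have hle : ∀ w : EuclideanSpace ℝ (Fin d), ‖w‖ ≤ 1 + ‖w‖ ^ 2 := fun w => by
    nlinarith [sq_nonneg (‖w‖ - 1), norm_nonneg w]
  have hi := (integrable_const (μ := G) (1 : ℝ)).add h2
  have h1 : Integrable (fun w => ‖w‖) G :=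
    hi.mono' measurable_norm.aestronglyMeasurable (ae_of_all _ fun w => by
      rw [norm_norm]; exact hle w)
  refine ⟨h1, (integral_mono h1 hi hle).trans ?_⟩
  rw [integral_add' (integrable_const _) h2]
  simpa using h2'

end Motion

/-! ### The rate of the maximal risk -/

section Rate

lemma meanCount_pos (d : ℕ) {lam r : ℝ} (hlam : 0 < lam) (hr : 0 < r) :
    0 < meanCount d lam r :=
  mul_pos hlam (ENNReal.toReal_pos (Metric.measure_closedBall_pos _ _ hr).ne'
    measure_closedBall_lt_top.ne)

lemma eLpNorm_two_le_sqrt {Ω : Type*} [MeasurableSpace Ω] {P : Measure Ω} {X : Ω → ℝ} {c : ℝ}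
    (hc : 0 ≤ c) (h : ∫⁻ ω, ‖X ω‖ₑ ^ 2 ∂P ≤ ENNReal.ofReal c) :
    eLpNorm X 2 P ≤ ENNReal.ofReal √c := by
  rw [eLpNorm_eq_lintegral_rpow_enorm_toReal two_ne_zero ENNReal.ofNat_ne_top, Real.sqrt_eq_rpow,
    ← ENNReal.ofReal_rpow_of_nonneg hc (by norm_num)]
  simp only [ENNReal.toReal_ofNat, ENNReal.rpow_ofNat]
  exact ENNReal.rpow_le_rpow h (by norm_num)

/-- A bound for the part of `T` times the mean squared error that is not due to the number of
entries and exits. Here `w` is the factor that turns the entry rate into the mean speed, `κ` is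
the mass of `kernelMeasure`, `m` bounds the entry rate, `c` the rate of short transits, and `H` is
the bandwidth. -/
noncomputable def riskRemainder (w κ ρ m c H T : ℝ) : ℝ :=
  2 * w ^ 2 * (κ ^ 2 * (8 * (6 * (ρ + 3 * ρ ^ 2) / T + 2 * (6 * m + 2 * c) * H +
    (6 * m + 2 * c) ^ 2 * (T * H ^ 2) + 16 * m ^ 2 * H)))

lemma riskRemainder_nonneg {w κ ρ m c H T : ℝ} (hρ : 0 ≤ ρ) (hm : 0 ≤ m) (hc : 0 ≤ c)
    (hH : 0 ≤ H) (hT : 0 ≤ T) : 0 ≤ riskRemainder w κ ρ m c H T := by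
  unfold riskRemainder; positivity

lemma tendsto_riskRemainder {w κ ρ m c : ℝ} {H : ℝ → ℝ} (hH : Tendsto H atTop (nhds 0))
    (hTH : Tendsto (fun T => T * H T ^ 2) atTop (nhds 0)) :
    Tendsto (fun T => riskRemainder w κ ρ m c (H T) T) atTop (nhds 0) := by
  have h1 : Tendsto (fun T : ℝ => 6 * (ρ + 3 * ρ ^ 2) / T) atTop (nhds 0) :=
    tendsto_const_nhds.div_atTop tendsto_id
  have := (((((h1.add (hH.const_mul (2 * (6 * m + 2 * c)))).add
    (hTH.const_mul ((6 * m + 2 * c) ^ 2))).add (hH.const_mul (16 * m ^ 2))).const_mul 8).const_mul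
      (κ ^ 2)).const_mul (2 * w ^ 2)
  simpa [riskRemainder] using this

lemma sqrt_mul_maxRisk_le {d : ℕ} (hd : 1 ≤ d) {lam r L : ℝ} (hlam : 0 < lam) (hr : 0 < r)
    (hL : 0 < L) {K : ℝ → ℝ} (hK : IsKernel K) {H T : ℝ} (hT : 1 ≤ T) (hH : 0 < H)
    (hHT : H ≤ T / 2) {β : ℝ} (hβ : β = ProbabilityTheory.beta (((d : ℝ) + 1) / 2) (1 / 2)) :
    ENNReal.ofReal √T * maxRisk.{u} d lam r L K H T ≤
      ENNReal.ofReal √(4 * β * r * (L * (1 + L)) / meanCount d lam r +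
        riskRemainder (r * β / meanCount d lam r) (kernelMeasure K Set.univ).toReal
          (meanCount d lam r) (lam * crossSection d r * (1 + L))
          (lam * crossSection d r * (d / (2 * r)) * L) H T) := by
  have hT0 : 0 < T := by linarith
  have hρ := meanCount_pos d hlam hr
  have hκ := crossSection_pos d hr
  have hβ0 : 0 < β := hβ ▸ beta_pos (by positivity) (by norm_num)
  set ρ := meanCount d lam r with hρdef
  set κ := (kernelMeasure K Set.univ).toReal
  set m' := lam * crossSection d r * (1 + L)
  set c' := lam * crossSection d r * (d / (2 * r)) * L
  set S := 4 * β * r * (L * (1 + L)) / ρ + riskRemainder (r * β / ρ) κ ρ m' c' H T with hS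
  have hS0 : 0 ≤ S := add_nonneg (by positivity)
    (riskRemainder_nonneg hρ.le (by positivity) (by positivity) hH.le hT0.le)
  suffices hmain : maxRisk.{u} d lam r L K H T ≤ ENNReal.ofReal √(S / T) by
    refine (mul_le_mul_right hmain _).trans (le_of_eq ?_)
    rw [← ENNReal.ofReal_mul (Real.sqrt_nonneg _), ← Real.sqrt_mul hT0.le,
      mul_div_cancel₀ _ hT0.ne']
  refine iSup₂_le fun F hFL => iSup₂_le fun G hG => iSup₂_le fun Ω _ => iSup_le fun P =>
    iSup₂_le fun ξ v => iSup_le fun hM => ?_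
  subst hG
  have := hM.isProbabilityMeasure
  have := hM.isProbabilityMeasure_velocity
  have hG0 := ae_velocity_ne_zero hFL
  obtain ⟨i2, b2⟩ := integral_speed_sq_le hL.le hFL
  obtain ⟨i1, b1⟩ := integral_speed_le hL.le hFL
  have hL2 := one_le_two_mul_of_mem_speedClass hL.le hFL
  have hflow := isTransitFlow_intensity hlam.le hr hG0 i1 i2
  have hpm := hM.hasPoissonMoments hlam.le
  rw [integral_map (f := fun x => x) measurable_norm.aemeasurable
    measurable_id.aestronglyMeasurable]
  set μ := ∫ w, ‖w‖ ∂G with hμ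
  have hμ0 : 0 ≤ μ := integral_nonneg fun _ => norm_nonneg _
  have hμL : μ ≤ 2 * (L * (1 + L)) := by nlinarith
  set m := lam * crossSection d r * μ with hm
  set c := lam * crossSection d r * (d / (2 * r)) * ∫ w, ‖w‖ ^ 2 ∂G with hc
  have hmm : m ≤ m' := mul_le_mul_of_nonneg_left b1 (by positivity)
  have hcc : c ≤ c' := mul_le_mul_of_nonneg_left b2 (by positivity)
  have hm0 := hflow.rate_nonneg
  have hc0 := hflow.short_nonneg
  -- The slope of the covariance function identifies the mean speed.
  have hslope : r * β / ρ * m = μ := by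
    have h1 := crossSection_mul_beta hd hr.le
    rw [← hβ] at h1
    have h2 : ρ = lam * (crossSection d r * (r * β)) := by rw [h1]; rfl
    rw [hm, h2]
    field_simp
  have : SigmaFinite (intensity lam G) :=
    inferInstanceAs (SigmaFinite ((ENNReal.ofReal lam • volume).prod G))
  have key := lintegral_meanSpeedEstimator_sub_sq_le hflow hpm hK (d := d) (r := r) hρ hT hH hHT
    (W := r * β) (by rw [hβ]) (by positivity)
  rw [hslope, ← hρdef] at key
  refine eLpNorm_two_le_sqrt (by positivity) ?_
  have hv : ∀ᵐ ω ∂P, ∀ j, v j ω ≠ 0 := ae_all_iff.2 fun j =>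
    ae_of_ae_map (hM.measurable_velocity j).aemeasurable (by rwa [hM.law_velocity j])
  refine le_trans (le_of_eq (lintegral_congr_ae ?_)) (key.trans (ENNReal.ofReal_le_ofReal ?_))
  · filter_upwards [hv] with ω hω
    simp only [count_toReal_eq hr.le hω, ← hρdef]
  · rw [hS, riskRemainder, add_div]
    have h1 : 2 * (r * β / ρ) ^ 2 * (m / T) ≤ 4 * β * r * (L * (1 + L)) / ρ / T := by
      have : 2 * (r * β / ρ) ^ 2 * (m / T) = 2 * (r * β / ρ) * (r * β / ρ * m) / T := by ring
      rw [this, hslope]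
      gcongr
      calc 2 * (r * β / ρ) * μ ≤ 2 * (r * β / ρ) * (2 * (L * (1 + L))) := by gcongr
        _ = 4 * β * r * (L * (1 + L)) / ρ := by ring
    have h2 : κ ^ 2 * (8 * (6 * (ρ + 3 * ρ ^ 2) / T ^ 2 + 2 * (6 * m + 2 * c) * H / T +
        (6 * m + 2 * c) ^ 2 * H ^ 2 + 16 * m ^ 2 * H / T)) ≤
        κ ^ 2 * (8 * (6 * (ρ + 3 * ρ ^ 2) / T ^ 2 + 2 * (6 * m' + 2 * c') * H / T +
        (6 * m' + 2 * c') ^ 2 * H ^ 2 + 16 * m' ^ 2 * H / T)) := by gcongr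
    rw [mul_add]
    refine add_le_add h1 ((mul_le_mul_of_nonneg_left h2 (by positivity)).trans (le_of_eq ?_))
    field_simp

end Rate

end Smoluchowski

theorem mainTheorem3 (d : ℕ) (hd : 1 ≤ d) :
    ∃ C : ℝ, 0 < C ∧
      ∀ (lam r L : ℝ), 0 < lam → 0 < r → 0 < L →
      ∀ K : ℝ → ℝ, Smoluchowski.IsKernel K →
      ∀ h : ℝ → ℝ,
        (∀ᶠ T : ℝ in atTop,
          (Real.log T) ^ 2 / T ≤ h T ∧ h T ≤ 1 / (Real.sqrt T * Real.log T)) →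
        limsup (fun T : ℝ =>
            ENNReal.ofReal (Real.sqrt T) * Smoluchowski.maxRisk.{u} d lam r L K (h T) T) atTop
          ≤ ENNReal.ofReal
              (C * Real.sqrt (1 + 1 / Smoluchowski.meanCount d lam r) *
                Real.sqrt (L * (1 + L) * r)) := by
  obtain ⟨β, hβ⟩ : ∃ β, β = ProbabilityTheory.beta (((d : ℝ) + 1) / 2) (1 / 2) := ⟨_, rfl⟩
  have hβ0 : 0 < β := hβ ▸ beta_pos (by positivity) (by norm_num)
  refine ⟨√(4 * β), by positivity, fun lam r L hlam hr hL K hK h hh => ?_⟩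
  have hρ := Smoluchowski.meanCount_pos d hlam hr
  -- For `T ≥ e` the two bounds on the bandwidth give `0 < h T ≤ T / 2`.
  have hev : ∀ᶠ T : ℝ in atTop, 1 ≤ T ∧ 0 < h T ∧ h T ≤ T / 2 ∧ h T ≤ 1 / Real.log T ∧
      T * h T ^ 2 ≤ 1 / Real.log T := by
    filter_upwards [hh, eventually_ge_atTop (Real.exp 1), eventually_ge_atTop 2] with T hT hTe hT2
    have hlog : 1 ≤ Real.log T := (Real.le_log_iff_exp_le (by linarith)).2 hTe
    have hs : 1 ≤ √T := Real.one_le_sqrt.2 (by linarith)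
    have hpos : 0 < h T := lt_of_lt_of_le (by positivity) hT.1
    have h1 : h T ≤ 1 / Real.log T := hT.2.trans
      (one_div_le_one_div_of_le (by linarith) (by nlinarith))
    have h2 : 1 / Real.log T ≤ 1 := by rw [div_le_one (by linarith)]; exact hlog
    refine ⟨by linarith, hpos, by linarith, h1, ?_⟩
    calc T * h T ^ 2 ≤ T * (1 / (√T * Real.log T)) ^ 2 := by
          gcongr
          · exact hT.2
      _ = 1 / Real.log T * (1 / Real.log T) := by
          rw [div_pow, mul_pow, Real.sq_sqrt (by linarith)]
          field_simp
      _ ≤ 1 / Real.log T := mul_le_of_le_one_right (by positivity) h2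
  have hlim : Tendsto (fun T => 1 / Real.log T) atTop (nhds 0) :=
    tendsto_const_nhds.div_atTop Real.tendsto_log_atTop
  have hH : Tendsto h atTop (nhds 0) := squeeze_zero' (hev.mono fun T hT => hT.2.1.le)
    (hev.mono fun T hT => hT.2.2.2.1) hlim
  have hTH : Tendsto (fun T => T * h T ^ 2) atTop (nhds 0) := squeeze_zero'
    (hev.mono fun T hT => mul_nonneg (by linarith [hT.1]) (sq_nonneg _))
    (hev.mono fun T hT => hT.2.2.2.2) hlim
  set D := 4 * β * r * (L * (1 + L)) / Smoluchowski.meanCount d lam r with hD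
  have htend := (ENNReal.tendsto_ofReal (((Smoluchowski.tendsto_riskRemainder
    (w := r * β / Smoluchowski.meanCount d lam r)
    (κ := (Smoluchowski.kernelMeasure K Set.univ).toReal) (ρ := Smoluchowski.meanCount d lam r)
    (m := lam * Smoluchowski.crossSection d r * (1 + L))
    (c := lam * Smoluchowski.crossSection d r * (d / (2 * r)) * L) hH hTH).const_add D).sqrt))
  calc limsup (fun T : ℝ =>
        ENNReal.ofReal (Real.sqrt T) * Smoluchowski.maxRisk.{u} d lam r L K (h T) T) atTop
      ≤ _ := limsup_le_limsup (hev.mono fun T hT =>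
        Smoluchowski.sqrt_mul_maxRisk_le hd hlam hr hL hK hT.1 hT.2.1 hT.2.2.1 hβ)
    _ = ENNReal.ofReal √(D + 0) := htend.limsup_eq
    _ ≤ _ := by
        apply ENNReal.ofReal_le_ofReal
        rw [add_zero, ← Real.sqrt_mul (by positivity), ← Real.sqrt_mul (by positivity)]
        apply Real.sqrt_le_sqrt
        have : 0 ≤ 4 * β * (L * (1 + L) * r) := by positivity
        calc D = 4 * β * (1 / Smoluchowski.meanCount d lam r) * (L * (1 + L) * r) := by
              rw [hD]; ring
          _ ≤ 4 * β * (1 + 1 / Smoluchowski.meanCount d lam r) * (L * (1 + L) * r) := by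
              linarith
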